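/- **Conventions.** One-mode Fock space has orthonormal basis $\{|n\rangle\}_{n\ge 0}$; $Q=a+a^\dagger$, $P=-i(a-a^\dagger)$ (so the vacuum has variance matrix $1\!\!1_2$), $\sigma_3=\mathrm{diag}(1,-1)$, and $\chi(\xi;\rho)=\mathrm{Tr}[\rho\,e^{i(\xi_1Q+\xi_2P)}]$ for $\xi\in\mathbb R^2$ and trace-class $\rho$. The one-mode Gaussian channel with real matrices $(X,Y)$ is the completely positive trace-preserving linear map $\Phi$ on trace-class operators with $\chi(\xi;\Phi[\rho])=\chi(X\xi;\rho)\,e^{-\frac12\xi^TY\xi}$ for all $\rho$ and $\xi$. Consider - the attenuator $\mathcal C_1(\kappa,\alpha)$: $(X,Y)=(\kappa 1\!\!1,\alpha1\!\!1)$, $0<\kappa<1$, $\alpha\ge 1-\kappa^2$; - the amplifier $\mathcal C_2(\kappa,\alpha)$: $(X,Y)=(\kappa 1\!\!1,\alpha1\!\!1)$, $\kappa>1$, $\alpha\ge\kappa^2-1$; - the phase conjugation channel $\mathcal D(\kappa,\alpha)$: $(X,Y)=(\kappa\sigma_3,\alpha1\!\!1)$, $\kappa>0$, $\alpha\ge\kappa^2+1$.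 Equality in the condition on $\alpha$ is the quantum-limited case and strict inequality the noisy case; both are covered. In each case the Gaussian channel exists and is unique. **Coefficients.** For $m_1\ge\max\{0,n_1-n_2\}$ put $$h[s,t]=\sum_{k=\max\{0,n_1-m_1\}}^{\min\{n_1,n_2\}}\Big[\tfrac{n_1!\,(n_2+m_1-n_1)!}{n_2!\,m_1!}\Big]^{1/2}\binom{n_2}{k}\binom{m_1}{n_1-k}(-1)^k\,s^{\,n_1+n_2-2k+1}\,t^{\,2k+m_1-n_1},$$ and for $0\le m_2\le n_1+n_2$ put $$h_c[s,c]=\sum_{k=\max\{0,m_2-n_2\}}^{\min\{n_1,m_2\}}\Big[\tfrac{(n_1+n_2-m_2)!\,m_2!}{n_1!\,n_2!}\Big]^{1/2}\binom{n_1}{k}\binom{n_2}{m_2-k}(-1)^{k}\,s^{\,2k+n_2-m_2}\,c^{\,n_1+m_2-2k}.$$ Let (with $0^0=1$) $$\gamma_b[\mu_0]=\Big[\tfrac{2}{\alpha+1-\kappa^2}\Big]^{1/2}\Big[\tfrac{\alpha+\kappa^2-1}{\alpha+1-\kappa^2}\Big]^{n_1/2}h\big[\sqrt{1-\kappa^2},\,\kappa\big],\qquad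 \gamma_a[\mu_0]=\Big[\tfrac{2}{\alpha+\kappa^2-1}\Big]^{1/2}\Big[\tfrac{\alpha-\kappa^2+1}{\alpha+\kappa^2-1}\Big]^{n_2/2}h\big[\tfrac{\sqrt{\kappa^2-1}}{\kappa},\,\tfrac1\kappa\big],$$ $$\gamma_c[\theta_0]=\Big[\tfrac{2}{\alpha+\kappa^2+1}\Big]^{1/2}\Big[\tfrac{\alpha-\kappa^2-1}{\alpha+\kappa^2+1}\Big]^{n_2/2}h_c\big[\tfrac{-1}{\sqrt{1+\kappa^2}},\,\tfrac{\kappa}{\sqrt{1+\kappa^2}}\big].$$ **Claim 1 (Kraus operators).** For $n_1,n_2=0,1,2,\dots$ let $$B_{n_1,n_2}=\sum_{m_1\ge\max\{0,n_1-n_2\}}\gamma_b[\mu_0]\,|m_1\rangle\langle n_2+m_1-n_1|,\qquad A_{n_1,n_2}=\sum_{m_1\ge\max\{0,n_1-n_2\}}\gamma_a[\mu_0]\,|m_1\rangle\langle n_2+m_1-n_1|,$$ $$C_{n_1,n_2}=\sum_{m_2=0}^{n_1+n_2}\gamma_c[\theta_0]\,|n_1+n_2-m_2\rangle\langle m_2|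 .$$ The series converge in operator norm, and $\{B_{n_1,n_2}\}$, $\{A_{n_1,n_2}\}$, $\{C_{n_1,n_2}\}$ are Kraus operators of $\mathcal C_1(\kappa,\alpha)$, $\mathcal C_2(\kappa,\alpha)$, $\mathcal D(\kappa,\alpha)$ respectively: writing $K_{n_1,n_2}$ for them, $\Phi(\rho)=\sum_{n_1,n_2}K_{n_1,n_2}\,\rho\,K_{n_1,n_2}^\dagger$ in trace norm for every trace-class $\rho$, and $\sum_{n_1,n_2}K_{n_1,n_2}^\dagger K_{n_1,n_2}=1\!\!1$ strongly. **Claim 2 (origin).** For $r\ge 0$ let $|\Psi_r\rangle=\mathrm{sech}\,r\sum_j(\tanh r)^j|j\,j\rangle$ and $\hat\sigma(r)=(\Phi\otimes 1\!\!1)(|\Psi_r\rangle\langle\Psi_r|)$. For attenuator and amplifier let $$S=\begin{pmatrix}\cosh\mu\,1\!\!1_2&-\sinh\mu\,\sigma_3\\-\sinh\mu\,\sigma_3&\cosh\mu\,1\!\!1_2\end{pmatrix},\quad \tanh2\mu=\frac{2\kappa\sinh2r}{\cosh2r+\kappa^2\cosh2r+\alpha},\quad \nu^\pm=\tfrac12(z\pm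 w),$$ $z=[(\alpha+(\kappa^2+1)\cosh2r)^2-4\kappa^2\sinh^22r]^{1/2}$, $w=\alpha+(\kappa^2-1)\cosh2r$. For phase conjugation let $$S=\begin{pmatrix}\cos\theta\,1\!\!1_2&-\sin\theta\,1\!\!1_2\\\sin\theta\,1\!\!1_2&\cos\theta\,1\!\!1_2\end{pmatrix},\quad 2\theta=\arg\big(\kappa^2\cosh2r+\alpha-\cosh2r-2i\kappa\sinh2r\big)\in(-\pi,0],\quad \nu^\pm=\tfrac12(w\pm z),$$ $z=[(\alpha+(\kappa^2-1)\cosh2r)^2+4\kappa^2\sinh^22r]^{1/2}$, $w=\alpha+\kappa^2\cosh2r+\cosh2r$. Put $x^\pm=[(\nu^\pm-1)/(\nu^\pm+1)]^{1/2}$ and $N=\cosh^2r\,(1-(x^+)^2)(1-(x^-)^2)$. Then there is a Gaussian unitary $U_S$ implementing $S$ (that is, $U_S^\dagger e^{i\xi^TR}U_S=e^{i(S^T\xi)^TR}$ for all $\xi\in\mathbb R^4$, $R=(Q_1,P_1,Q_2,P_2)$) such that $$U_S\,\hat\sigma(r)\,U_S^\dagger=\hat\sigma_{\rm th}(\nu^+)\otimes\hat\sigma_{\rm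 th}(\nu^-),\qquad \hat\sigma_{\rm th}(\nu^\pm)=(1-(x^\pm)^2)\sum_n(x^\pm)^{2n}|n\rangle\langle n|,$$ $$\hat\sigma(r)=\mathrm{sech}^2r\sum_{n_1,n_2}|T_{n_1,n_2}(r)\rangle\langle T_{n_1,n_2}(r)|\ \text{ in trace norm},\qquad |T_{n_1,n_2}(r)\rangle=\sqrt N\,(x^+)^{n_1}(x^-)^{n_2}\,U_S^\dagger|n_1,n_2\rangle.$$ Flipping the second ket of $|T_{n_1,n_2}(r)\rangle$ to a bra gives $$T_{n_1,n_2}(r)=\sum_{m_1\ge\max\{0,n_1-n_2\}}\gamma[\mu]\,|m_1\rangle\langle n_2+m_1-n_1|,\qquad\gamma[\mu]=\sqrt N\,(x^+)^{n_1}(x^-)^{n_2}\,h[\mathrm{sech}\,\mu,\tanh\mu]$$ for attenuator and amplifier (the series converging in operator norm), and $$T_{n_1,n_2}(r)=\sum_{m_2=0}^{n_1+n_2}\gamma_c[\theta]\,|n_1+n_2-m_2\rangle\langle m_2|,\qquad\gamma_c[\theta]=\sqrt N\,(x^+)^{n_1}(x^-)^{n_2}\,h_c[\sin\theta,\cos\theta]$$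 for phase conjugation. As $r\to\infty$, $T_{n_1,n_2}(r)$ converges in operator norm to $B_{n_1,n_2}$, $A_{n_1,n_2}$, $C_{n_1,n_2}$ respectively. -/

import Mathlib

open scoped ENNReal ComplexOrder Topology
open Filter ContinuousLinearMap

noncomputable section

namespace Bosonic

/-- One-mode Fock space, with coordinates in the Fock basis. -/
abbrev Mode : Type := lp (fun _ : ℕ => ℂ) 2

/-- Two-mode Fock space, with coordinates in the product Fock basis; the first index is the
system mode and the second one the reference mode. -/
abbrev TwoMode : Type := lp (fun _ : ℕ × ℕ => ℂ) 2

/-- The Fock vector `|n⟩`. -/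
def ket (n : ℕ) : Mode := lp.single 2 n 1

/-- The Fock vector `|m, n⟩`. -/
def ket₂ (m n : ℕ) : TwoMode := lp.single 2 (m, n) 1

/-- The rank-one operator `|m⟩⟨n|`. -/
def ketBra (m n : ℕ) : Mode →L[ℂ] Mode := InnerProductSpace.rankOne ℂ (ket m) (ket n)

/-! ### Displacement operators -/

theorem memℓp_expVec (z : ℂ) :
    Memℓp (fun n : ℕ => z ^ n / (Real.sqrt (Nat.factorial n) : ℂ)) 2 := by
  refine memℓp_gen ?_
  have h : ∀ n : ℕ, ‖z ^ n / (Real.sqrt (Nat.factorial n) : ℂ)‖ ^ (2 : ℝ≥0∞).toReal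
      = (‖z‖ ^ 2) ^ n / (Nat.factorial n : ℝ) := by
    intro n
    have h0 : (0 : ℝ) ≤ (Nat.factorial n : ℝ) := by positivity
    simp only [ENNReal.toReal_ofNat, Real.rpow_ofNat, norm_div, norm_pow, div_pow,
      Complex.norm_real, Real.norm_eq_abs, sq_abs, Real.sq_sqrt h0]
    ring
  simp_rw [h]
  exact Real.summable_pow_div_factorial _

/-- The exponential vector (unnormalised coherent state) `∑ₙ zⁿ / √(n!) |n⟩`. -/
def expVec (z : ℂ) : Mode := ⟨fun n : ℕ => z ^ n / (Real.sqrt (Nat.factorial n) : ℂ), memℓp_expVec z⟩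

theorem inner_expVec (z w : ℂ) :
    inner ℂ (expVec z) (expVec w) = Complex.exp (starRingEnd ℂ z * w) := by
  rw [lp.inner_eq_tsum, Complex.exp_eq_exp_ℂ, NormedSpace.exp_eq_tsum_div]
  refine tsum_congr fun n => ?_
  have h0 : (0 : ℝ) ≤ (Nat.factorial n : ℝ) := by positivity
  have h1 : (Real.sqrt (Nat.factorial n) : ℂ) * (Real.sqrt (Nat.factorial n) : ℂ)
      = (Nat.factorial n : ℂ) := by
    rw [← Complex.ofReal_mul, Real.mul_self_sqrt h0]; simp
  simp only [expVec, RCLike.inner_apply, map_div₀, map_pow, Complex.conj_ofReal]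
  rw [div_mul_div_comm, h1, mul_pow, mul_comm]

/-- The image `e^{-|β|²/2 - β̄ z} expVec (z + β)` of `expVec z` under the displacement by `β`. -/
def displacedExpVec (β z : ℂ) : Mode :=
  Complex.exp (-(‖β‖ ^ 2 / 2 : ℝ) - starRingEnd ℂ β * z) • expVec (z + β)

theorem inner_displacedExpVec (β z w : ℂ) :
    inner ℂ (displacedExpVec β z) (displacedExpVec β w) = inner ℂ (expVec z) (expVec w) := by
  have hb : ((‖β‖ ^ 2 / 2 : ℝ) : ℂ) = starRingEnd ℂ β * β / 2 := by
    rw [← Complex.normSq_eq_norm_sq, Complex.ofReal_div, Complex.normSq_eq_conj_mul_self]; simp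
  simp only [displacedExpVec, inner_smul_left, inner_smul_right, inner_expVec]
  rw [hb, ← Complex.exp_conj, ← Complex.exp_add, ← Complex.exp_add]
  congr 1
  simp only [map_sub, map_neg, map_div₀, map_mul, map_add, Complex.conj_conj, map_ofNat]
  ring

/-- The finite combinations of exponential vectors. -/
def expSpan : (ℂ →₀ ℂ) →ₗ[ℂ] Mode := Finsupp.linearCombination ℂ expVec

/-- The finite combinations of displaced exponential vectors. -/
def displacedExpSpan (β : ℂ) : (ℂ →₀ ℂ) →ₗ[ℂ] Mode :=
  Finsupp.linearCombination ℂ (displacedExpVec β)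

theorem norm_displacedExpSpan (β : ℂ) (f : ℂ →₀ ℂ) :
    ‖displacedExpSpan β f‖ = ‖expSpan f‖ := by
  have h : inner ℂ (displacedExpSpan β f) (displacedExpSpan β f)
      = inner ℂ (expSpan f) (expSpan f) := by
    simp only [displacedExpSpan, expSpan, Finsupp.linearCombination_apply, Finsupp.sum,
      sum_inner, inner_sum, inner_smul_left, inner_smul_right, inner_displacedExpVec]
  rw [inner_self_eq_norm_sq_to_K, inner_self_eq_norm_sq_to_K] at h
  have h2 : ‖displacedExpSpan β f‖ ^ 2 = ‖expSpan f‖ ^ 2 := by exact_mod_cast h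
  exact (sq_eq_sq₀ (norm_nonneg _) (norm_nonneg _)).1 h2

theorem denseRange_expSpan : DenseRange expSpan := by
  have hbot : (LinearMap.range expSpan)ᗮ = ⊥ := by
    rw [Submodule.eq_bot_iff]
    intro ψ hψ
    have h0 : ∀ z : ℂ, inner ℂ (expVec z) ψ = 0 := fun z =>
      Submodule.inner_right_of_mem_orthogonal (K := LinearMap.range expSpan)
        ⟨Finsupp.single z 1, by simp [expSpan]⟩ hψ
    let p := FormalMultilinearSeries.ofScalars ℂ
      (fun n : ℕ => ψ n / (Real.sqrt (Nat.factorial n) : ℂ))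
    have hp : HasFPowerSeriesAt (0 : ℂ → ℂ) p 0 := by
      rw [hasFPowerSeriesAt_iff]
      refine Filter.Eventually.of_forall fun z => ?_
      have h1 := lp.hasSum_inner (𝕜 := ℂ) (G := fun _ : ℕ => ℂ) (expVec (starRingEnd ℂ z)) ψ
      rw [h0] at h1
      have h2 : (fun n : ℕ => (inner ℂ (expVec (starRingEnd ℂ z) n : ℂ) (ψ n : ℂ) : ℂ))
          = fun n => z ^ n • p.coeff n := by
        funext n
        simp only [expVec, p, FormalMultilinearSeries.coeff_ofScalars, RCLike.inner_apply,
          map_div₀, map_pow, Complex.conj_conj, Complex.conj_ofReal, smul_eq_mul]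
        ring
      rw [h2] at h1
      exact h1
    have hp0 := hp.eq_zero
    ext n
    have h2 : p.coeff n = 0 := by rw [hp0]; rfl
    rw [FormalMultilinearSeries.coeff_ofScalars] at h2
    have h3 : (Real.sqrt (Nat.factorial n) : ℂ) ≠ 0 := by
      rw [Complex.ofReal_ne_zero, Real.sqrt_ne_zero']
      exact_mod_cast Nat.factorial_pos n
    simpa [h3] using h2
  have h := (Submodule.topologicalClosure_eq_top_iff (K := LinearMap.range expSpan)).2 hbot
  have h' := Submodule.dense_iff_topologicalClosure_eq_top.2 h
  rwa [DenseRange, ← LinearMap.coe_range]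

/-- The displacement operator `D(β) = exp(β a† - β̄ a)`: the bounded operator which sends each
exponential vector `expVec z` to `e^{-|β|²/2 - β̄ z} expVec (z + β)`. -/
def displacement (β : ℂ) : Mode →L[ℂ] Mode := (displacedExpSpan β).extendOfNorm expSpan

theorem displacement_expVec (β z : ℂ) : displacement β (expVec z) = displacedExpVec β z := by
  have h := LinearMap.extendOfNorm_eq (f := displacedExpSpan β) (e := expSpan)
    denseRange_expSpan ⟨1, fun f => by rw [norm_displacedExpSpan, one_mul]⟩ (Finsupp.single z 1)
  simpa [expSpan, displacedExpSpan, displacement] using h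

/-! ### Tensor products of operators -/

theorem memℓp_row (ψ : TwoMode) (i : ℕ) : Memℓp (fun j : ℕ => ψ (i, j)) 2 := by
  refine memℓp_gen ?_
  exact ((lp.memℓp ψ).summable (by norm_num)).comp_injective (Prod.mk_right_injective i)

/-- The vector `∑ⱼ ψ(i,j) |j⟩` of the second mode. -/
def row (ψ : TwoMode) (i : ℕ) : Mode := ⟨fun j : ℕ => ψ (i, j), memℓp_row ψ i⟩


theorem hasSum_norm_sq {ι : Type} (x : lp (fun _ : ι => ℂ) 2) :
    HasSum (fun i => ‖x i‖ ^ 2) (‖x‖ ^ 2) := by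
  simpa using lp.hasSum_norm (p := 2) (by norm_num) x

theorem memℓp_of_summable_sq {ι : Type} {f : ι → ℂ} (h : Summable fun i => ‖f i‖ ^ 2) :
    Memℓp f 2 := by
  refine memℓp_gen ?_
  simpa using h

theorem hasSum_norm_row (ψ : TwoMode) : HasSum (fun i => ‖row ψ i‖ ^ 2) (‖ψ‖ ^ 2) :=
  (hasSum_norm_sq ψ).prod_fiberwise fun i => hasSum_norm_sq (row ψ i)

theorem summable_norm_onSecond (B : Mode →L[ℂ] Mode) (ψ : TwoMode) :
    Summable fun p : ℕ × ℕ => ‖B (row ψ p.1) p.2‖ ^ 2 := by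
  rw [summable_prod_of_nonneg fun _ => by positivity]
  refine ⟨fun i => (hasSum_norm_sq (B (row ψ i))).summable, ?_⟩
  simp_rw [fun i => (hasSum_norm_sq (B (row ψ i))).tsum_eq]
  refine Summable.of_nonneg_of_le (fun i => by positivity) (fun i => ?_)
    ((hasSum_norm_row ψ).summable.mul_left (‖B‖ ^ 2))
  rw [← mul_pow]
  exact pow_le_pow_left₀ (norm_nonneg _) (B.le_opNorm _) 2

theorem row_add (ψ φ : TwoMode) (i : ℕ) : row (ψ + φ) i = row ψ i + row φ i := rfl

theorem row_smul (c : ℂ) (ψ : TwoMode) (i : ℕ) : row (c • ψ) i = c • row ψ i := rfl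

/-- `1 ⊗ B`: the operator `B` acting on the second mode. -/
def onSecond (B : Mode →L[ℂ] Mode) : TwoMode →L[ℂ] TwoMode :=
  LinearMap.mkContinuous
    { toFun := fun ψ => ⟨fun p : ℕ × ℕ => B (row ψ p.1) p.2,
        memℓp_of_summable_sq (summable_norm_onSecond B ψ)⟩
      map_add' := fun ψ φ => by
        ext p
        simp only [row_add, map_add]
        rfl
      map_smul' := fun c ψ => by
        ext p
        simp only [row_smul, map_smul]
        rfl }
    ‖B‖ (fun ψ => by
      refine abs_le_of_sq_le_sq' ?_ (by positivity) |>.2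
      rw [mul_pow]
      refine hasSum_le (fun i => ?_) ((hasSum_norm_row _)) ((hasSum_norm_row ψ).mul_left (‖B‖ ^ 2))
      rw [← mul_pow]
      exact pow_le_pow_left₀ (norm_nonneg _) (B.le_opNorm (row ψ i)) 2)

theorem memℓp_swap (ψ : TwoMode) : Memℓp (fun p : ℕ × ℕ => ψ p.swap) 2 :=
  memℓp_of_summable_sq
    ((hasSum_norm_sq ψ).summable.comp_injective (Equiv.prodComm ℕ ℕ).injective)

/-- The vector with exchanged modes. -/
def swapVec (ψ : TwoMode) : TwoMode := ⟨fun p : ℕ × ℕ => ψ p.swap, memℓp_swap ψ⟩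

theorem norm_swapVec (ψ : TwoMode) : ‖swapVec ψ‖ = ‖ψ‖ := by
  have h1 : HasSum (fun p : ℕ × ℕ => ‖ψ p.swap‖ ^ 2) (‖ψ‖ ^ 2) :=
    (Equiv.prodComm ℕ ℕ).hasSum_iff.2 (hasSum_norm_sq ψ)
  have h2 : HasSum (fun p : ℕ × ℕ => ‖ψ p.swap‖ ^ 2) (‖swapVec ψ‖ ^ 2) :=
    hasSum_norm_sq (swapVec ψ)
  exact (sq_eq_sq₀ (norm_nonneg _) (norm_nonneg _)).1 (h2.unique h1)

/-- The exchange of the two modes, `|m, n⟩ ↦ |n, m⟩`. -/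
def swapModes : TwoMode →L[ℂ] TwoMode :=
  LinearMap.mkContinuous
    { toFun := swapVec
      map_add' := fun _ _ => rfl
      map_smul' := fun _ _ => rfl }
    1 (fun ψ => by
      rw [one_mul]
      exact (norm_swapVec ψ).le)

/-- `A ⊗ 1`: the operator `A` acting on the first mode. -/
def onFirst (A : Mode →L[ℂ] Mode) : TwoMode →L[ℂ] TwoMode :=
  swapModes ∘L onSecond A ∘L swapModes

/-- The tensor product operator `A ⊗ B`. -/
def tensorOp (A B : Mode →L[ℂ] Mode) : TwoMode →L[ℂ] TwoMode := onFirst A ∘L onSecond B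

/-! ### Trace-class operators, characteristic functions and Gaussian channels -/

/-- The trace-class operators: the complex span of the positive operators with finite trace. -/
def traceClass : Submodule ℂ (Mode →L[ℂ] Mode) :=
  Submodule.span ℂ {ρ | ρ.IsPositive ∧ Summable fun n => inner ℂ (ket n) (ρ (ket n))}

/-- The trace `∑ₙ ⟨n|T|n⟩`. -/
def trace (T : Mode →L[ℂ] Mode) : ℂ := ∑' n, inner ℂ (ket n) (T (ket n))

/-- The trace norm `sup ∑ᵢ |⟨uᵢ, T vᵢ⟩|` over finite orthonormal systems `u`, `v`. -/
def traceNorm {E : Type*} [NormedAddCommGroup E] [InnerProductSpace ℂ E] (T : E →L[ℂ] E) : ℝ≥0∞ :=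
  ⨆ (N : ℕ) (u : Fin N → E) (v : Fin N → E) (_ : Orthonormal ℂ u) (_ : Orthonormal ℂ v),
    ∑ i, ‖inner ℂ (u i) (T (v i))‖ₑ

/-- The series `∑ᵢ fᵢ` converges unconditionally to `T` in trace norm. -/
def HasTraceNormSum {ι E : Type*} [NormedAddCommGroup E] [InnerProductSpace ℂ E]
    (f : ι → E →L[ℂ] E) (T : E →L[ℂ] E) : Prop :=
  Tendsto (fun s : Finset ι => traceNorm (T - ∑ i ∈ s, f i)) atTop (𝓝 0)

/-- The Weyl operator `exp(i (ξ₀ Q + ξ₁ P))`, where `Q = a + a†` and `P = -i (a - a†)`, so that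
the vacuum has variance matrix `1`. -/
def weyl (ξ : Fin 2 → ℝ) : Mode →L[ℂ] Mode :=
  displacement (Complex.I * ((ξ 0 : ℂ) + Complex.I * (ξ 1 : ℂ)))

/-- The characteristic function `χ(ξ; ρ) = Tr (ρ exp(i (ξ₀ Q + ξ₁ P)))`. -/
def charFn (ξ : Fin 2 → ℝ) (ρ : Mode →L[ℂ] Mode) : ℂ := trace (ρ ∘L weyl ξ)

/-- `Φ` is completely positive: it maps positive block matrices of trace-class operators to
positive block matrices. -/
def IsCompletelyPositive (Φ : traceClass →ₗ[ℂ] traceClass) : Prop :=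
  ∀ (k : ℕ) (ρ : Fin k → Fin k → traceClass),
    (∀ v : Fin k → Mode, 0 ≤ ∑ i, ∑ j, inner ℂ (v i) ((ρ i j : Mode →L[ℂ] Mode) (v j))) →
    ∀ v : Fin k → Mode, 0 ≤ ∑ i, ∑ j, inner ℂ (v i) ((Φ (ρ i j) : Mode →L[ℂ] Mode) (v j))

/-- `Φ` is the one-mode Gaussian channel with transmission matrix `X` and noise matrix `Y`: a
completely positive trace-preserving map which acts on characteristic functions by
`χ(ξ; Φ ρ) = χ(X ξ; ρ) exp(-ξᵀ Y ξ / 2)`. -/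
structure IsGaussianChannel (X Y : Matrix (Fin 2) (Fin 2) ℝ)
    (Φ : traceClass →ₗ[ℂ] traceClass) : Prop where
  completelyPositive : IsCompletelyPositive Φ
  tracePreserving : ∀ ρ : traceClass,
    trace (Φ ρ : Mode →L[ℂ] Mode) = trace (ρ : Mode →L[ℂ] Mode)
  charFn_apply : ∀ (ρ : traceClass) (ξ : Fin 2 → ℝ),
    charFn ξ (Φ ρ : Mode →L[ℂ] Mode)
      = charFn (X.mulVec ξ) (ρ : Mode →L[ℂ] Mode)
        * (Real.exp (-(1 / 2) * (ξ ⬝ᵥ Y.mulVec ξ)) : ℂ)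

/-- The operators `K n₁ n₂` are Kraus operators of `Φ`: `Φ ρ = ∑ K ρ K†` in trace norm for every
trace-class `ρ`, and `∑ K† K = 1` strongly. -/
structure IsKrausRepresentation (Φ : traceClass →ₗ[ℂ] traceClass)
    (K : ℕ → ℕ → Mode →L[ℂ] Mode) : Prop where
  hasSum_apply : ∀ ρ : traceClass,
    HasTraceNormSum (fun n : ℕ × ℕ => K n.1 n.2 ∘L (ρ : Mode →L[ℂ] Mode) ∘L adjoint (K n.1 n.2))
      (Φ ρ : Mode →L[ℂ] Mode)
  resolution : ∀ ψ : Mode,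
    HasSum (fun n : ℕ × ℕ => adjoint (K n.1 n.2) (K n.1 n.2 ψ)) ψ

/-! ### Choi states and their canonical form -/

/-- The two-mode squeezed vacuum `|Ψ_r⟩ = sech r ∑ⱼ (tanh r)ʲ |j, j⟩`. -/
def squeezedVacuum (r : ℝ) : TwoMode :=
  ((Real.cosh r)⁻¹ : ℂ) • ∑' j : ℕ, ((Real.tanh r ^ j : ℝ) : ℂ) • ket₂ j j

/-- `S = (Φ ⊗ 1)(R)`: the blocks of `R` and `S` with respect to the Fock basis of the second mode
satisfy `S_{mn} = Φ(R_{mn})`. -/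
def IsOneSidedAction (Φ : traceClass →ₗ[ℂ] traceClass) (R S : TwoMode →L[ℂ] TwoMode) : Prop :=
  ∀ m n : ℕ, ∃ B : traceClass,
    (∀ i j : ℕ, inner ℂ (ket i) ((B : Mode →L[ℂ] Mode) (ket j))
      = inner ℂ (ket₂ i m) (R (ket₂ j n))) ∧
    (∀ i j : ℕ, inner ℂ (ket i) ((Φ B : Mode →L[ℂ] Mode) (ket j))
      = inner ℂ (ket₂ i m) (S (ket₂ j n)))

/-- The number `x(ν) = √((ν - 1) / (ν + 1))` attached to a symplectic eigenvalue `ν ≥ 1`. -/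
def xParam (ν : ℝ) : ℝ := Real.sqrt ((ν - 1) / (ν + 1))

/-- The thermal state `(1 - x²) ∑ₙ x²ⁿ |n⟩⟨n|`, `x = x(ν)`, with variance matrix `ν 1`. -/
def thermal (ν : ℝ) : Mode →L[ℂ] Mode :=
  ∑' n : ℕ, (((1 - xParam ν ^ 2) * xParam ν ^ (2 * n) : ℝ) : ℂ) • ketBra n n

/-- The two-mode Weyl operator. -/
def twoModeWeyl (ξ : Fin 2 ⊕ Fin 2 → ℝ) : TwoMode →L[ℂ] TwoMode :=
  tensorOp (weyl (ξ ∘ Sum.inl)) (weyl (ξ ∘ Sum.inr))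

/-- `U` is a Gaussian unitary which implements the symplectic matrix `S`: it maps the
characteristic function `χ(ξ)` of a state to `χ(Sᵀ ξ)`, and variance matrices `V` to `S V Sᵀ`. -/
structure IsGaussianUnitary (S : Matrix (Fin 2 ⊕ Fin 2) (Fin 2 ⊕ Fin 2) ℝ)
    (U : TwoMode →L[ℂ] TwoMode) : Prop where
  unitary : U ∈ unitary (TwoMode →L[ℂ] TwoMode)
  weyl_apply : ∀ ξ : Fin 2 ⊕ Fin 2 → ℝ,
    adjoint U ∘L twoModeWeyl ξ ∘L U = twoModeWeyl (S.transpose.mulVec ξ)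

/-- The operator `A` arises from the two-mode vector `v` by flipping the second ket to a bra. -/
def IsFlip (v : TwoMode) (A : Mode →L[ℂ] Mode) : Prop :=
  ∀ i j : ℕ, inner ℂ (ket i) (A (ket j)) = v (i, j)

/-- The factor `N = cosh² r (1 - x(ν₊)²) (1 - x(ν₋)²)`. -/
def normFactor (r νp νm : ℝ) : ℝ :=
  Real.cosh r ^ 2 * (1 - xParam νp ^ 2) * (1 - xParam νm ^ 2)

/-- The Choi state `σ = (Φ ⊗ 1)(|Ψ_r⟩⟨Ψ_r|)` is brought by a Gaussian unitary `U` implementing `S`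
to the product of the thermal states with parameters `νp` and `νm`; undoing `U` in the Fock
decomposition of that product gives
`σ = sech² r ∑ |t⟩⟨t|`, `|t n₁ n₂⟩ = √N x(νp)^n₁ x(νm)^n₂ U† |n₁, n₂⟩`,
and flipping the second ket of `|t n₁ n₂⟩` to a bra gives the operator `T n₁ n₂`. -/
def HasFockChoiDecomposition (Φ : traceClass →ₗ[ℂ] traceClass) (r : ℝ)
    (S : Matrix (Fin 2 ⊕ Fin 2) (Fin 2 ⊕ Fin 2) ℝ) (νp νm : ℝ)
    (T : ℕ → ℕ → Mode →L[ℂ] Mode) : Prop :=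
  ∃ (σ U : TwoMode →L[ℂ] TwoMode) (t : ℕ → ℕ → TwoMode),
    IsOneSidedAction Φ
      (InnerProductSpace.rankOne ℂ (squeezedVacuum r) (squeezedVacuum r)) σ ∧
    IsGaussianUnitary S U ∧
    U ∘L σ ∘L adjoint U = tensorOp (thermal νp) (thermal νm) ∧
    (∀ n₁ n₂, t n₁ n₂
      = ((Real.sqrt (normFactor r νp νm) * xParam νp ^ n₁ * xParam νm ^ n₂ : ℝ) : ℂ) •
          adjoint U (ket₂ n₁ n₂)) ∧
    HasTraceNormSum (fun n : ℕ × ℕ => ((Real.cosh r ^ 2)⁻¹ : ℂ) •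
      (InnerProductSpace.rankOne ℂ (t n.1 n.2) (t n.1 n.2) : TwoMode →L[ℂ] TwoMode)) σ ∧
    ∀ n₁ n₂, IsFlip (t n₁ n₂) (T n₁ n₂)

/-! ### Attenuator and amplifier: explicit data -/

/-- The Pauli matrix `σ₃`. -/
def pauli₃ : Matrix (Fin 2) (Fin 2) ℝ := !![1, 0; 0, -1]

/-- The two-mode squeezing matrix `S(μ)`. -/
def squeezeMatrix (μ : ℝ) : Matrix (Fin 2 ⊕ Fin 2) (Fin 2 ⊕ Fin 2) ℝ :=
  Matrix.fromBlocks (Real.cosh μ • 1) (-Real.sinh μ • pauli₃)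
    (-Real.sinh μ • pauli₃) (Real.cosh μ • 1)

/-- The squeezing parameter with
`tanh 2μ = 2κ sinh 2r / (cosh 2r + κ² cosh 2r + α)`. -/
def squeezeParam (κ α r : ℝ) : ℝ :=
  Real.artanh (2 * κ * Real.sinh (2 * r)
    / (Real.cosh (2 * r) + κ ^ 2 * Real.cosh (2 * r) + α)) / 2

def zAB (κ α r : ℝ) : ℝ :=
  Real.sqrt ((α + (κ ^ 2 + 1) * Real.cosh (2 * r)) ^ 2 - 4 * κ ^ 2 * Real.sinh (2 * r) ^ 2)

def wAB (κ α r : ℝ) : ℝ := α + (κ ^ 2 - 1) * Real.cosh (2 * r)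

/-- The symplectic eigenvalues `ν± = (z ± w) / 2` of the Choi state of attenuator and amplifier. -/
def nuPlusAB (κ α r : ℝ) : ℝ := (zAB κ α r + wAB κ α r) / 2

def nuMinusAB (κ α r : ℝ) : ℝ := (zAB κ α r - wAB κ α r) / 2

/-- The Fock matrix element `h[μ] = ⟨m₁, n₂ + m₁ - n₁| U_S[μ]† |n₁, n₂⟩` of two-mode squeezing, as a
function of `s = sech μ` and `t = tanh μ`, for `m₁ ≥ max {0, n₁ - n₂}`. -/
def hAB (n₁ n₂ m₁ : ℕ) (s t : ℝ) : ℝ :=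
  ∑ k ∈ Finset.Icc (n₁ - m₁) (min n₁ n₂),
    Real.sqrt ((n₁.factorial * (n₂ + m₁ - n₁).factorial : ℝ) / (n₂.factorial * m₁.factorial))
      * n₂.choose k * m₁.choose (n₁ - k) * (-1) ^ k
      * s ^ (n₁ + n₂ - 2 * k + 1) * t ^ (2 * k + m₁ - n₁)

/-- The term `c m₁ |m₁⟩⟨n₂ + m₁ - n₁|`, present for `m₁ ≥ max {0, n₁ - n₂}`. -/
def bandTerm (n₁ n₂ : ℕ) (c : ℕ → ℝ) (m₁ : ℕ) : Mode →L[ℂ] Mode :=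
  if n₁ ≤ n₂ + m₁ then (c m₁ : ℂ) • ketBra m₁ (n₂ + m₁ - n₁) else 0

/-- The operator `∑_{m₁ ≥ max {0, n₁ - n₂}} c m₁ |m₁⟩⟨n₂ + m₁ - n₁|` (sum in operator norm). -/
def bandOp (n₁ n₂ : ℕ) (c : ℕ → ℝ) : Mode →L[ℂ] Mode := ∑' m₁ : ℕ, bandTerm n₁ n₂ c m₁

/-- The coefficients `γ[μ]` at finite squeezing `r`, with `μ = μ(r, κ, α)`. -/
def gammaAB (κ α r : ℝ) (n₁ n₂ m₁ : ℕ) : ℝ :=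
  Real.sqrt (normFactor r (nuPlusAB κ α r) (nuMinusAB κ α r))
    * xParam (nuPlusAB κ α r) ^ n₁ * xParam (nuMinusAB κ α r) ^ n₂
    * hAB n₁ n₂ m₁ (Real.cosh (squeezeParam κ α r))⁻¹ (Real.tanh (squeezeParam κ α r))

/-- The limiting coefficients `γ_b[μ₀]`, where `sech μ₀ = √(1 - κ²)` and `tanh μ₀ = κ`. -/
def gammaAtt (κ α : ℝ) (n₁ n₂ m₁ : ℕ) : ℝ :=
  Real.sqrt (2 / (α + 1 - κ ^ 2)) * Real.sqrt ((α + κ ^ 2 - 1) / (α + 1 - κ ^ 2)) ^ n₁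
    * hAB n₁ n₂ m₁ (Real.sqrt (1 - κ ^ 2)) κ

/-- The limiting coefficients `γ_a[μ₀]`, where `sech μ₀ = √(κ² - 1) / κ` and `tanh μ₀ = 1 / κ`. -/
def gammaAmp (κ α : ℝ) (n₁ n₂ m₁ : ℕ) : ℝ :=
  Real.sqrt (2 / (α + κ ^ 2 - 1)) * Real.sqrt ((α - κ ^ 2 + 1) / (α + κ ^ 2 - 1)) ^ n₂
    * hAB n₁ n₂ m₁ (Real.sqrt (κ ^ 2 - 1) / κ) (1 / κ)

/-! ### Phase conjugation: explicit data -/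

/-- The beam-splitter matrix `S(θ)`. -/
def beamSplitterMatrix (θ : ℝ) : Matrix (Fin 2 ⊕ Fin 2) (Fin 2 ⊕ Fin 2) ℝ :=
  Matrix.fromBlocks (Real.cos θ • 1) (-Real.sin θ • 1) (Real.sin θ • 1) (Real.cos θ • 1)

/-- The angle `θ ∈ (-π/2, 0]` with `tan 2θ = 2κ sinh 2r / (cosh 2r - κ² cosh 2r - α)`, that is,
`2θ` is the argument of `κ² cosh 2r + α - cosh 2r - 2 i κ sinh 2r`. -/
def splitAngle (κ α r : ℝ) : ℝ :=
  Complex.arg ⟨κ ^ 2 * Real.cosh (2 * r) + α - Real.cosh (2 * r),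
    -(2 * κ * Real.sinh (2 * r))⟩ / 2

def zC (κ α r : ℝ) : ℝ :=
  Real.sqrt ((α + (κ ^ 2 - 1) * Real.cosh (2 * r)) ^ 2 + 4 * κ ^ 2 * Real.sinh (2 * r) ^ 2)

def wC (κ α r : ℝ) : ℝ := α + κ ^ 2 * Real.cosh (2 * r) + Real.cosh (2 * r)

/-- The symplectic eigenvalues `ν± = (w ± z) / 2` of the Choi state of phase conjugation. -/
def nuPlusC (κ α r : ℝ) : ℝ := (wC κ α r + zC κ α r) / 2

def nuMinusC (κ α r : ℝ) : ℝ := (wC κ α r - zC κ α r) / 2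

/-- The Fock matrix element `h_c[θ] = ⟨n₁ + n₂ - m₂, m₂| U_S[θ]† |n₁, n₂⟩` of the beam splitter, as
a function of `s = sin θ` and `c = cos θ`, for `m₂ ≤ n₁ + n₂`. -/
def hC (n₁ n₂ m₂ : ℕ) (s c : ℝ) : ℝ :=
  ∑ k ∈ Finset.Icc (m₂ - n₂) (min n₁ m₂),
    Real.sqrt (((n₁ + n₂ - m₂).factorial * m₂.factorial : ℝ) / (n₁.factorial * n₂.factorial))
      * n₁.choose k * n₂.choose (m₂ - k) * (-1) ^ k
      * s ^ (2 * k + n₂ - m₂) * c ^ (n₁ + m₂ - 2 * k)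

/-- The operator `∑_{m₂ = 0}^{n₁ + n₂} c m₂ |n₁ + n₂ - m₂⟩⟨m₂|`. -/
def antiBandOp (n₁ n₂ : ℕ) (c : ℕ → ℝ) : Mode →L[ℂ] Mode :=
  ∑ m₂ ∈ Finset.range (n₁ + n₂ + 1), (c m₂ : ℂ) • ketBra (n₁ + n₂ - m₂) m₂

/-- The coefficients `γ_c[θ]` at finite squeezing `r`, with `θ = θ(r, κ, α)`. -/
def gammaC (κ α r : ℝ) (n₁ n₂ m₂ : ℕ) : ℝ :=
  Real.sqrt (normFactor r (nuPlusC κ α r) (nuMinusC κ α r))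
    * xParam (nuPlusC κ α r) ^ n₁ * xParam (nuMinusC κ α r) ^ n₂
    * hC n₁ n₂ m₂ (Real.sin (splitAngle κ α r)) (Real.cos (splitAngle κ α r))

/-- The limiting coefficients `γ_c[θ₀]`, where `sin θ₀ = -1 / √(1 + κ²)` and
`cos θ₀ = κ / √(1 + κ²)`. -/
def gammaConj (κ α : ℝ) (n₁ n₂ m₂ : ℕ) : ℝ :=
  Real.sqrt (2 / (α + κ ^ 2 + 1)) * Real.sqrt ((α - κ ^ 2 - 1) / (α + κ ^ 2 + 1)) ^ n₂
    * hC n₁ n₂ m₂ (-1 / Real.sqrt (1 + κ ^ 2)) (κ / Real.sqrt (1 + κ ^ 2))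

end Bosonic

end

/-! Everything is tested on the exponential vectors `expVec z`, written e_z below. They are total,
displacements permute them up to scalars, and a bounded operator is determined by its kernel between
them (`eq_of_inner_expVec`). There all objects are Gaussian, and the claims become identities
between exponents.

The binomial sums enter through generating functions. By `hasSum_hC`, h_c is the coefficient array
of (cu - sz)^n₁ (su + cz)^n₂, and h is the same array with permuted indices, up to a factor s
(`hAB_eq_mul_hC`). Hence the vectors K_n e_z are encoded in Taylor coefficients of entire functions
whose values are multiples of product exponential vectors, and sums over a whole Kraus family reduce
to one summation formula of Laguerre type, `hasSum_inner_coeff`.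

Two sums are needed for each Kraus family. The first, ∑ ⟨K_n e_w, D(β) K_n e_z⟩, is the dual map
applied to a Weyl operator. At β = 0 it says that the K_n are the components of an isometry into a
direct sum of Fock spaces, so ρ ↦ ∑ K_n ρ K_n† is a channel; for general β it gives the action on
characteristic functions (`exists_isGaussianChannel`). Uniqueness holds because a Gaussian average
of displacements is a multiple of |e_z⟩⟨e_w|, so that a characteristic function determines its
operator (`integral_charFn`). The second sum, ∑ conj⟨e_v, K_n e_w⟩ ⟨e_u, K_n e_z⟩, is the kernel of
the Choi operator.

At finite r the operators T_n form a family of the same shape with other parameters. Their Choi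
kernel is that of the limiting family with w, z replaced by tanh r · w, tanh r · z
(`ABParams.hasSum_kernel`, `ConjParams.hasSum_kernel`): the square roots z and the parameters μ, θ
cancel. Tensoring with the squeezed vacuum produces the same rescaling, so U†(thermal ⊗ thermal)U is
the Choi state (`hasFockChoiDecomposition_of_kernel`). The unitary U comes from the family with all
weights equal to 1: its second sum is the kernel of the identity, so the flipped vectors define an
isometry, and changing the sign of the parameter gives the adjoint.

The limit r → ∞ is continuity of the parameters at sech 2r = 0, with dominated convergence for the
infinite bands. -/

noncomputable section

namespace Bosonic

/-! ### Series of rank-one operators and the trace norm -/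

section RankOneSeries

variable {E : Type*} [NormedAddCommGroup E] [InnerProductSpace ℂ E]

theorem summable_norm_mul_norm {E : Type*} [NormedAddCommGroup E] {κ : Type*} {φ ψ : κ → E}
    (hφ : Summable fun k => ‖φ k‖ ^ 2)
    (hψ : Summable fun k => ‖ψ k‖ ^ 2) : Summable fun k => ‖φ k‖ * ‖ψ k‖ := by
  refine Summable.of_nonneg_of_le (fun k => by positivity) (fun k => ?_) (hφ.add hψ)
  nlinarith [sq_nonneg (‖φ k‖ - ‖ψ k‖), sq_nonneg (‖φ k‖ + ‖ψ k‖)]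

theorem summable_rankOne [CompleteSpace E] {κ : Type*} {φ ψ : κ → E}
    (hφ : Summable fun k => ‖φ k‖ ^ 2) (hψ : Summable fun k => ‖ψ k‖ ^ 2) :
    Summable fun k => (InnerProductSpace.rankOne ℂ (φ k) (ψ k) : E →L[ℂ] E) := by
  refine Summable.of_norm ?_
  simpa using summable_norm_mul_norm hφ hψ

theorem hasSum_inner_of_hasSum_rankOne {κ : Type*} {φ ψ : κ → E} {T : E →L[ℂ] E}
    (h : HasSum (fun k => (InnerProductSpace.rankOne ℂ (φ k) (ψ k) : E →L[ℂ] E)) T) (x y : E) :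
    HasSum (fun k => inner ℂ x (φ k) * inner ℂ (ψ k) y) (inner ℂ x (T y)) := by
  have h1 := (h.mapL (ContinuousLinearMap.apply ℂ E y)).mapL (innerSL ℂ x)
  simpa [inner_smul_right, mul_comm] using h1

theorem sum_norm_inner_mul_le {N : ℕ} {u v : Fin N → E} (hu : Orthonormal ℂ u)
    (hv : Orthonormal ℂ v) (φ ψ : E) :
    ∑ i, ‖inner ℂ (u i) φ‖ * ‖inner ℂ ψ (v i)‖ ≤ ‖φ‖ * ‖ψ‖ := by
  have h1 := Real.sum_mul_le_sqrt_mul_sqrt Finset.univ (fun i => ‖inner ℂ (u i) φ‖)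
    (fun i => ‖inner ℂ ψ (v i)‖)
  refine h1.trans (mul_le_mul ?_ ?_ (Real.sqrt_nonneg _) (norm_nonneg _))
  · refine Real.sqrt_le_iff.2 ⟨norm_nonneg _, hu.sum_inner_products_le φ⟩
  · refine Real.sqrt_le_iff.2 ⟨norm_nonneg _, ?_⟩
    simp_rw [norm_inner_symm ψ]
    exact hv.sum_inner_products_le ψ

/-- For a single rank-one term, Cauchy–Schwarz and Bessel's inequality for `u` and `v` bound the
test sum by ‖φ k‖ ‖ψ k‖; the general case follows by exchanging the finite sum with the series. -/
theorem traceNorm_le_of_hasSum_rankOne {κ : Type*} {φ ψ : κ → E} {T : E →L[ℂ] E} {A : ℝ}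
    (h : HasSum (fun k => (InnerProductSpace.rankOne ℂ (φ k) (ψ k) : E →L[ℂ] E)) T)
    (hA : HasSum (fun k => ‖φ k‖ * ‖ψ k‖) A) : traceNorm T ≤ ENNReal.ofReal A := by
  refine iSup_le fun N => iSup_le fun u => iSup_le fun v => iSup_le fun hu => iSup_le fun hv => ?_
  have hb : ∀ i k, ‖inner ℂ (u i) (φ k)‖ * ‖inner ℂ (ψ k) (v i)‖ ≤ ‖φ k‖ * ‖ψ k‖ := fun i k =>
    (Finset.single_le_sum (f := fun i => ‖inner ℂ (u i) (φ k)‖ * ‖inner ℂ (ψ k) (v i)‖)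
      (fun i _ => by positivity) (Finset.mem_univ i)).trans (sum_norm_inner_mul_le hu hv _ _)
  have hs : ∀ i, Summable fun k => ‖inner ℂ (u i) (φ k)‖ * ‖inner ℂ (ψ k) (v i)‖ := fun i =>
    Summable.of_nonneg_of_le (fun k => by positivity) (hb i) hA.summable
  have h1 : ∀ i, ‖inner ℂ (u i) (T (v i))‖
      ≤ ∑' k, ‖inner ℂ (u i) (φ k)‖ * ‖inner ℂ (ψ k) (v i)‖ := fun i => by
    rw [← (hasSum_inner_of_hasSum_rankOne h (u i) (v i)).tsum_eq]
    simpa using norm_tsum_le_tsum_norm (f := fun k => inner ℂ (u i) (φ k) * inner ℂ (ψ k) (v i))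
      (by simpa using hs i)
  have h2 : ∑ i, ‖inner ℂ (u i) (T (v i))‖ ≤ A := by
    refine (Finset.sum_le_sum fun i _ => h1 i).trans ?_
    rw [← Summable.tsum_finsetSum fun i _ => hs i, ← hA.tsum_eq]
    exact Summable.tsum_le_tsum (fun k => sum_norm_inner_mul_le hu hv _ _)
      (summable_sum fun i _ => hs i) hA.summable
  have h3 : ∑ i, ‖inner ℂ (u i) (T (v i))‖ₑ = ENNReal.ofReal (∑ i, ‖inner ℂ (u i) (T (v i))‖) := by
    rw [ENNReal.ofReal_sum_of_nonneg fun i _ => norm_nonneg _]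
    simp
  rw [h3]
  exact ENNReal.ofReal_le_ofReal h2

/-- Removing finitely many rows from a double series: this turns a remainder `T - ∑ f n` into a
series of the same kind as `T`. -/
theorem hasSum_ite_fst {ι κ G : Type*} [NormedAddCommGroup G] [DecidableEq ι] {f : ι × κ → G}
    {g : ι → G} {T : G} (hf : HasSum f T) (hg : ∀ n, HasSum (fun k => f (n, k)) (g n))
    (s : Finset ι) : HasSum (fun p => if p.1 ∈ s then 0 else f p) (T - ∑ n ∈ s, g n) := by
  have h1 : ∀ n ∈ s, HasSum (fun p : ι × κ => if p.1 = n then f p else 0) (g n) := fun n _ => by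
    rw [← (Prod.mk_right_injective n).hasSum_iff]
    · simpa [Function.comp_def] using hg n
    · rintro ⟨m, k⟩ hx
      rw [if_neg]
      rintro rfl
      exact hx ⟨k, rfl⟩
  refine (hf.sub (hasSum_sum h1)).congr_fun ?_
  intro p
  by_cases hp : p.1 ∈ s <;> simp [hp]

/-- The remainder after finitely many rows is the rank-one series with `φ` set to zero on these
rows, so its trace norm is at most the tail of a convergent scalar series. -/
theorem hasTraceNormSum_of_hasSum_rankOne {ι κ : Type*} {φ ψ : ι × κ → E} {f : ι → E →L[ℂ] E}
    {T : E →L[ℂ] E} (hA : Summable fun p => ‖φ p‖ * ‖ψ p‖)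
    (h : HasSum (fun p => (InnerProductSpace.rankOne ℂ (φ p) (ψ p) : E →L[ℂ] E)) T)
    (hf : ∀ n, HasSum
      (fun k => (InnerProductSpace.rankOne ℂ (φ (n, k)) (ψ (n, k)) : E →L[ℂ] E)) (f n)) :
    HasTraceNormSum f T := by
  classical
  set g : ι → ℝ := fun n => ∑' k, ‖φ (n, k)‖ * ‖ψ (n, k)‖
  have hg : ∀ n, HasSum (fun k => ‖φ (n, k)‖ * ‖ψ (n, k)‖) (g n) := fun n =>
    (hA.comp_injective (Prod.mk_right_injective n)).hasSum
  have h1 : ∀ s : Finset ι, traceNorm (T - ∑ n ∈ s, f n)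
      ≤ ENNReal.ofReal ((∑' p, ‖φ p‖ * ‖ψ p‖) - ∑ n ∈ s, g n) := fun s => by
    refine traceNorm_le_of_hasSum_rankOne (φ := fun p => if p.1 ∈ s then 0 else φ p) (ψ := ψ) ?_ ?_
    · refine (hasSum_ite_fst h hf s).congr_fun fun p => ?_
      by_cases hp : p.1 ∈ s <;> simp [hp]
    · refine (hasSum_ite_fst hA.hasSum hg s).congr_fun fun p => ?_
      by_cases hp : p.1 ∈ s <;> simp [hp]
  have h2 : HasSum g (∑' p, ‖φ p‖ * ‖ψ p‖) := hA.hasSum.prod_fiberwise hg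
  have h3 : Tendsto (fun s : Finset ι => ENNReal.ofReal ((∑' p, ‖φ p‖ * ‖ψ p‖) - ∑ n ∈ s, g n))
      atTop (𝓝 0) := by
    rw [← ENNReal.ofReal_zero, ← sub_self (∑' p, ‖φ p‖ * ‖ψ p‖)]
    exact (ENNReal.continuous_ofReal.tendsto _).comp (tendsto_const_nhds.sub h2)
  exact tendsto_of_tendsto_of_tendsto_of_le_of_le tendsto_const_nhds h3 (fun _ => zero_le) h1

end RankOneSeries

/-! ### Trace-class operators as series of rank-one operators -/

theorem inner_ket (n : ℕ) (ψ : Mode) : inner ℂ (ket n) ψ = ψ n := by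
  simp [ket, lp.inner_single_left]

theorem inner_ket₂ (m n : ℕ) (ψ : TwoMode) : inner ℂ (ket₂ m n) ψ = ψ (m, n) := by
  simp [ket₂, lp.inner_single_left]

theorem hasSum_inner_ket (x y : Mode) :
    HasSum (fun n => inner ℂ x (ket n) * inner ℂ (ket n) y) (inner ℂ x y) := by
  refine (lp.hasSum_inner (𝕜 := ℂ) x y).congr_fun fun n => ?_
  rw [← inner_conj_symm x, inner_ket, inner_ket]
  simp [mul_comm]

theorem hasSum_norm_inner_ket (x : Mode) : HasSum (fun n => ‖inner ℂ (ket n) x‖ ^ 2) (‖x‖ ^ 2) := by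
  simpa [inner_ket] using hasSum_norm_sq x

theorem exists_mul_self_eq {E : Type*} [NormedAddCommGroup E] [InnerProductSpace ℂ E]
    [CompleteSpace E] {ρ : E →L[ℂ] E} (h : ρ.IsPositive) :
    ∃ S : E →L[ℂ] E, adjoint S = S ∧ S * S = ρ := by
  have h0 : 0 ≤ ρ := (nonneg_iff_isPositive ρ).2 h
  exact ⟨CFC.sqrt ρ, ((nonneg_iff_isPositive _).1 (CFC.sqrt_nonneg ρ)).isSelfAdjoint,
    CFC.sqrt_mul_sqrt_self ρ h0⟩

/-- With S the positive square root, ρ = S·S = ∑ |S k⟩⟨S k| over the Fock basis, and ∑ ‖S k‖² is the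
trace. No spectral decomposition is required. -/
theorem exists_hasSum_rankOne_of_isPositive {ρ : Mode →L[ℂ] Mode} (h : ρ.IsPositive)
    (hs : Summable fun n => inner ℂ (ket n) (ρ (ket n))) :
    ∃ φ : ℕ → Mode, (Summable fun k => ‖φ k‖ ^ 2) ∧
      HasSum (fun k => (InnerProductSpace.rankOne ℂ (φ k) (φ k) : Mode →L[ℂ] Mode)) ρ := by
  obtain ⟨S, hSa, hS⟩ := exists_mul_self_eq h
  have hin : ∀ x y, inner ℂ (S x) (S y) = inner ℂ x (ρ y) := fun x y => by
    rw [← adjoint_inner_right, hSa, ← hS]; rfl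
  have hsum : Summable fun k => ‖S (ket k)‖ ^ 2 := by
    have h1 : (fun k => ‖S (ket k)‖ ^ 2) = fun k => (inner ℂ (ket k) (ρ (ket k))).re := by
      funext k
      rw [← hin, inner_self_eq_norm_sq_to_K]
      norm_cast
    rw [h1]
    exact (Complex.reCLM.summable hs)
  refine ⟨fun k => S (ket k), hsum, ?_⟩
  have h2 := (summable_rankOne hsum hsum).hasSum
  convert h2
  refine ContinuousLinearMap.ext fun y => ext_inner_left ℂ fun x => ?_
  have h3 := hasSum_inner_of_hasSum_rankOne h2 x y
  have h4 : HasSum (fun k => inner ℂ x (S (ket k)) * inner ℂ (S (ket k)) y)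
      (inner ℂ x (ρ y)) := by
    rw [← hin]
    refine (hasSum_inner_ket (S x) (S y)).congr_fun fun k => ?_
    have e1 := adjoint_inner_left S (ket k) x
    have e2 := adjoint_inner_right S (ket k) y
    rw [hSa] at e1 e2
    rw [e1, e2]
  exact h4.unique h3

/-- The operator `T` is the sum of the rank-one operators `|φ k⟩⟨ψ k|`, where the families `φ` and
`ψ` are square summable. -/
structure NuclearSeries {κ : Type*} (φ ψ : κ → Mode) (T : Mode →L[ℂ] Mode) : Prop where
  left : Summable fun k => ‖φ k‖ ^ 2
  right : Summable fun k => ‖ψ k‖ ^ 2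
  hasSum : HasSum (fun k => (InnerProductSpace.rankOne ℂ (φ k) (ψ k) : Mode →L[ℂ] Mode)) T

theorem NuclearSeries.sumElim {κ κ' : Type*} {φ ψ : κ → Mode} {φ' ψ' : κ' → Mode}
    {S T : Mode →L[ℂ] Mode} (hS : NuclearSeries φ ψ S) (hT : NuclearSeries φ' ψ' T) :
    NuclearSeries (Sum.elim φ φ') (Sum.elim ψ ψ') (S + T) where
  left := (HasSum.sum (f := fun k => ‖Sum.elim φ φ' k‖ ^ 2) hS.left.hasSum hT.left.hasSum).summable
  right := (HasSum.sum (f := fun k => ‖Sum.elim ψ ψ' k‖ ^ 2)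
    hS.right.hasSum hT.right.hasSum).summable
  hasSum := HasSum.sum (f := fun k => (InnerProductSpace.rankOne ℂ (Sum.elim φ φ' k)
    (Sum.elim ψ ψ' k) : Mode →L[ℂ] Mode)) hS.hasSum hT.hasSum

theorem NuclearSeries.reindex {κ κ' : Type*} {φ ψ : κ → Mode} {T : Mode →L[ℂ] Mode}
    (h : NuclearSeries φ ψ T) (e : κ' ≃ κ) : NuclearSeries (φ ∘ e) (ψ ∘ e) T where
  left := (e.summable_iff (f := fun k => ‖φ k‖ ^ 2)).2 h.left
  right := (e.summable_iff (f := fun k => ‖ψ k‖ ^ 2)).2 h.right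
  hasSum := (e.hasSum_iff
    (f := fun k => (InnerProductSpace.rankOne ℂ (φ k) (ψ k) : Mode →L[ℂ] Mode))).2 h.hasSum

theorem NuclearSeries.smul {κ : Type*} {φ ψ : κ → Mode} {T : Mode →L[ℂ] Mode}
    (h : NuclearSeries φ ψ T) (c : ℂ) : NuclearSeries (fun k => c • φ k) ψ (c • T) where
  left := by simpa [norm_smul, mul_pow] using h.left.mul_left (‖c‖ ^ 2)
  right := h.right
  hasSum := by simpa using h.hasSum.const_smul c

theorem exists_nuclearSeries {ρ : Mode →L[ℂ] Mode} (h : ρ ∈ traceClass) :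
    ∃ φ ψ : ℕ → Mode, NuclearSeries φ ψ ρ := by
  induction h using Submodule.span_induction with
  | mem ρ h =>
    obtain ⟨φ, h1, h2⟩ := exists_hasSum_rankOne_of_isPositive h.1 h.2
    exact ⟨φ, φ, h1, h1, h2⟩
  | zero => exact ⟨0, 0, by simp, by simp, by simp⟩
  | add S T _ _ hS hT =>
    obtain ⟨φ, ψ, h1⟩ := hS
    obtain ⟨φ', ψ', h2⟩ := hT
    exact ⟨_, _, (h1.sumElim h2).reindex Equiv.natSumNatEquivNat.symm⟩
  | smul c T _ hT =>
    obtain ⟨φ, ψ, h⟩ := hT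
    exact ⟨_, _, h.smul c⟩

theorem summable_inner_ket_sq {κ : Type*} {φ : κ → Mode} (h : Summable fun k => ‖φ k‖ ^ 2) :
    Summable fun p : κ × ℕ => ‖inner ℂ (ket p.2) (φ p.1)‖ ^ 2 := by
  rw [summable_prod_of_nonneg fun _ => by positivity]
  refine ⟨fun k => (hasSum_norm_inner_ket (φ k)).summable, ?_⟩
  simpa [fun k => (hasSum_norm_inner_ket (φ k)).tsum_eq] using h

theorem NuclearSeries.summable_prod {κ : Type*} {φ ψ : κ → Mode} {T : Mode →L[ℂ] Mode}
    (h : NuclearSeries φ ψ T) :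
    Summable fun p : κ × ℕ => inner ℂ (ket p.2) (φ p.1) * inner ℂ (ψ p.1) (ket p.2) := by
  refine Summable.of_norm ?_
  have h1 := summable_norm_mul_norm (summable_inner_ket_sq h.left) (summable_inner_ket_sq h.right)
  refine h1.congr fun p => ?_
  rw [norm_mul, norm_inner_symm (ψ p.1)]

/-- Fubini for the absolutely convergent array ⟨n|φ k⟩⟨ψ k|n⟩: summing over n first gives ⟨ψ k, φ k⟩
by Parseval. -/
theorem NuclearSeries.hasSum_inner_ket {κ : Type*} {φ ψ : κ → Mode} {T : Mode →L[ℂ] Mode}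
    (h : NuclearSeries φ ψ T) :
    HasSum (fun n => inner ℂ (ket n) (T (ket n))) (∑' k, inner ℂ (ψ k) (φ k)) := by
  have h1 := h.summable_prod.hasSum
  have h2 := h1.prod_fiberwise fun k =>
    (Bosonic.hasSum_inner_ket (ψ k) (φ k)).congr_fun fun n => mul_comm _ _
  rw [← h2.tsum_eq] at h1
  exact ((Equiv.prodComm ℕ κ).hasSum_iff.2 h1).prod_fiberwise fun n =>
    hasSum_inner_of_hasSum_rankOne h.hasSum (ket n) (ket n)

theorem NuclearSeries.comp {κ : Type*} {φ ψ : κ → Mode} {T : Mode →L[ℂ] Mode}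
    (h : NuclearSeries φ ψ T) (W : Mode →L[ℂ] Mode) :
    NuclearSeries φ (fun k => adjoint W (ψ k)) (T ∘L W) where
  left := h.left
  right := by
    refine Summable.of_nonneg_of_le (fun k => by positivity) (fun k => ?_)
      (h.right.mul_left (‖adjoint W‖ ^ 2))
    rw [← mul_pow]
    exact pow_le_pow_left₀ (norm_nonneg _) (le_opNorm _ _) 2
  hasSum := by
    have h1 := h.hasSum.mapL ((ContinuousLinearMap.compL ℂ Mode Mode Mode).flip W)
    simpa [InnerProductSpace.rankOne_comp] using h1

theorem NuclearSeries.summable_inner {κ : Type*} {φ ψ : κ → Mode} {T : Mode →L[ℂ] Mode}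
    (h : NuclearSeries φ ψ T) : Summable fun k => inner ℂ (ψ k) (φ k) := by
  refine Summable.of_norm (Summable.of_nonneg_of_le (fun _ => norm_nonneg _)
    (fun k => norm_inner_le_norm _ _) (summable_norm_mul_norm h.right h.left))

theorem NuclearSeries.hasSum_trace_comp {κ : Type*} {φ ψ : κ → Mode} {T : Mode →L[ℂ] Mode}
    (h : NuclearSeries φ ψ T) (W : Mode →L[ℂ] Mode) :
    HasSum (fun k => inner ℂ (ψ k) (W (φ k))) (trace (T ∘L W)) := by
  have h1 := (h.comp W).summable_inner.hasSum
  rw [← (h.comp W).hasSum_inner_ket.tsum_eq] at h1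
  exact h1.congr_fun fun k => (adjoint_inner_left W _ _).symm

theorem mem_traceClass_of_hasSum_rankOne_self {κ : Type*} {φ : κ → Mode} {T : Mode →L[ℂ] Mode}
    (h : NuclearSeries φ φ T) : T ∈ traceClass := by
  refine Submodule.subset_span ⟨?_, h.hasSum_inner_ket.summable⟩
  rw [← nonneg_iff_isPositive]
  exact h.hasSum.nonneg fun k =>
    (nonneg_iff_isPositive _).2 (InnerProductSpace.isPositive_rankOne_self _)

theorem summable_norm_add_sq {κ E : Type*} [NormedAddCommGroup E] {φ ψ : κ → E}
    (hφ : Summable fun k => ‖φ k‖ ^ 2) (hψ : Summable fun k => ‖ψ k‖ ^ 2) :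
    Summable fun k => ‖φ k + ψ k‖ ^ 2 := by
  refine Summable.of_nonneg_of_le (fun k => by positivity) (fun k => ?_)
    ((hφ.add hψ).mul_left 2)
  have := pow_le_pow_left₀ (norm_nonneg _) (norm_add_le (φ k) (ψ k)) 2
  nlinarith [sq_nonneg (‖φ k‖ - ‖ψ k‖)]

theorem rankOne_polarization {E : Type*} [NormedAddCommGroup E] [InnerProductSpace ℂ E] (x y : E) :
    (InnerProductSpace.rankOne ℂ x y : E →L[ℂ] E)
      = (4⁻¹ : ℂ) • (InnerProductSpace.rankOne ℂ (x + y) (x + y)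
        - InnerProductSpace.rankOne ℂ (x + (-1 : ℂ) • y) (x + (-1 : ℂ) • y)
        + Complex.I • InnerProductSpace.rankOne ℂ (x + Complex.I • y) (x + Complex.I • y)
        - Complex.I • InnerProductSpace.rankOne ℂ (x + (-Complex.I) • y)
          (x + (-Complex.I) • y)) := by
  ext z
  simp only [InnerProductSpace.rankOne_apply, add_apply, sub_apply, smul_apply, inner_add_left,
    inner_smul_left, map_neg, map_one, Complex.conj_I]
  match_scalars
  all_goals
    ring_nf
    try simp only [Complex.I_sq]
    try ring

/-- `traceClass` is a span of positive operators, so the series is polarized: |φ⟩⟨ψ| is a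
combination of the four positive operators |φ + cψ⟩⟨φ + cψ|, c = ±1, ±i, each giving a convergent
series with finite trace. -/
theorem NuclearSeries.mem_traceClass {κ : Type*} {φ ψ : κ → Mode} {T : Mode →L[ℂ] Mode}
    (h : NuclearSeries φ ψ T) : T ∈ traceClass := by
  have hc : ∀ c : ℂ, ∃ S ∈ traceClass, HasSum (fun k => (InnerProductSpace.rankOne ℂ
      (φ k + c • ψ k) (φ k + c • ψ k) : Mode →L[ℂ] Mode)) S := fun c => by
    have h1 : Summable fun k => ‖φ k + c • ψ k‖ ^ 2 := by
      refine summable_norm_add_sq h.left ?_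
      simpa [norm_smul, mul_pow] using h.right.mul_left (‖c‖ ^ 2)
    have h2 := (summable_rankOne h1 h1).hasSum
    exact ⟨_, mem_traceClass_of_hasSum_rankOne_self ⟨h1, h1, h2⟩, h2⟩
  obtain ⟨S1, m1, h1⟩ := hc 1
  obtain ⟨S2, m2, h2⟩ := hc (-1)
  obtain ⟨S3, m3, h3⟩ := hc Complex.I
  obtain ⟨S4, m4, h4⟩ := hc (-Complex.I)
  have h5 := (((h1.sub h2).add (h3.const_smul Complex.I)).sub
    (h4.const_smul Complex.I)).const_smul (4⁻¹ : ℂ)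
  have h6 := h5.unique (h.hasSum.congr_fun fun k => by
    rw [rankOne_polarization (φ k) (ψ k)]; simp only [one_smul])
  rw [← h6]
  exact traceClass.smul_mem _ (traceClass.sub_mem (traceClass.add_mem (traceClass.sub_mem m1 m2)
    (traceClass.smul_mem _ m3)) (traceClass.smul_mem _ m4))

theorem nuclearSeries_rankOne (x y : Mode) :
    NuclearSeries (fun _ : Unit => x) (fun _ => y) (InnerProductSpace.rankOne ℂ x y) where
  left := (hasSum_fintype _).summable
  right := (hasSum_fintype _).summable
  hasSum := by simp

/-! ### Families of operators with a common isometric dilation -/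

section Dilation

variable {ι : Type*} {E F : Type*} [NormedAddCommGroup E] [InnerProductSpace ℂ E]
  [NormedAddCommGroup F] [InnerProductSpace ℂ F]

/-- The family becomes one operator into the ℓ² sum of copies of F, as in a Stinespring dilation.
Convergence questions about sums over n turn into continuity of inner products with `V`. -/
theorem exists_clm_lp (A : ι → E →L[ℂ] F) (C : ℝ) (hC : 0 ≤ C)
    (h : ∀ ψ (s : Finset ι), ∑ n ∈ s, ‖A n ψ‖ ^ 2 ≤ C ^ 2 * ‖ψ‖ ^ 2) :
    ∃ V : E →L[ℂ] lp (fun _ : ι => F) 2, ∀ ψ n, V ψ n = A n ψ := by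
  have hm : ∀ ψ, Memℓp (fun n => A n ψ) 2 := fun ψ => by
    refine memℓp_gen ?_
    simpa using summable_of_sum_le (fun _ => by positivity) (h ψ)
  refine ⟨LinearMap.mkContinuous
    { toFun := fun ψ => ⟨fun n => A n ψ, hm ψ⟩
      map_add' := fun ψ φ => by ext n; simp; rfl
      map_smul' := fun c ψ => by ext n; simp } C fun ψ => ?_, fun ψ n => rfl⟩
  refine abs_le_of_sq_le_sq' ?_ (by positivity) |>.2
  rw [mul_pow]
  have h1 := lp.hasSum_norm (p := 2) (by norm_num) (⟨fun n => A n ψ, hm ψ⟩ : lp (fun _ : ι => F) 2)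
  simp only [ENNReal.toReal_ofNat, Real.rpow_ofNat] at h1
  exact hasSum_le_of_sum_le h1 (h ψ)

/-- The relation ∑ A_n† A_n = 1 need only be checked weakly on a total family. Sesquilinearity gives
it on the span; there it bounds all finite partial sums, so `V` exists on all of E, and the isometry
relation extends by density. -/
theorem exists_isometry_lp (A : ι → E →L[ℂ] F) {κ : Type*} {e : κ → E}
    (he : Dense (Submodule.span ℂ (Set.range e) : Set E))
    (h : ∀ w z, HasSum (fun n => inner ℂ (A n (e w)) (A n (e z))) (inner ℂ (e w) (e z))) :
    ∃ V : E →L[ℂ] lp (fun _ : ι => F) 2, (∀ ψ n, V ψ n = A n ψ) ∧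
      ∀ φ ψ, inner ℂ (V φ) (V ψ) = inner ℂ φ ψ := by
  have h1 : ∀ φ ∈ Submodule.span ℂ (Set.range e), ∀ ψ ∈ Submodule.span ℂ (Set.range e),
      HasSum (fun n => inner ℂ (A n φ) (A n ψ)) (inner ℂ φ ψ) := by
    intro φ hφ ψ hψ
    induction hφ using Submodule.span_induction with
    | zero => simp
    | add x y hx hy h1 h2 => simpa only [map_add, inner_add_left] using h1.add h2
    | smul r x hx h1 => simpa only [map_smul, inner_smul_left] using h1.mul_left _
    | mem x hx =>
      obtain ⟨w, rfl⟩ := hx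
      induction hψ using Submodule.span_induction with
      | zero => simp
      | add x y hx hy h1 h2 => simpa only [map_add, inner_add_right] using h1.add h2
      | smul r x hx h1 => simpa only [map_smul, inner_smul_right] using h1.mul_left _
      | mem x hx =>
        obtain ⟨z, rfl⟩ := hx
        exact h w z
  have h2 : ∀ ψ (s : Finset ι), ∑ n ∈ s, ‖A n ψ‖ ^ 2 ≤ (1 : ℝ) ^ 2 * ‖ψ‖ ^ 2 := by
    intro ψ s
    rw [one_pow, one_mul]
    -- The bound is extended for one finite partial sum at a time, since only finite sums are
    -- visibly continuous before `V` is known to exist.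
    refine he.induction (P := fun ψ => ∑ n ∈ s, ‖A n ψ‖ ^ 2 ≤ ‖ψ‖ ^ 2) (fun ψ hψ => ?_)
      (isClosed_le (by fun_prop) (by fun_prop)) ψ
    have h3 := h1 ψ hψ ψ hψ
    simp_rw [inner_self_eq_norm_sq_to_K] at h3
    have h4 : HasSum (fun n => ‖A n ψ‖ ^ 2) (‖ψ‖ ^ 2) := by exact_mod_cast h3
    exact sum_le_hasSum s (fun _ _ => by positivity) h4
  obtain ⟨V, hV⟩ := exists_clm_lp A 1 zero_le_one h2
  refine ⟨V, hV, fun φ ψ => ?_⟩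
  have h3 : ∀ φ ∈ Submodule.span ℂ (Set.range e), ∀ ψ ∈ Submodule.span ℂ (Set.range e),
      inner ℂ (V φ) (V ψ) = inner ℂ φ ψ := fun φ hφ ψ hψ => by
    have h4 := lp.hasSum_inner (𝕜 := ℂ) (V φ) (V ψ)
    simp_rw [hV] at h4
    exact h4.unique (h1 φ hφ ψ hψ)
  have h4 : ∀ φ ∈ Submodule.span ℂ (Set.range e), ∀ ψ,
      inner ℂ (V φ) (V ψ) = inner ℂ φ ψ := fun φ hφ ψ =>
    he.induction (P := fun ψ => inner ℂ (V φ) (V ψ) = inner ℂ φ ψ) (h3 φ hφ)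
      (isClosed_eq (by fun_prop) (by fun_prop)) ψ
  exact he.induction (P := fun φ => inner ℂ (V φ) (V ψ) = inner ℂ φ ψ) (fun φ hφ => h4 φ hφ ψ)
      (isClosed_eq (by fun_prop) (by fun_prop)) φ

/-- This transports ∑ A_n† W A_n = W' from a total family to all vectors. The operators W A_n have
their own dilation `V'`, of norm at most ‖W‖ ‖V‖, so the sum is ⟨V φ, V' ψ⟩ and depends continuously
on both vectors. -/
theorem hasSum_inner_comp [CompleteSpace E] [CompleteSpace F] {A : ι → E →L[ℂ] F}
    {V : E →L[ℂ] lp (fun _ : ι => F) 2} (hV : ∀ ψ n, V ψ n = A n ψ) (W : F →L[ℂ] F)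
    {W' : E →L[ℂ] E} {κ : Type*} {e : κ → E}
    (he : Dense (Submodule.span ℂ (Set.range e) : Set E))
    (h : ∀ w z, HasSum (fun n => inner ℂ (A n (e w)) (W (A n (e z)))) (inner ℂ (e w) (W' (e z))))
    (φ ψ : E) : HasSum (fun n => inner ℂ (A n φ) (W (A n ψ))) (inner ℂ φ (W' ψ)) := by
  have h2 : ∀ ψ (s : Finset ι), ∑ n ∈ s, ‖(W ∘L A n) ψ‖ ^ 2 ≤ (‖W‖ * ‖V‖) ^ 2 * ‖ψ‖ ^ 2 := by
    intro ψ s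
    have h4 : ∑ n ∈ s, ‖A n ψ‖ ^ 2 ≤ ‖V ψ‖ ^ 2 := by
      have h1 := lp.hasSum_norm (p := 2) (by norm_num) (V ψ)
      simp only [ENNReal.toReal_ofNat, Real.rpow_ofNat, hV] at h1
      exact sum_le_hasSum s (fun _ _ => by positivity) h1
    calc ∑ n ∈ s, ‖(W ∘L A n) ψ‖ ^ 2 ≤ ∑ n ∈ s, ‖W‖ ^ 2 * ‖A n ψ‖ ^ 2 := by
          refine Finset.sum_le_sum fun n _ => ?_
          rw [← mul_pow]
          exact pow_le_pow_left₀ (norm_nonneg _) (W.le_opNorm _) 2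
      _ = ‖W‖ ^ 2 * ∑ n ∈ s, ‖A n ψ‖ ^ 2 := by rw [Finset.mul_sum]
      _ ≤ ‖W‖ ^ 2 * ‖V ψ‖ ^ 2 := by gcongr
      _ ≤ ‖W‖ ^ 2 * (‖V‖ * ‖ψ‖) ^ 2 := by gcongr; exact V.le_opNorm _
      _ = _ := by ring
  obtain ⟨V', hV'⟩ := exists_clm_lp (fun n => W ∘L A n) (‖W‖ * ‖V‖) (by positivity) h2
  have h3 : ∀ φ ψ, HasSum (fun n => inner ℂ (A n φ) (W (A n ψ))) (inner ℂ (V φ) (V' ψ)) :=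
    fun φ ψ => by simpa [hV, hV'] using lp.hasSum_inner (𝕜 := ℂ) (V φ) (V' ψ)
  have h5 : ∀ w ψ, inner ℂ (V (e w)) (V' ψ) = inner ℂ (e w) (W' ψ) := by
    intro w
    have : innerSL ℂ (V (e w)) ∘L V' = innerSL ℂ (e w) ∘L W' := by
      refine ContinuousLinearMap.ext_on he ?_
      rintro _ ⟨z, rfl⟩
      exact (h3 (e w) (e z)).unique (h w z)
    exact fun ψ => DFunLike.congr_fun this ψ
  have h6 : inner ℂ (V φ) (V' ψ) = inner ℂ φ (W' ψ) := by
    refine he.induction (P := fun φ => inner ℂ (V φ) (V' ψ) = inner ℂ φ (W' ψ)) (fun φ hφ => ?_)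
      (isClosed_eq (by fun_prop) (by fun_prop)) φ
    induction hφ using Submodule.span_induction with
    | mem x hx => obtain ⟨w, rfl⟩ := hx; exact h5 w ψ
    | zero => simp
    | add x y _ _ hx hy => simp [hx, hy]
    | smul c x _ hx => simp [hx]
  rw [← h6]
  exact h3 φ ψ

/-- Since V†V = 1, expanding V ψ into its components and applying V† gives strong, and not merely
weak, convergence. -/
theorem hasSum_adjoint_apply_apply [CompleteSpace E] [CompleteSpace F] [DecidableEq ι]
    {A : ι → E →L[ℂ] F} {V : E →L[ℂ] lp (fun _ : ι => F) 2} (hV : ∀ ψ n, V ψ n = A n ψ)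
    (hi : ∀ φ ψ, inner ℂ (V φ) (V ψ) = inner ℂ φ ψ) (ψ : E) :
    HasSum (fun n => adjoint (A n) (A n ψ)) ψ := by
  have h1 := (lp.hasSum_single (p := 2) (by norm_num) (V ψ)).mapL (adjoint V)
  have h2 : adjoint V (V ψ) = ψ := ext_inner_left ℂ fun φ => by rw [adjoint_inner_right, hi]
  rw [h2] at h1
  refine h1.congr_fun fun n => ext_inner_left ℂ fun φ => ?_
  rw [adjoint_inner_right, adjoint_inner_right, lp.inner_single_right, hV, hV]

end Dilation

/-! ### Exponential vectors and displacements -/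

theorem dense_span_expVec : Dense (Submodule.span ℂ (Set.range expVec) : Set Mode) := by
  have h := denseRange_expSpan
  rwa [DenseRange, ← LinearMap.coe_range, expSpan, Finsupp.range_linearCombination] at h

theorem expVec_apply (z : ℂ) (n : ℕ) :
    expVec z n = z ^ n / (Real.sqrt (Nat.factorial n) : ℂ) := rfl

theorem inner_expVec_displacement_expVec (β u z : ℂ) :
    inner ℂ (expVec u) (displacement β (expVec z))
      = Complex.exp (-(‖β‖ ^ 2 / 2 : ℝ) - starRingEnd ℂ β * z + starRingEnd ℂ u * (z + β)) := by
  rw [displacement_expVec, displacedExpVec, inner_smul_right, inner_expVec, ← Complex.exp_add]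

/-- This is D(β)† = D(-β) on an exponential vector, obtained by comparing two continuous functionals
on the total family. -/
theorem inner_expVec_displacement (β u : ℂ) (ψ : Mode) :
    inner ℂ (expVec u) (displacement β ψ)
      = Complex.exp (-(‖β‖ ^ 2 / 2 : ℝ) + starRingEnd ℂ u * β)
        * inner ℂ (expVec (u - β)) ψ := by
  have h : innerSL ℂ (expVec u) ∘L displacement β
      = Complex.exp (-(‖β‖ ^ 2 / 2 : ℝ) + starRingEnd ℂ u * β) •
        innerSL ℂ (expVec (u - β)) := by
    refine ContinuousLinearMap.ext_on dense_span_expVec ?_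
    rintro _ ⟨z, rfl⟩
    simp only [comp_apply, innerSL_apply_apply, smul_apply, smul_eq_mul]
    rw [inner_expVec_displacement_expVec, inner_expVec, ← Complex.exp_add]
    congr 1
    simp only [map_sub]
    ring
  exact DFunLike.congr_fun h ψ

theorem displacement_zero : displacement 0 = ContinuousLinearMap.id ℂ Mode := by
  refine ContinuousLinearMap.ext_on dense_span_expVec ?_
  rintro _ ⟨z, rfl⟩
  simp [displacement_expVec, displacedExpVec]

theorem norm_displacement_apply (β : ℂ) (ψ : Mode) : ‖displacement β ψ‖ = ‖ψ‖ := by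
  refine denseRange_expSpan.induction (P := fun ψ => ‖displacement β ψ‖ = ‖ψ‖) ?_
    (isClosed_eq (by fun_prop) (by fun_prop)) ψ
  rintro _ ⟨f, rfl⟩
  rw [← norm_displacedExpSpan β f, displacement, LinearMap.extendOfNorm_eq denseRange_expSpan
    ⟨1, fun f => by rw [norm_displacedExpSpan, one_mul]⟩]

/-! ### Product vectors -/

theorem summable_mul_sq (φ ψ : Mode) : Summable fun p : ℕ × ℕ => ‖φ p.1 * ψ p.2‖ ^ 2 := by
  simp_rw [norm_mul, mul_pow]
  exact (hasSum_norm_sq φ).summable.mul_of_nonneg (hasSum_norm_sq ψ).summable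
    (fun _ => by positivity) (fun _ => by positivity)

/-- The product vector `φ ⊗ ψ`. -/
def prodVec (φ ψ : Mode) : TwoMode :=
  ⟨fun p => φ p.1 * ψ p.2, memℓp_of_summable_sq (summable_mul_sq φ ψ)⟩

theorem prodVec_apply (φ ψ : Mode) (p : ℕ × ℕ) : prodVec φ ψ p = φ p.1 * ψ p.2 := rfl

theorem row_prodVec (φ ψ : Mode) (i : ℕ) : row (prodVec φ ψ) i = φ i • ψ := rfl

theorem onSecond_apply (B : Mode →L[ℂ] Mode) (ψ : TwoMode) (p : ℕ × ℕ) :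
    onSecond B ψ p = B (row ψ p.1) p.2 := rfl

theorem swapModes_apply (ψ : TwoMode) (p : ℕ × ℕ) : swapModes ψ p = ψ p.swap := rfl

theorem onFirst_apply (A : Mode →L[ℂ] Mode) (ψ : TwoMode) (i j : ℕ) :
    onFirst A ψ (i, j) = A (row (swapModes ψ) j) i := rfl

theorem swapModes_prodVec (φ ψ : Mode) : swapModes (prodVec φ ψ) = prodVec ψ φ := by
  ext p
  simp [swapModes_apply, prodVec_apply, mul_comm]

theorem onSecond_prodVec (B : Mode →L[ℂ] Mode) (φ ψ : Mode) :
    onSecond B (prodVec φ ψ) = prodVec φ (B ψ) := by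
  ext p
  simp [onSecond_apply, row_prodVec, prodVec_apply]

theorem onFirst_prodVec (A : Mode →L[ℂ] Mode) (φ ψ : Mode) :
    onFirst A (prodVec φ ψ) = prodVec (A φ) ψ := by
  simp [onFirst, swapModes_prodVec, onSecond_prodVec]

theorem tensorOp_prodVec (A B : Mode →L[ℂ] Mode) (φ ψ : Mode) :
    tensorOp A B (prodVec φ ψ) = prodVec (A φ) (B ψ) := by
  simp [tensorOp, onFirst_prodVec, onSecond_prodVec]

theorem prodVec_smul_left (c : ℂ) (φ ψ : Mode) : prodVec (c • φ) ψ = c • prodVec φ ψ := by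
  ext p
  simp [prodVec_apply, mul_assoc]

theorem prodVec_smul_right (c : ℂ) (φ ψ : Mode) : prodVec φ (c • ψ) = c • prodVec φ ψ := by
  ext p
  simp [prodVec_apply, mul_left_comm]

theorem inner_prodVec_left (φ ψ : Mode) (χ : TwoMode) :
    HasSum (fun i => inner ℂ (φ i) (inner ℂ ψ (row χ i))) (inner ℂ (prodVec φ ψ) χ) := by
  refine (lp.hasSum_inner (𝕜 := ℂ) (prodVec φ ψ) χ).prod_fiberwise fun i => ?_
  have h := (lp.hasSum_inner (𝕜 := ℂ) ψ (row χ i)).mul_left (starRingEnd ℂ (φ i))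
  rw [RCLike.inner_apply, mul_comm]
  refine h.congr_fun fun j => ?_
  simp only [RCLike.inner_apply, prodVec_apply, map_mul]
  change χ (i, j) * _ = _ * (χ (i, j) * _)
  ring

theorem inner_prodVec (φ ψ φ' ψ' : Mode) :
    inner ℂ (prodVec φ ψ) (prodVec φ' ψ') = inner ℂ φ φ' * inner ℂ ψ ψ' := by
  refine (inner_prodVec_left φ ψ (prodVec φ' ψ')).unique ?_
  refine ((lp.hasSum_inner (𝕜 := ℂ) φ φ').mul_right (inner ℂ ψ ψ')).congr_fun fun i => ?_
  rw [row_prodVec, inner_smul_right]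
  simp only [RCLike.inner_apply]
  ring

/-- The product of exponential vectors. -/
def expVec₂ (p q : ℂ) : TwoMode := prodVec (expVec p) (expVec q)

theorem expVec₂_apply (p q : ℂ) (i j : ℕ) : expVec₂ p q (i, j)
    = p ^ i / (Real.sqrt (Nat.factorial i) : ℂ) * (q ^ j / (Real.sqrt (Nat.factorial j) : ℂ)) := rfl

theorem inner_expVec₂ (p q p' q' : ℂ) : inner ℂ (expVec₂ p q) (expVec₂ p' q')
    = Complex.exp (starRingEnd ℂ p * p' + starRingEnd ℂ q * q') := by
  rw [expVec₂, expVec₂, inner_prodVec, inner_expVec, inner_expVec, Complex.exp_add]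

/-- Totality in each factor is used in turn: for fixed w, the numbers ⟨e_w, row i⟩ form a vector
orthogonal to every e_z, hence vanish; then every row is orthogonal to every e_w. -/
theorem dense_span_expVec₂ :
    Dense (Submodule.span ℂ (Set.range fun p : ℂ × ℂ => expVec₂ p.1 p.2) : Set TwoMode) := by
  rw [Submodule.dense_iff_topologicalClosure_eq_top, Submodule.topologicalClosure_eq_top_iff,
    Submodule.eq_bot_iff]
  intro χ hχ
  have h0 : ∀ φ : Mode, (∀ z, inner ℂ (expVec z) φ = 0) → φ = 0 := fun φ h => by
    have h1 : innerSL ℂ φ = 0 := by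
      refine ContinuousLinearMap.ext_on dense_span_expVec ?_
      rintro _ ⟨z, rfl⟩
      rw [innerSL_apply_apply, ← inner_conj_symm, h]
      simp
    have h2 := DFunLike.congr_fun h1 φ
    simpa using h2
  have h1 : ∀ z w, inner ℂ (expVec₂ z w) χ = 0 := fun z w =>
    Submodule.inner_right_of_mem_orthogonal (K := Submodule.span ℂ (Set.range fun p : ℂ × ℂ => expVec₂ p.1 p.2))
      (Submodule.subset_span (Set.mem_range_self (z, w))) hχ
  have h2 : ∀ w i, inner ℂ (expVec w) (row χ i) = 0 := fun w i => by
    have hm : Memℓp (fun i => (inner ℂ (expVec w) (row χ i) : ℂ)) 2 := by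
      refine memℓp_of_summable_sq (Summable.of_nonneg_of_le (fun _ => by positivity) (fun i => ?_)
        ((hasSum_norm_row χ).summable.mul_left (‖expVec w‖ ^ 2)))
      rw [← mul_pow]
      exact pow_le_pow_left₀ (norm_nonneg _) (norm_inner_le_norm _ _) 2
    obtain ⟨χw, hw⟩ : ∃ χw : Mode, ∀ i, χw i = inner ℂ (expVec w) (row χ i) :=
      ⟨⟨_, hm⟩, fun _ => rfl⟩
    have h3 := h0 χw fun z => by
      rw [← h1 z w]
      refine (lp.hasSum_inner (𝕜 := ℂ) (expVec z) χw).unique ?_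
      simp only [hw]
      exact inner_prodVec_left (expVec z) (expVec w) χ
    rw [← hw, h3]
    rfl
  ext ⟨i, j⟩
  exact congrFun (congrArg Subtype.val (h0 (row χ i) fun w => h2 w i)) j

theorem eq_of_inner_expVec {S T : Mode →L[ℂ] Mode}
    (h : ∀ w z, inner ℂ (expVec w) (S (expVec z)) = inner ℂ (expVec w) (T (expVec z))) : S = T := by
  refine ContinuousLinearMap.ext_on dense_span_expVec ?_
  rintro _ ⟨z, rfl⟩
  have h1 : innerSL ℂ (S (expVec z)) = innerSL ℂ (T (expVec z)) := by
    refine ContinuousLinearMap.ext_on dense_span_expVec ?_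
    rintro _ ⟨w, rfl⟩
    rw [innerSL_apply_apply, innerSL_apply_apply, ← inner_conj_symm, h, inner_conj_symm]
  refine ext_inner_right ℂ fun v => DFunLike.congr_fun h1 v

theorem eq_of_inner_expVec₂ {S T : TwoMode →L[ℂ] TwoMode}
    (h : ∀ w w' z z', inner ℂ (expVec₂ w w') (S (expVec₂ z z'))
      = inner ℂ (expVec₂ w w') (T (expVec₂ z z'))) : S = T := by
  refine ContinuousLinearMap.ext_on dense_span_expVec₂ ?_
  rintro _ ⟨⟨z, z'⟩, rfl⟩
  have h1 : innerSL ℂ (S (expVec₂ z z')) = innerSL ℂ (T (expVec₂ z z')) := by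
    refine ContinuousLinearMap.ext_on dense_span_expVec₂ ?_
    rintro _ ⟨⟨w, w'⟩, rfl⟩
    rw [innerSL_apply_apply, innerSL_apply_apply, ← inner_conj_symm, h, inner_conj_symm]
  refine ext_inner_right ℂ fun v => DFunLike.congr_fun h1 v

/-! ### Channels from Kraus operators -/

section Kraus

variable {ι : Type*} {K : ι → Mode →L[ℂ] Mode}

/-- The vectors K_n φ_k are square summable over pairs (n, k) because ∑ₙ ‖K_n φ_k‖² = ‖φ_k‖². The
rows of the resulting double series are the single Kraus terms, the shape that
`hasTraceNormSum_of_hasSum_rankOne` expects. -/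
theorem NuclearSeries.kraus {κ : Type*} {φ ψ : κ → Mode} {ρ : Mode →L[ℂ] Mode}
    (h : NuclearSeries φ ψ ρ) (hK : ∀ ψ, HasSum (fun n => ‖K n ψ‖ ^ 2) (‖ψ‖ ^ 2)) :
    NuclearSeries (fun p : ι × κ => K p.1 (φ p.2)) (fun p => K p.1 (ψ p.2))
      (∑' n, K n ∘L ρ ∘L adjoint (K n)) ∧ (Summable fun n => K n ∘L ρ ∘L adjoint (K n)) ∧
    ∀ n, HasSum (fun k => (InnerProductSpace.rankOne ℂ (K n (φ k)) (K n (ψ k)) : Mode →L[ℂ] Mode))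
      (K n ∘L ρ ∘L adjoint (K n)) := by
  have h1 : ∀ {φ : κ → Mode}, (Summable fun k => ‖φ k‖ ^ 2) →
      Summable fun p : ι × κ => ‖K p.1 (φ p.2)‖ ^ 2 := fun {φ} hφ => by
    refine ((Equiv.prodComm ι κ).summable_iff
      (f := fun p : κ × ι => ‖K p.2 (φ p.1)‖ ^ 2)).2 ?_
    rw [summable_prod_of_nonneg fun _ => by positivity]
    exact ⟨fun k => (hK (φ k)).summable, by simpa [fun k => (hK (φ k)).tsum_eq] using hφ⟩
  have h2 : ∀ n, HasSum (fun k => (InnerProductSpace.rankOne ℂ (K n (φ k)) (K n (ψ k)) :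
      Mode →L[ℂ] Mode)) (K n ∘L ρ ∘L adjoint (K n)) := fun n => by
    have h3 := (h.hasSum.mapL ((ContinuousLinearMap.compL ℂ Mode Mode Mode).flip
      (adjoint (K n)))).mapL (ContinuousLinearMap.compL ℂ Mode Mode Mode (K n))
    simpa [InnerProductSpace.rankOne_comp,
      InnerProductSpace.comp_rankOne] using h3
  have h3 := (summable_rankOne (h1 h.left) (h1 h.right)).hasSum
  have h4 := h3.prod_fiberwise h2
  refine ⟨⟨h1 h.left, h1 h.right, ?_⟩, h4.summable, h2⟩
  rw [h4.tsum_eq]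
  exact h3

/-- The map `ρ ↦ ∑ K ρ K†` on trace-class operators. -/
def krausMap (hK : ∀ ψ, HasSum (fun n => ‖K n ψ‖ ^ 2) (‖ψ‖ ^ 2)) : traceClass →ₗ[ℂ] traceClass where
  toFun ρ := ⟨∑' n, K n ∘L (ρ : Mode →L[ℂ] Mode) ∘L adjoint (K n), by
    obtain ⟨φ, ψ, h⟩ := exists_nuclearSeries ρ.2
    exact (h.kraus hK).1.mem_traceClass⟩
  map_add' ρ σ := by
    obtain ⟨φ, ψ, h⟩ := exists_nuclearSeries ρ.2
    obtain ⟨φ', ψ', h'⟩ := exists_nuclearSeries σ.2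
    ext1
    simp only [Submodule.coe_add, add_comp, comp_add]
    exact (h.kraus hK).2.1.tsum_add (h'.kraus hK).2.1
  map_smul' c ρ := by
    ext1
    simp only [Submodule.coe_smul, smul_comp, comp_smul, RingHom.id_apply]
    exact tsum_const_smul'' c

theorem coe_krausMap (hK : ∀ ψ, HasSum (fun n => ‖K n ψ‖ ^ 2) (‖ψ‖ ^ 2)) (ρ : traceClass) :
    (krausMap hK ρ : Mode →L[ℂ] Mode) = ∑' n, K n ∘L (ρ : Mode →L[ℂ] Mode) ∘L adjoint (K n) := rfl

theorem hasTraceNormSum_krausMap (hK : ∀ ψ, HasSum (fun n => ‖K n ψ‖ ^ 2) (‖ψ‖ ^ 2))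
    (ρ : traceClass) : HasTraceNormSum (fun n => K n ∘L (ρ : Mode →L[ℂ] Mode) ∘L adjoint (K n))
      (krausMap hK ρ : Mode →L[ℂ] Mode) := by
  obtain ⟨φ, ψ, h⟩ := exists_nuclearSeries ρ.2
  obtain ⟨h1, -, h2⟩ := h.kraus hK
  exact hasTraceNormSum_of_hasSum_rankOne (summable_norm_mul_norm h1.left h1.right) h1.hasSum h2

/-- Each Kraus term evaluates the given block form at the vectors K_n† v_i. -/
theorem isCompletelyPositive_krausMap (hK : ∀ ψ, HasSum (fun n => ‖K n ψ‖ ^ 2) (‖ψ‖ ^ 2)) :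
    IsCompletelyPositive (krausMap hK) := by
  intro k ρ hρ v
  have h1 : ∀ i j, HasSum (fun n => inner ℂ (adjoint (K n) (v i))
      ((ρ i j : Mode →L[ℂ] Mode) (adjoint (K n) (v j))))
      (inner ℂ (v i) ((krausMap hK (ρ i j) : Mode →L[ℂ] Mode) (v j))) := fun i j => by
    obtain ⟨φ, ψ, h⟩ := exists_nuclearSeries (ρ i j).2
    have h2 := ((h.kraus hK).2.1.hasSum.mapL (ContinuousLinearMap.apply ℂ Mode (v j))).mapL
      (innerSL ℂ (v i))
    simpa [adjoint_inner_left, coe_krausMap] using h2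
  exact (hasSum_sum fun i _ => hasSum_sum fun j _ => h1 i j).nonneg fun n => hρ _

/-- Duality between the Schrödinger and Heisenberg pictures. The identity operators give trace
preservation, the Weyl operators the transformation of characteristic functions. -/
theorem trace_krausMap_comp (hK : ∀ ψ, HasSum (fun n => ‖K n ψ‖ ^ 2) (‖ψ‖ ^ 2))
    {W W' : Mode →L[ℂ] Mode}
    (h : ∀ φ ψ, HasSum (fun n => inner ℂ (K n φ) (W (K n ψ))) (inner ℂ φ (W' ψ)))
    (ρ : traceClass) : trace ((krausMap hK ρ : Mode →L[ℂ] Mode) ∘L W)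
      = trace ((ρ : Mode →L[ℂ] Mode) ∘L W') := by
  obtain ⟨φ, ψ, h1⟩ := exists_nuclearSeries ρ.2
  have h2 := (h1.kraus hK).1.hasSum_trace_comp W
  have h3 := ((Equiv.prodComm ℕ ι).hasSum_iff.2 h2).prod_fiberwise fun k => h (ψ k) (φ k)
  exact h3.unique (h1.hasSum_trace_comp W')

theorem hasSum_norm_sq_of_hasSum_inner {A : ι → Mode →L[ℂ] Mode}
    (h : ∀ φ ψ, HasSum (fun n => inner ℂ (A n φ) (A n ψ)) (inner ℂ φ ψ)) (ψ : Mode) :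
    HasSum (fun n => ‖A n ψ‖ ^ 2) (‖ψ‖ ^ 2) := by
  have h1 := h ψ ψ
  simp_rw [inner_self_eq_norm_sq_to_K] at h1
  exact_mod_cast h1

end Kraus

/-! ### Gaussian channels from kernel identities -/

theorem weyl_zero : weyl 0 = ContinuousLinearMap.id ℂ Mode := by
  simp [weyl, displacement_zero]

/-- One Gaussian identity on exponential vectors suffices for everything: completeness, the channel
and its characteristic function. The last conjunct, giving matrix elements of Φ ρ, serves the
computation of Choi states. -/
theorem exists_isGaussianChannel (K : ℕ → ℕ → Mode →L[ℂ] Mode) (X Y : Matrix (Fin 2) (Fin 2) ℝ)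
    (h : ∀ ξ w z, HasSum
      (fun n : ℕ × ℕ => inner ℂ (K n.1 n.2 (expVec w)) (weyl ξ (K n.1 n.2 (expVec z))))
      ((Real.exp (-(1 / 2) * (ξ ⬝ᵥ Y.mulVec ξ)) : ℂ)
        * inner ℂ (expVec w) (weyl (X.mulVec ξ) (expVec z)))) :
    ∃ Φ : traceClass →ₗ[ℂ] traceClass, IsGaussianChannel X Y Φ ∧ IsKrausRepresentation Φ K ∧
      ∀ (ρ : traceClass) (x y : Mode), HasSum (fun n : ℕ × ℕ => inner ℂ (adjoint (K n.1 n.2) x)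
        ((ρ : Mode →L[ℂ] Mode) (adjoint (K n.1 n.2) y)))
        (inner ℂ x ((Φ ρ : Mode →L[ℂ] Mode) y)) := by
  set A : ℕ × ℕ → Mode →L[ℂ] Mode := fun n => K n.1 n.2
  -- At ξ = 0 both Weyl operators and the Gaussian factor are trivial, and the hypothesis reads ∑
  -- K†K = 1.
  obtain ⟨V, hV, hi⟩ := exists_isometry_lp A dense_span_expVec fun w z => by
    simpa [weyl_zero] using h 0 w z
  have hA : ∀ φ ψ, HasSum (fun n => inner ℂ (A n φ) (A n ψ)) (inner ℂ φ ψ) := fun φ ψ => by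
    simpa [hV, hi] using lp.hasSum_inner (𝕜 := ℂ) (V φ) (V ψ)
  have hK := hasSum_norm_sq_of_hasSum_inner hA
  refine ⟨krausMap hK, ⟨isCompletelyPositive_krausMap hK, fun ρ => ?_, fun ρ ξ => ?_⟩,
    ⟨hasTraceNormSum_krausMap hK, hasSum_adjoint_apply_apply hV hi⟩, fun ρ x y => ?_⟩
  · simpa using trace_krausMap_comp hK (W := ContinuousLinearMap.id ℂ Mode)
      (W' := ContinuousLinearMap.id ℂ Mode) hA ρ
  · have h1 := trace_krausMap_comp hK (W := weyl ξ)
      (W' := (Real.exp (-(1 / 2) * (ξ ⬝ᵥ Y.mulVec ξ)) : ℂ) • weyl (X.mulVec ξ))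
      (hasSum_inner_comp hV (weyl ξ) dense_span_expVec fun w z => by
        simpa [inner_smul_right] using h ξ w z) ρ
    rw [charFn, h1, charFn, comp_smul]
    simp only [trace, smul_apply, inner_smul_right]
    rw [tsum_mul_left, mul_comm]
  · obtain ⟨φ, ψ, h'⟩ := exists_nuclearSeries ρ.2
    have h2 := ((h'.kraus hK).2.1.hasSum.mapL (ContinuousLinearMap.apply ℂ Mode y)).mapL
      (innerSL ℂ x)
    simpa [adjoint_inner_left, coe_krausMap, A] using h2

/-! ### Taylor coefficients of entire vector-valued functions -/

section Entire

variable {H : Type*} [NormedAddCommGroup H] [InnerProductSpace ℂ H]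

theorem sqrt_factorial_ne_zero (n : ℕ) : (Real.sqrt (Nat.factorial n) : ℂ) ≠ 0 := by
  rw [Complex.ofReal_ne_zero, Real.sqrt_ne_zero']
  exact_mod_cast Nat.factorial_pos n

theorem sqrt_factorial_mul_self (n : ℕ) :
    (Real.sqrt (Nat.factorial n) : ℂ) * (Real.sqrt (Nat.factorial n) : ℂ)
      = (Nat.factorial n : ℂ) := by
  rw [← Complex.ofReal_mul, Real.mul_self_sqrt (Nat.cast_nonneg _)]
  simp

/-- The terms tend to zero at every positive radius, so the radius of convergence is infinite. -/
theorem hasFPowerSeriesOnBall_of_hasSum [CompleteSpace H] {f : ℂ → H} {c : ℕ → H}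
    (h : ∀ a : ℂ, HasSum (fun n : ℕ => a ^ n • c n) (f a)) :
    HasFPowerSeriesOnBall f (fun n => ContinuousMultilinearMap.mkPiRing ℂ (Fin n) (c n)) 0 ⊤ where
  r_le := by
    refine top_le_iff.2 (ENNReal.eq_top_of_forall_nnreal_le fun r => ?_)
    refine FormalMultilinearSeries.le_radius_of_tendsto (l := 0) _ ?_
    have h1 := (h (r : ℂ)).summable.tendsto_atTop_zero.norm
    simpa [norm_smul, mul_comm] using h1
  r_pos := ENNReal.zero_lt_top
  hasSum := fun {y} _ => by simpa using h y

theorem differentiable_of_hasSum [CompleteSpace H] {f : ℂ → H} {c : ℕ → H}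
    (h : ∀ a : ℂ, HasSum (fun n : ℕ => a ^ n • c n) (f a)) : Differentiable ℂ f := by
  have h1 := (hasFPowerSeriesOnBall_of_hasSum h).differentiableOn
  simpa [differentiableOn_univ] using h1

/-- Taylor coefficients are normalised by √(n!) so that they match Fock components of exponential
vectors. -/
theorem exists_hasSum_of_differentiable [CompleteSpace H] {f : ℂ → H} (hf : Differentiable ℂ f) :
    ∃ c : ℕ → H, ∀ a : ℂ,
      HasSum (fun n : ℕ => (a ^ n / (Real.sqrt (Nat.factorial n) : ℂ)) • c n) (f a) := by
  have h1 := hf.hasFPowerSeriesOnBall 0 (R := (1 : NNReal)) one_pos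
  refine ⟨fun n => (Real.sqrt (Nat.factorial n) : ℂ) • (cauchyPowerSeries f 0 ((1 : NNReal) : ℝ)).coeff n,
    fun a => ?_⟩
  have h2 := h1.hasSum (y := a) (by simp)
  rw [zero_add] at h2
  refine h2.congr_fun fun n => ?_
  rw [FormalMultilinearSeries.apply_eq_pow_smul_coeff, smul_smul,
    div_mul_cancel₀ _ (sqrt_factorial_ne_zero n)]

theorem coeff_unique {x y : ℕ → ℂ} {f : ℂ → ℂ}
    (hx : ∀ a : ℂ, HasSum (fun n : ℕ => a ^ n / (Real.sqrt (Nat.factorial n) : ℂ) * x n) (f a))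
    (hy : ∀ a : ℂ, HasSum (fun n : ℕ => a ^ n / (Real.sqrt (Nat.factorial n) : ℂ) * y n) (f a)) :
    x = y := by
  have h1 : ∀ {x : ℕ → ℂ}, (∀ a : ℂ, HasSum
      (fun n : ℕ => a ^ n / (Real.sqrt (Nat.factorial n) : ℂ) * x n) (f a)) →
      HasFPowerSeriesAt f (fun n => ContinuousMultilinearMap.mkPiRing ℂ (Fin n)
        (x n / (Real.sqrt (Nat.factorial n) : ℂ))) 0 := fun {x} hx =>
    (hasFPowerSeriesOnBall_of_hasSum (H := ℂ) fun a => (hx a).congr_fun fun n => by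
      rw [smul_eq_mul]; ring).hasFPowerSeriesAt
  have h2 := (h1 hx).eq_formalMultilinearSeries (h1 hy)
  funext n
  have h3 := congrArg (fun m => m fun _ => (1 : ℂ)) (congrFun h2 n)
  simpa [div_left_inj' (sqrt_factorial_ne_zero n)] using h3

theorem hasSum_antidiagonal {f : ℕ × ℕ → ℂ} {a : ℂ} (hf : HasSum f a) :
    HasSum (fun n => ∑ p ∈ Finset.HasAntidiagonal.antidiagonal n, f p) a := by
  refine (Finset.HasAntidiagonal.sigmaAntidiagonalEquivProd.hasSum_iff.2 hf).sigma fun n => ?_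
  exact Finset.hasSum (Finset.HasAntidiagonal.antidiagonal n) f

theorem hasSum_exp (x : ℂ) : HasSum (fun n : ℕ => x ^ n / (Nat.factorial n : ℂ)) (Complex.exp x) := by
  rw [Complex.exp_eq_exp_ℂ]
  exact NormedSpace.expSeries_div_hasSum_exp x

theorem hasSum_choose_mul_pow (x Q : ℂ) (n : ℕ) :
    HasSum (fun j : ℕ => (n.choose j : ℂ) * x ^ j * Q ^ (n - j)) ((x + Q) ^ n) := by
  have h3 : HasSum (fun j : ℕ => (n.choose j : ℂ) * x ^ j * Q ^ (n - j))
      (∑ j ∈ Finset.range (n + 1), (n.choose j : ℂ) * x ^ j * Q ^ (n - j)) :=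
    hasSum_sum_of_ne_finset_zero fun j hj => by
      rw [Nat.choose_eq_zero_of_lt (by simpa using hj)]
      simp
  have e : ∑ j ∈ Finset.range (n + 1), (n.choose j : ℂ) * x ^ j * Q ^ (n - j) = (x + Q) ^ n := by
    rw [add_pow]
    exact Finset.sum_congr rfl fun j _ => by ring
  rwa [e] at h3

/-- The Cauchy product of the exponential series with the binomial expansion, which exhibits the
m-th normalised coefficient. -/
theorem hasSum_expVec_coeff (C P L Q : ℂ) (n : ℕ) (a : ℂ) :
    HasSum (fun m : ℕ => a ^ m / (Real.sqrt (Nat.factorial m) : ℂ) *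
      ((Real.sqrt (Nat.factorial m) : ℂ) * (C / (Real.sqrt (Nat.factorial n) : ℂ)) *
        ∑ p ∈ Finset.HasAntidiagonal.antidiagonal m,
          P ^ p.1 / (Nat.factorial p.1 : ℂ) * (n.choose p.2 * L ^ p.2 * Q ^ (n - p.2))))
      (C * Complex.exp (P * a) * ((L * a + Q) ^ n / (Real.sqrt (Nat.factorial n) : ℂ))) := by
  have h1 := hasSum_exp (P * a)
  have h2 := hasSum_choose_mul_pow (L * a) Q n
  have hs := summable_mul_of_summable_norm h1.summable.norm h2.summable.norm
  have h3 := hasSum_antidiagonal (h1.mul h2 hs)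
  have e : ∀ s x y : ℂ, C * x * (y / s) = C / s * (x * y) := fun s x y => by ring
  rw [e]
  have key : ∀ x y f a1 a2 p1 c l2 q : ℂ, x ≠ 0 → a1 * a2 / x * (x * (C / y) *
      (p1 / f * (c * l2 * q))) = C / y * (p1 * a1 / f * (c * (l2 * a2) * q)) := by
    intro x y f a1 a2 p1 c l2 q hx
    field_simp
  refine (h3.mul_left (C / (Real.sqrt (Nat.factorial n) : ℂ))).congr_fun fun m => ?_
  simp only [Finset.mul_sum]
  refine Finset.sum_congr rfl fun p hp => ?_
  obtain rfl := Finset.HasAntidiagonal.mem_antidiagonal.1 hp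
  rw [pow_add, mul_pow, mul_pow]
  exact key _ (Real.sqrt (Nat.factorial n) : ℂ) (Nat.factorial p.1 : ℂ) (a ^ p.1) (a ^ p.2)
    (P ^ p.1) (n.choose p.2 : ℂ) (L ^ p.2) (Q ^ (n - p.2)) (sqrt_factorial_ne_zero (p.1 + p.2))

/-- Summing over the power j of L at fixed i gives the negative binomial series ∑ⱼ C(i+j, i) Lʲ = (1
- L)^(-i-1), and the sum over i is then exponential. Absolute convergence allows regrouping along i
+ j = n. -/
theorem hasSum_laguerre {L z : ℂ} (hL : ‖L‖ < 1) :
    HasSum (fun n : ℕ => ∑ p ∈ Finset.HasAntidiagonal.antidiagonal n,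
      z ^ p.1 / (Nat.factorial p.1 : ℂ) * (n.choose p.2 * L ^ p.2))
      (1 / (1 - L) * Complex.exp (z / (1 - L))) := by
  have hr : ∀ i : ℕ, HasSum (fun j : ℕ => ‖z ^ i / (Nat.factorial i : ℂ) *
      (((j + i).choose i : ℂ) * L ^ j)‖)
      (‖z‖ ^ i / (Nat.factorial i : ℝ) * (1 / (1 - ‖L‖) ^ (i + 1))) := fun i => by
    have h := (hasSum_choose_mul_geometric_of_norm_lt_one i (r := ‖L‖) (by simpa using hL)).mul_left
      (‖z‖ ^ i / (Nat.factorial i : ℝ))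
    refine h.congr_fun fun j => by simp
  have hc : ∀ i : ℕ, HasSum (fun j : ℕ => z ^ i / (Nat.factorial i : ℂ) *
      (((j + i).choose i : ℂ) * L ^ j))
      (z ^ i / (Nat.factorial i : ℂ) * (1 / (1 - L) ^ (i + 1))) := fun i =>
    (hasSum_choose_mul_geometric_of_norm_lt_one i hL).mul_left _
  have hs : Summable fun p : ℕ × ℕ => z ^ p.1 / (Nat.factorial p.1 : ℂ) *
      (((p.2 + p.1).choose p.1 : ℂ) * L ^ p.2) := by
    refine Summable.of_norm ?_
    rw [summable_prod_of_nonneg fun _ => norm_nonneg _]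
    refine ⟨fun i => (hr i).summable, ?_⟩
    simp_rw [fun i => (hr i).tsum_eq]
    refine ((Real.summable_pow_div_factorial (‖z‖ / (1 - ‖L‖))).mul_left (1 / (1 - ‖L‖))).congr
      fun i => ?_
    have : (1 - ‖L‖) ≠ 0 := by linarith
    rw [div_pow, pow_succ]
    field_simp
  have h1L : 1 - L ≠ 0 := fun h => by
    rw [← sub_eq_zero.1 h] at hL
    simp at hL
  have h1 := hs.hasSum.prod_fiberwise hc
  have h2 : HasSum (fun i : ℕ => z ^ i / (Nat.factorial i : ℂ) * (1 / (1 - L) ^ (i + 1)))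
      (1 / (1 - L) * Complex.exp (z / (1 - L))) := by
    refine ((hasSum_exp (z / (1 - L))).mul_left (1 / (1 - L))).congr_fun fun i => ?_
    rw [div_pow, pow_succ]
    field_simp
  have h3 := hs.hasSum
  rw [h1.unique h2] at h3
  refine (hasSum_antidiagonal h3).congr_fun fun n => Finset.sum_congr rfl fun p hp => ?_
  have h4 := Finset.HasAntidiagonal.mem_antidiagonal.1 hp
  rw [← h4, Nat.add_comm p.2 p.1, ← Nat.choose_symm_add]

/-- If the generating functions of two sequences of vectors have a Gaussian inner product, then the
inner products of the vectors are summed by the generating function of the Laguerre polynomials. -/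
theorem hasSum_inner_coeff {c d : ℕ → H} {Φ Ψ : ℂ → H} {C L P Q : ℂ}
    (hc : ∀ a : ℂ, HasSum (fun n : ℕ => (a ^ n / (Real.sqrt (Nat.factorial n) : ℂ)) • c n) (Φ a))
    (hd : ∀ a : ℂ, HasSum (fun n : ℕ => (a ^ n / (Real.sqrt (Nat.factorial n) : ℂ)) • d n) (Ψ a))
    (h : ∀ a b, inner ℂ (Ψ b) (Φ a) = C * Complex.exp (L * (starRingEnd ℂ b * a) + P * a
      + Q * starRingEnd ℂ b)) (hL : ‖L‖ < 1) :
    HasSum (fun n => inner ℂ (d n) (c n)) (C * (1 / (1 - L) * Complex.exp (P * Q / (1 - L)))) := by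
  -- Coefficients are compared first in the left variable. Replacing b by its conjugate makes the
  -- antilinear slot holomorphic.
  have h1 : ∀ a n, inner ℂ (d n) (Φ a)
      = C * Complex.exp (P * a) * ((L * a + Q) ^ n / (Real.sqrt (Nat.factorial n) : ℂ)) := by
    intro a n
    refine congrFun (coeff_unique (x := fun n => inner ℂ (d n) (Φ a))
      (y := fun n => C * Complex.exp (P * a) * ((L * a + Q) ^ n / (Real.sqrt (Nat.factorial n) : ℂ)))
      (f := fun b => inner ℂ (Ψ (starRingEnd ℂ b)) (Φ a)) (fun b => ?_) fun b => ?_) n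
    · have h2 := Complex.hasSum_conj'.2 ((hd (starRingEnd ℂ b)).mapL (innerSL ℂ (Φ a)))
      simp only [innerSL_apply_apply] at h2
      rw [inner_conj_symm] at h2
      refine h2.congr_fun fun n => ?_
      rw [inner_conj_symm, inner_smul_left]
      simp
    · rw [h, Complex.conj_conj, show L * (b * a) + P * a + Q * b = P * a + (L * a + Q) * b by ring,
        Complex.exp_add]
      rw [← mul_assoc]
      refine ((hasSum_exp ((L * a + Q) * b)).mul_left (C * Complex.exp (P * a))).congr_fun
        fun n => ?_
      rw [← sqrt_factorial_mul_self, mul_pow]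
      field_simp
  -- Now coefficients are compared in a, which gives all the inner products ⟨d n, c m⟩; only the
  -- diagonal m = n is used.
  have h2 := fun n => coeff_unique (x := fun m => inner ℂ (d n) (c m)) (fun a => by
    have h3 := (hc a).mapL (innerSL ℂ (d n))
    simp only [innerSL_apply_apply, inner_smul_right] at h3
    rw [h1] at h3
    exact h3) (hasSum_expVec_coeff C P L Q n)
  refine ((hasSum_laguerre hL).mul_left C).congr_fun fun n => ?_
  rw [congrFun (h2 n) n, Finset.mul_sum, Finset.mul_sum]
  refine Finset.sum_congr rfl fun p hp => ?_
  have h4 := Finset.HasAntidiagonal.mem_antidiagonal.1 hp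
  -- On the diagonal the exponents of P and Q agree, so only the product PQ remains and the Laguerre
  -- sum applies.
  have h5 : n - p.2 = p.1 := by omega
  have := sqrt_factorial_ne_zero n
  rw [h5, mul_pow]
  field_simp

end Entire

/-! ### Analyticity of exponential vectors and their products -/

theorem hasSum_expVec (z : ℂ) :
    HasSum (fun n : ℕ => z ^ n • ((Real.sqrt (Nat.factorial n) : ℂ)⁻¹ • ket n)) (expVec z) := by
  refine (lp.hasSum_single (p := 2) (by norm_num) (expVec z)).congr_fun fun n => ?_
  rw [expVec_apply, ket, smul_smul, ← div_eq_mul_inv, ← lp.single_smul]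
  simp

theorem differentiable_expVec : Differentiable ℂ expVec := differentiable_of_hasSum hasSum_expVec

theorem norm_prodVec (φ ψ : Mode) : ‖prodVec φ ψ‖ = ‖φ‖ * ‖ψ‖ := by
  have h : ‖prodVec φ ψ‖ ^ 2 = (‖φ‖ * ‖ψ‖) ^ 2 := by
    have h1 := inner_prodVec φ ψ φ ψ
    simp_rw [inner_self_eq_norm_sq_to_K] at h1
    rw [mul_pow]
    exact_mod_cast h1
  exact (sq_eq_sq₀ (norm_nonneg _) (by positivity)).1 h

theorem isBoundedBilinearMap_prodVec :
    IsBoundedBilinearMap ℂ fun p : Mode × Mode => prodVec p.1 p.2 where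
  add_left x y z := by ext p; simp [prodVec_apply, add_mul]
  smul_left c x y := prodVec_smul_left c x y
  add_right x y z := by ext p; simp [prodVec_apply, mul_add]
  smul_right c x y := prodVec_smul_right c x y
  bound := ⟨1, one_pos, fun x y => by rw [norm_prodVec, one_mul]⟩

theorem differentiable_expVec₂ (p q p' q' : ℂ) :
    Differentiable ℂ fun a : ℂ => expVec₂ (p + q * a) (p' + q' * a) := by
  have h1 : ∀ p q : ℂ, Differentiable ℂ fun a : ℂ => expVec (p + q * a) := fun p q =>
    differentiable_expVec.comp (by fun_prop)
  intro a
  exact (isBoundedBilinearMap_prodVec.differentiableAt _).comp a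
    ((h1 p q a).prodMk (h1 p' q' a))

/-! ### Operators are determined by their characteristic functions -/

/-- Strong continuity is explicit on exponential vectors. Displacements are isometric, so
approximating ψ approximates the whole orbit uniformly in β. -/
theorem continuous_displacement_apply (ψ : Mode) : Continuous fun β => displacement β ψ := by
  have h1 : ∀ ψ ∈ Submodule.span ℂ (Set.range expVec), Continuous fun β => displacement β ψ := by
    intro ψ hψ
    induction hψ using Submodule.span_induction with
    | mem x hx =>
      obtain ⟨z, rfl⟩ := hx
      simp_rw [displacement_expVec, displacedExpVec]
      have := differentiable_expVec.continuous
      fun_prop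
    | zero => simpa using continuous_const
    | add x y _ _ hx hy => simp only [map_add]; exact hx.add hy
    | smul c x _ hx => simp only [map_smul]; exact hx.const_smul c
  refine continuous_of_uniform_approx_of_continuous fun u hu => ?_
  obtain ⟨ε, hε, hu⟩ := Metric.mem_uniformity_dist.1 hu
  obtain ⟨φ, hφ, h2⟩ := Metric.dense_iff.1 dense_span_expVec ψ ε hε
  refine ⟨fun β => displacement β φ, h1 φ h2, fun β => hu ?_⟩
  rw [dist_eq_norm, ← map_sub, norm_displacement_apply, ← dist_eq_norm, dist_comm]
  exact hφ

/-- The displacement amplitude of the Weyl operator. -/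
def amplitude (x : ℝ × ℝ) : ℂ := Complex.I * ((x.1 : ℂ) + Complex.I * (x.2 : ℂ))

theorem continuous_amplitude : Continuous amplitude := by
  unfold amplitude
  fun_prop

theorem norm_amplitude_sq (x : ℝ × ℝ) : ‖amplitude x‖ ^ 2 = x.1 ^ 2 + x.2 ^ 2 := by
  rw [amplitude, norm_mul, Complex.norm_I, one_mul, ← Complex.normSq_eq_norm_sq, mul_comm Complex.I,
    Complex.normSq_add_mul_I]

theorem weyl_eq (x : ℝ × ℝ) : weyl ![x.1, x.2] = displacement (amplitude x) := by
  simp [weyl, amplitude]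

theorem amplitude_eq (x : ℝ × ℝ) : amplitude x = Complex.I * x.1 - x.2 := by
  rw [amplitude, mul_add, ← mul_assoc, Complex.I_mul_I]
  ring

theorem conj_amplitude (x : ℝ × ℝ) :
    starRingEnd ℂ (amplitude x) = -(Complex.I * x.1) - x.2 := by
  simp [amplitude_eq]

/-- The Gaussian weight for which the weighted integral of the displacement operators is a multiple
of `|expVec z⟩⟨expVec w|`. -/
def gaussWeight (w z : ℂ) (x : ℝ × ℝ) : ℂ :=
  Complex.exp (-(‖amplitude x‖ ^ 2 / 2 : ℝ) - starRingEnd ℂ w * amplitude x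
    + z * starRingEnd ℂ (amplitude x))

theorem integrable_gaussian_prod {b : ℂ} (hb : b.re < 0) (c d c' d' : ℂ) :
    MeasureTheory.Integrable (fun x : ℝ × ℝ => Complex.exp (b * x.1 ^ 2 + c * x.1 + d)
      * Complex.exp (b * x.2 ^ 2 + c' * x.2 + d')) :=
  (integrable_cexp_quadratic' hb c d).mul_prod (integrable_cexp_quadratic' hb c' d')

theorem gaussWeight_eq (w z : ℂ) (x : ℝ × ℝ) : gaussWeight w z x
    = Complex.exp ((-1 / 2 : ℂ) * x.1 ^ 2 + (-Complex.I * (starRingEnd ℂ w + z)) * x.1 + 0)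
      * Complex.exp ((-1 / 2 : ℂ) * x.2 ^ 2 + (starRingEnd ℂ w - z) * x.2 + 0) := by
  rw [gaussWeight, ← Complex.exp_add, norm_amplitude_sq, conj_amplitude, amplitude_eq]
  congr 1
  push_cast
  ring

theorem integrable_gaussWeight (w z : ℂ) : MeasureTheory.Integrable (gaussWeight w z) := by
  rw [funext (gaussWeight_eq w z)]
  exact integrable_gaussian_prod (by norm_num) _ _ _ _

/-- The weight is chosen so that the integrand factors into two one-dimensional Gaussians, each
contributing √π; completing the squares separates u from v. -/
theorem integral_gaussWeight_mul (w z u v : ℂ) :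
    ∫ x : ℝ × ℝ, gaussWeight w z x
      * inner ℂ (expVec u) (displacement (amplitude x) (expVec v))
      = Real.pi * Complex.exp (-(starRingEnd ℂ w * z))
        * (inner ℂ (expVec u) (expVec z) * inner ℂ (expVec w) (expVec v)) := by
  have h1 : ∀ x : ℝ × ℝ, gaussWeight w z x
      * inner ℂ (expVec u) (displacement (amplitude x) (expVec v))
      = Complex.exp ((-1 : ℂ) * x.1 ^ 2 + (Complex.I *
          ((starRingEnd ℂ u - starRingEnd ℂ w) - (z - v))) * x.1 + starRingEnd ℂ u * v)
        * Complex.exp ((-1 : ℂ) * x.2 ^ 2 +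
          (-((starRingEnd ℂ u - starRingEnd ℂ w) + (z - v))) * x.2 + 0) := fun x => by
    rw [gaussWeight, inner_expVec_displacement_expVec, ← Complex.exp_add, ← Complex.exp_add,
      norm_amplitude_sq, conj_amplitude, amplitude_eq]
    congr 1
    push_cast
    ring
  have h2 : ((Real.pi : ℂ) / -(-1)) ^ (1 / 2 : ℂ) * ((Real.pi : ℂ) / -(-1)) ^ (1 / 2 : ℂ)
      = Real.pi := by
    have h0 : (Real.pi : ℂ) ≠ 0 := by exact_mod_cast Real.pi_ne_zero
    rw [neg_neg, div_one, ← Complex.cpow_add _ _ h0]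
    norm_num
  simp_rw [h1]
  rw [MeasureTheory.Measure.volume_eq_prod, MeasureTheory.integral_prod_mul
      (fun x : ℝ => Complex.exp ((-1 : ℂ) * x ^ 2 + (Complex.I *
          ((starRingEnd ℂ u - starRingEnd ℂ w) - (z - v))) * x + starRingEnd ℂ u * v))
      (fun x : ℝ => Complex.exp ((-1 : ℂ) * x ^ 2 +
          (-((starRingEnd ℂ u - starRingEnd ℂ w) + (z - v))) * x + 0)),
    integral_cexp_quadratic (by norm_num), integral_cexp_quadratic (by norm_num),
    mul_mul_mul_comm, h2, inner_expVec, inner_expVec, mul_assoc, ← Complex.exp_add,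
    ← Complex.exp_add, ← Complex.exp_add]
  congr 2
  have := Complex.I_sq
  field_simp
  simp only [this]
  ring

theorem integrable_gaussWeight_smul (w z : ℂ) (ψ : Mode) : MeasureTheory.Integrable
    fun x : ℝ × ℝ => gaussWeight w z x • displacement (amplitude x) ψ := by
  refine (integrable_gaussWeight w z).smul_bdd ‖ψ‖ ?_ ?_
  · exact ((continuous_displacement_apply ψ).comp continuous_amplitude).aestronglyMeasurable
  · exact Eventually.of_forall fun x => (norm_displacement_apply _ _).le

theorem integral_inner_displacement (w z : ℂ) (φ ψ : Mode) :
    ∫ x : ℝ × ℝ, gaussWeight w z x * inner ℂ φ (displacement (amplitude x) ψ)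
      = Real.pi * Complex.exp (-(starRingEnd ℂ w * z))
        * (inner ℂ φ (expVec z) * inner ℂ (expVec w) ψ) := by
  set J : Mode →L[ℂ] Mode := LinearMap.mkContinuous
    { toFun := fun ψ => ∫ x : ℝ × ℝ, gaussWeight w z x • displacement (amplitude x) ψ
      map_add' := fun ψ φ => by
        simp only [map_add, smul_add]
        exact MeasureTheory.integral_add (integrable_gaussWeight_smul w z ψ)
          (integrable_gaussWeight_smul w z φ)
      map_smul' := fun c ψ => by
        simp only [map_smul, RingHom.id_apply, smul_comm _ c]
        exact MeasureTheory.integral_smul c _ } (∫ x : ℝ × ℝ, ‖gaussWeight w z x‖) (fun ψ => by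
          rw [← MeasureTheory.integral_mul_const]
          refine (MeasureTheory.norm_integral_le_integral_norm _).trans_eq ?_
          simp only [norm_smul, norm_displacement_apply])
  have h1 : ∀ φ ψ, inner ℂ φ (J ψ)
      = ∫ x : ℝ × ℝ, gaussWeight w z x * inner ℂ φ (displacement (amplitude x) ψ) := fun φ ψ => by
    change inner ℂ φ (∫ x : ℝ × ℝ, gaussWeight w z x • displacement (amplitude x) ψ) = _
    rw [← integral_inner (integrable_gaussWeight_smul w z ψ)]
    simp only [inner_smul_right]
  -- Both sides are bounded operators with equal kernels on exponential vectors, which lifts the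
  -- explicit integral to arbitrary φ, ψ.
  have h2 : J = ((Real.pi : ℂ) * Complex.exp (-(starRingEnd ℂ w * z))) •
      InnerProductSpace.rankOne ℂ (expVec z) (expVec w) := by
    refine eq_of_inner_expVec fun u v => ?_
    rw [h1, integral_gaussWeight_mul]
    simp only [smul_apply, InnerProductSpace.rankOne_apply, inner_smul_right]
    ring
  rw [← h1, h2]
  simp only [smul_apply, InnerProductSpace.rankOne_apply, inner_smul_right]
  ring

/-- An inversion formula: with ρ = ∑ |φ k⟩⟨ψ k|, the trace against a displacement is ∑ ⟨ψ k, D φ k⟩,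
and the Gaussian average may be taken term by term. The kernel of ρ is recovered from its
characteristic function. -/
theorem integral_charFn (w z : ℂ) {ρ : Mode →L[ℂ] Mode} (hρ : ρ ∈ traceClass) :
    ∫ x : ℝ × ℝ, gaussWeight w z x * charFn ![x.1, x.2] ρ
      = Real.pi * Complex.exp (-(starRingEnd ℂ w * z)) * inner ℂ (expVec w) (ρ (expVec z)) := by
  obtain ⟨φ, ψ, h⟩ := exists_nuclearSeries hρ
  have hm : ∀ φ ψ : Mode, MeasureTheory.Integrable fun x : ℝ × ℝ =>
      gaussWeight w z x * inner ℂ φ (displacement (amplitude x) ψ) := fun φ ψ => by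
    simpa [inner_smul_right] using (integrable_gaussWeight_smul w z ψ).const_inner (𝕜 := ℂ) φ
  have hs : Summable fun k => ∫ x : ℝ × ℝ,
      ‖gaussWeight w z x * inner ℂ (ψ k) (displacement (amplitude x) (φ k))‖ := by
    refine Summable.of_nonneg_of_le (fun k => by positivity) (fun k => ?_)
      ((summable_norm_mul_norm h.right h.left).mul_left (∫ x : ℝ × ℝ, ‖gaussWeight w z x‖))
    rw [← MeasureTheory.integral_mul_const]
    refine MeasureTheory.integral_mono (hm _ _).norm ((integrable_gaussWeight w z).norm.mul_const _)
      fun x => ?_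
    simp only [norm_mul]
    refine mul_le_mul_of_nonneg_left ?_ (norm_nonneg _)
    refine (norm_inner_le_norm _ _).trans_eq ?_
    rw [norm_displacement_apply]
  have h1 := MeasureTheory.hasSum_integral_of_summable_integral_norm (fun k => hm (ψ k) (φ k)) hs
  have h2 : ∀ x : ℝ × ℝ,
      ∑' k, gaussWeight w z x * inner ℂ (ψ k) (displacement (amplitude x) (φ k))
      = gaussWeight w z x * charFn ![x.1, x.2] ρ := fun x => by
    rw [charFn, weyl_eq]
    exact ((h.hasSum_trace_comp _).mul_left _).tsum_eq
  simp only [h2, integral_inner_displacement] at h1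
  refine h1.unique (((hasSum_inner_of_hasSum_rankOne h.hasSum (expVec w) (expVec z)).mul_left
    (Real.pi * Complex.exp (-(starRingEnd ℂ w * z)))).congr_fun fun k => ?_)
  ring

theorem eq_of_charFn_eq {ρ σ : Mode →L[ℂ] Mode} (hρ : ρ ∈ traceClass) (hσ : σ ∈ traceClass)
    (h : ∀ ξ, charFn ξ ρ = charFn ξ σ) : ρ = σ := by
  refine eq_of_inner_expVec fun w z => ?_
  have h1 := integral_charFn w z hρ
  simp only [h] at h1
  rw [integral_charFn w z hσ] at h1
  have h2 : (Real.pi : ℂ) * Complex.exp (-(starRingEnd ℂ w * z)) ≠ 0 :=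
    mul_ne_zero (by exact_mod_cast Real.pi_ne_zero) (Complex.exp_ne_zero _)
  exact (mul_left_cancel₀ h2 h1).symm

theorem IsGaussianChannel.iff_eq {X Y : Matrix (Fin 2) (Fin 2) ℝ} {Φ : traceClass →ₗ[ℂ] traceClass}
    (h : IsGaussianChannel X Y Φ) (Ψ : traceClass →ₗ[ℂ] traceClass) :
    IsGaussianChannel X Y Ψ ↔ Ψ = Φ := by
  refine ⟨fun h' => LinearMap.ext fun ρ => Subtype.ext ?_, fun h' => h' ▸ h⟩
  refine eq_of_charFn_eq (Ψ ρ).2 (Φ ρ).2 fun ξ => ?_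
  rw [h.charFn_apply, h'.charFn_apply]

/-! ### Generating functions of the coefficients -/

/-- The range of k in the definition is exactly where both binomials can be nonzero, so the sum may
run over the whole antidiagonal; within that range the truncated subtractions in the exponents are
genuine. -/
theorem hC_eq_sum_antidiagonal (n₁ n₂ m : ℕ) (s c : ℝ) : hC n₁ n₂ m s c
    = Real.sqrt (((n₁ + n₂ - m).factorial * m.factorial : ℝ) / (n₁.factorial * n₂.factorial)) *
      ∑ p ∈ Finset.HasAntidiagonal.antidiagonal m, (n₁.choose p.1 * n₂.choose p.2 * (-1) ^ p.1
        * s ^ (p.1 + (n₂ - p.2)) * c ^ ((n₁ - p.1) + p.2) : ℝ) := by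
  rw [Finset.Nat.sum_antidiagonal_eq_sum_range_succ (fun i j => (n₁.choose i * n₂.choose j * (-1) ^ i
    * s ^ (i + (n₂ - j)) * c ^ ((n₁ - i) + j) : ℝ)), hC, Finset.mul_sum]
  refine Finset.sum_subset_zero_on_sdiff (fun k hk => ?_) (fun k hk => ?_) fun k hk => ?_
  · simp only [Finset.mem_Icc, Finset.mem_range] at hk ⊢
    omega
  · simp only [Finset.mem_sdiff, Finset.mem_Icc, Finset.mem_range] at hk
    rcases lt_or_ge n₁ k with h | h
    · simp [Nat.choose_eq_zero_of_lt h]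
    · rw [Nat.choose_eq_zero_of_lt (show n₂ < m - k by omega)]
      simp
  · simp only [Finset.mem_Icc] at hk
    rw [show k + (n₂ - (m - k)) = 2 * k + n₂ - m by omega,
      show n₁ - k + (m - k) = n₁ + m - 2 * k by omega]
    ring

/-- Two-mode squeezing and the beam splitter share one coefficient array: an input index is
exchanged with an output index and the roles of s and t are interchanged. All facts about `hAB`
below except its growth bound and its limits come from this. -/
theorem hAB_eq_mul_hC (n₁ n₂ m₁ : ℕ) (s t : ℝ) :
    hAB n₁ n₂ m₁ s t = s * hC n₂ m₁ n₁ t s := by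
  rw [hAB, hC, Finset.mul_sum, min_comm]
  refine Finset.sum_congr rfl fun k hk => ?_
  simp only [Finset.mem_Icc] at hk
  have h := min_le_left n₂ n₁
  have h' := min_le_right n₂ n₁
  rw [show n₁ + n₂ - 2 * k + 1 = (n₂ + n₁ - 2 * k) + 1 by omega, pow_succ,
    mul_comm (n₁.factorial : ℝ)]
  ring

/-- A beam splitter acts on the two arguments as a rotation. The identity is the product of two
binomial expansions regrouped by the power of z, with square roots of factorials absorbed into the
coefficient. -/
theorem hasSum_hC (n₁ n₂ : ℕ) (s c : ℝ) (u z : ℂ) :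
    HasSum (fun m : ℕ => (hC n₁ n₂ m s c : ℂ)
      * (u ^ (n₁ + n₂ - m) / (Real.sqrt (Nat.factorial (n₁ + n₂ - m)) : ℂ))
      * (z ^ m / (Real.sqrt (Nat.factorial m) : ℂ)))
      ((c * u - s * z) ^ n₁ / (Real.sqrt (Nat.factorial n₁) : ℂ)
        * ((s * u + c * z) ^ n₂ / (Real.sqrt (Nat.factorial n₂) : ℂ))) := by
  have h1 := hasSum_choose_mul_pow (-(s * z)) (c * u) n₁
  have h2 := hasSum_choose_mul_pow (c * z) (s * u) n₂
  have hs := summable_mul_of_summable_norm h1.summable.norm h2.summable.norm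
  have h3 := (hasSum_antidiagonal (h1.mul h2 hs)).mul_left
    (1 / ((Real.sqrt (Nat.factorial n₁) : ℂ) * (Real.sqrt (Nat.factorial n₂) : ℂ)))
  have e : 1 / ((Real.sqrt (Nat.factorial n₁) : ℂ) * (Real.sqrt (Nat.factorial n₂) : ℂ))
      * ((-(s * z) + c * u) ^ n₁ * (c * z + s * u) ^ n₂)
      = (c * u - s * z) ^ n₁ / (Real.sqrt (Nat.factorial n₁) : ℂ)
        * ((s * u + c * z) ^ n₂ / (Real.sqrt (Nat.factorial n₂) : ℂ)) := by
    rw [neg_add_eq_sub, add_comm (c * z)]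
    ring
  rw [← e]
  refine h3.congr_fun fun m => ?_
  have hsq : ((Real.sqrt (((n₁ + n₂ - m).factorial * m.factorial : ℝ)
      / (n₁.factorial * n₂.factorial)) : ℝ) : ℂ)
      = (Real.sqrt (Nat.factorial (n₁ + n₂ - m)) : ℂ) * (Real.sqrt (Nat.factorial m) : ℂ)
        / ((Real.sqrt (Nat.factorial n₁) : ℂ) * (Real.sqrt (Nat.factorial n₂) : ℂ)) := by
    rw [Real.sqrt_div (by positivity), Real.sqrt_mul (by positivity), Real.sqrt_mul (by positivity)]
    push_cast
    rfl
  have key : ∀ a b f S x y : ℂ, a ≠ 0 → b ≠ 0 →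
      (a * b / f * S) * (x / a) * (y / b) = 1 / f * (S * (x * y)) := by
    intro a b f S x y ha hb
    field_simp
  rw [hC_eq_sum_antidiagonal, Complex.ofReal_mul, hsq,
    key _ _ _ _ _ _ (sqrt_factorial_ne_zero _) (sqrt_factorial_ne_zero _), Complex.ofReal_sum,
    Finset.sum_mul]
  refine congrArg _ (Finset.sum_congr rfl fun p hp => ?_)
  have hp' := Finset.HasAntidiagonal.mem_antidiagonal.1 hp
  rcases lt_or_ge n₁ p.1 with h | h
  · simp [Nat.choose_eq_zero_of_lt h]
  rcases lt_or_ge n₂ p.2 with h' | h'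
  · simp [Nat.choose_eq_zero_of_lt h']
  rw [← hp', show n₁ + n₂ - (p.1 + p.2) = (n₁ - p.1) + (n₂ - p.2) by omega]
  push_cast
  rw [neg_pow (s * z), mul_pow, mul_pow, mul_pow, mul_pow, pow_add, pow_add, pow_add, pow_add]
  ring

theorem hasSum_hAB (n₂ m₁ : ℕ) (s t : ℝ) (a z : ℂ) :
    HasSum (fun n₁ : ℕ => (hAB n₁ n₂ m₁ s t : ℂ)
      * (z ^ (n₂ + m₁ - n₁) / (Real.sqrt (Nat.factorial (n₂ + m₁ - n₁)) : ℂ))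
      * (a ^ n₁ / (Real.sqrt (Nat.factorial n₁) : ℂ)))
      (s * ((t * z + s * a) ^ m₁ / (Real.sqrt (Nat.factorial m₁) : ℂ)
        * ((s * z - t * a) ^ n₂ / (Real.sqrt (Nat.factorial n₂) : ℂ)))) := by
  have h := (hasSum_hC n₂ m₁ t s z a).mul_left (s : ℂ)
  rw [mul_comm (_ / _)] at h
  refine h.congr_fun fun n₁ => ?_
  rw [hAB_eq_mul_hC]
  push_cast
  ring

theorem hC_eq_zero {n₁ n₂ m : ℕ} (h : n₁ + n₂ < m) (s c : ℝ) : hC n₁ n₂ m s c = 0 := by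
  rw [hC, Finset.Icc_eq_empty, Finset.sum_empty]
  have := min_le_left n₁ m
  omega

theorem hAB_eq_zero {n₁ n₂ m₁ : ℕ} (h : n₂ + m₁ < n₁) (s t : ℝ) : hAB n₁ n₂ m₁ s t = 0 := by
  rw [hAB_eq_mul_hC, hC_eq_zero h, mul_zero]

/-! ### Bounds for the coefficients -/

/-- A bound for `hAB n₁ n₂ m` on `|s| ≤ 1`, `|t| ≤ τ`. -/
def bandBound (n₁ n₂ : ℕ) (τ : ℝ) (m : ℕ) : ℝ :=
  (n₁ + 1 : ℕ) * ((1 + n₁.factorial * (m + n₂) ^ n₂) * 2 ^ n₂ * (m + 1) ^ n₁ * τ ^ (m - n₁))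

theorem factorial_div_le (n₁ n₂ m : ℕ) :
    (n₁.factorial * (n₂ + m - n₁).factorial : ℝ) / (n₂.factorial * m.factorial)
      ≤ n₁.factorial * (m + n₂) ^ n₂ := by
  have h1 : ((n₂ + m - n₁).factorial : ℝ) ≤ m.factorial * (m + n₂) ^ n₂ := by
    have h2 : (n₂ + m - n₁).factorial ≤ m.factorial * (m + n₂) ^ n₂ := by
      refine (Nat.factorial_le (show n₂ + m - n₁ ≤ m + n₂ by omega)).trans ?_
      rw [← Nat.factorial_mul_ascFactorial]
      exact Nat.mul_le_mul_left _ (Nat.ascFactorial_le_pow_add _ _)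
    exact_mod_cast h2
  have h2 : (1 : ℝ) ≤ n₂.factorial := by exact_mod_cast Nat.factorial_pos n₂
  have h3 : (0 : ℝ) < m.factorial := by exact_mod_cast Nat.factorial_pos m
  rw [div_le_iff₀ (by positivity)]
  calc (n₁.factorial * (n₂ + m - n₁).factorial : ℝ)
      ≤ n₁.factorial * (m.factorial * (m + n₂) ^ n₂) := by gcongr
    _ = n₁.factorial * (m + n₂) ^ n₂ * (1 * m.factorial) := by ring
    _ ≤ _ := by gcongr

/-- At fixed n₁, n₂ the number of terms is bounded, the binomials and the factorial ratio grow
polynomially in m, and the power of t decays geometrically. The bound is uniform in s and t, as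
dominated convergence requires. -/
theorem abs_hAB_le {s t τ : ℝ} (hs : |s| ≤ 1) (ht : |t| ≤ τ) (hτ : τ ≤ 1) (n₁ n₂ m : ℕ) :
    |hAB n₁ n₂ m s t| ≤ bandBound n₁ n₂ τ m := by
  have hτ0 : 0 ≤ τ := (abs_nonneg t).trans ht
  rw [hAB]
  refine (Finset.abs_sum_le_sum_abs _ _).trans ?_
  refine (Finset.sum_le_card_nsmul _ _
    ((1 + n₁.factorial * (m + n₂) ^ n₂) * 2 ^ n₂ * (m + 1) ^ n₁ * τ ^ (m - n₁))
    fun k hk => ?_).trans ?_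
  · simp only [Finset.mem_Icc] at hk
    have h1 : Real.sqrt ((n₁.factorial * (n₂ + m - n₁).factorial : ℝ)
        / (n₂.factorial * m.factorial)) ≤ 1 + n₁.factorial * (m + n₂) ^ n₂ := by
      have h2 := factorial_div_le n₁ n₂ m
      refine Real.sqrt_le_iff.2 ⟨by positivity, ?_⟩
      have : (0 : ℝ) ≤ n₁.factorial * (m + n₂) ^ n₂ := by positivity
      nlinarith
    have h2 : (n₂.choose k : ℝ) ≤ 2 ^ n₂ := by exact_mod_cast Nat.choose_le_two_pow n₂ k
    have h3 : (m.choose (n₁ - k) : ℝ) ≤ (m + 1) ^ n₁ := by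
      have h4 : m.choose (n₁ - k) ≤ (m + 1) ^ n₁ :=
        (Nat.choose_le_pow m (n₁ - k)).trans ((Nat.pow_le_pow_left (Nat.le_succ m) _).trans
          (Nat.pow_le_pow_right (Nat.succ_pos m) (Nat.sub_le _ _)))
      exact_mod_cast h4
    have h4 : |s| ^ (n₁ + n₂ - 2 * k + 1) ≤ 1 := pow_le_one₀ (abs_nonneg _) hs
    have h5 : |t| ^ (2 * k + m - n₁) ≤ τ ^ (m - n₁) :=
      (pow_le_pow_left₀ (abs_nonneg _) ht _).trans
        (pow_le_pow_of_le_one hτ0 hτ (by omega))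
    simp only [abs_mul, abs_pow, abs_neg, abs_one, one_pow, mul_one, Nat.abs_cast,
      abs_of_nonneg (Real.sqrt_nonneg _)]
    calc _ ≤ (1 + n₁.factorial * (m + n₂) ^ n₂ : ℝ) * 2 ^ n₂ * (m + 1) ^ n₁ * 1 * τ ^ (m - n₁) := by
          gcongr
      _ = _ := by ring
  · rw [bandBound, nsmul_eq_mul]
    refine mul_le_mul_of_nonneg_right ?_ (by positivity)
    have : (Finset.Icc (n₁ - m) (min n₁ n₂)).card ≤ n₁ + 1 := by
      rw [Nat.card_Icc]
      have := min_le_left n₁ n₂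
      omega
    exact_mod_cast this

theorem summable_bandBound (n₁ n₂ : ℕ) {τ : ℝ} (h0 : 0 < τ) (h1 : τ < 1) :
    Summable (bandBound n₁ n₂ τ) := by
  -- With this shift m + q dominates both m + n₁ + n₂ and m + n₁ + 1, so one power of m + q covers
  -- all polynomial factors.
  set q := n₁ + n₂ + 1
  have h2 : Summable fun m : ℕ => ((m : ℝ) ^ (n₁ + n₂)) * τ ^ m :=
    summable_pow_mul_geometric_of_norm_lt_one _ (by rwa [Real.norm_eq_abs, abs_of_pos h0])
  have h3 := ((summable_nat_add_iff q).2 h2).mul_left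
    ((n₁ + 1 : ℕ) * ((1 + n₁.factorial) * 2 ^ n₂) * (τ ^ q)⁻¹)
  rw [← summable_nat_add_iff n₁]
  refine Summable.of_nonneg_of_le (fun m => ?_) (fun m => ?_) h3
  · unfold bandBound; positivity
  · rw [bandBound, Nat.add_sub_cancel]
    have e1 : ((m + q : ℕ) : ℝ) = m + n₁ + n₂ + 1 := by simp [q]; ring
    have e2 : (1 + n₁.factorial * (((m + n₁ : ℕ) : ℝ) + n₂) ^ n₂ : ℝ)
        ≤ (1 + n₁.factorial) * ((m + q : ℕ) : ℝ) ^ n₂ := by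
      have h4 : (1 : ℝ) ≤ ((m + q : ℕ) : ℝ) ^ n₂ := one_le_pow₀ (by
        rw [e1]
        have : (0 : ℝ) ≤ m + n₁ + n₂ := by positivity
        linarith)
      have h5 : (((m + n₁ : ℕ) : ℝ) + n₂) ^ n₂ ≤ ((m + q : ℕ) : ℝ) ^ n₂ := by
        gcongr
        rw [e1]
        push_cast
        linarith
      rw [add_mul, one_mul]
      gcongr
    have e3 : (((m + n₁ : ℕ) : ℝ) + 1) ^ n₁ ≤ ((m + q : ℕ) : ℝ) ^ n₁ := by
      gcongr
      rw [e1]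
      push_cast
      have : (0 : ℝ) ≤ n₂ := by positivity
      linarith
    have e4 : τ ^ m = (τ ^ q)⁻¹ * τ ^ (m + q) := by
      have h6 : τ ^ q ≠ 0 := by positivity
      rw [pow_add τ m q, mul_left_comm, inv_mul_cancel₀ h6, mul_one]
    calc _ ≤ ((n₁ + 1 : ℕ) : ℝ) * ((1 + n₁.factorial) * ((m + q : ℕ) : ℝ) ^ n₂ * 2 ^ n₂
          * ((m + q : ℕ) : ℝ) ^ n₁ * τ ^ m) := by gcongr
      _ = _ := by
        rw [e4, pow_add _ n₁ n₂]
        ring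

theorem summable_abs_hAB {s t : ℝ} (hs : |s| ≤ 1) (ht : |t| < 1) (n₁ n₂ : ℕ) :
    Summable fun m => |hAB n₁ n₂ m s t| := by
  have h0 := abs_nonneg t
  exact Summable.of_nonneg_of_le (fun _ => abs_nonneg _)
    (fun m => abs_hAB_le hs (show |t| ≤ (|t| + 1) / 2 by linarith) (by linarith) n₁ n₂ m)
    (summable_bandBound n₁ n₂ (by linarith) (by linarith))

/-! ### Band operators -/

theorem norm_ket (n : ℕ) : ‖ket n‖ = 1 := by
  simp [ket, lp.norm_single]

theorem norm_ketBra (m n : ℕ) : ‖ketBra m n‖ = 1 := by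
  simp [ketBra, norm_ket]

theorem ket_apply (m n : ℕ) : ket m n = if n = m then 1 else 0 := by
  rw [ket, lp.single_apply]
  by_cases h : n = m <;> simp [h]

theorem ketBra_apply (m n : ℕ) (ψ : Mode) (i : ℕ) : ketBra m n ψ i = if i = m then ψ n else 0 := by
  rw [ketBra, InnerProductSpace.rankOne_apply, inner_ket, lp.coeFn_smul, Pi.smul_apply, ket_apply]
  by_cases h : i = m <;> simp [h]

theorem norm_bandTerm_le (n₁ n₂ : ℕ) (c : ℕ → ℝ) (m : ℕ) : ‖bandTerm n₁ n₂ c m‖ ≤ |c m| := by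
  unfold bandTerm
  split_ifs
  · rw [norm_smul, norm_ketBra]
    simp
  · simp

theorem summable_bandTerm {n₁ n₂ : ℕ} {c : ℕ → ℝ} (h : Summable fun m => |c m|) :
    Summable (bandTerm n₁ n₂ c) :=
  Summable.of_norm_bounded h (norm_bandTerm_le n₁ n₂ c)

theorem bandOp_apply {n₁ n₂ : ℕ} {c : ℕ → ℝ} (h : Summable (bandTerm n₁ n₂ c)) (ψ : Mode) (i : ℕ) :
    bandOp n₁ n₂ c ψ i = if n₁ ≤ n₂ + i then (c i : ℂ) * ψ (n₂ + i - n₁) else 0 := by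
  have h1 := (h.hasSum.mapL (ContinuousLinearMap.apply ℂ Mode ψ)).mapL (innerSL ℂ (ket i))
  simp only [ContinuousLinearMap.apply_apply, innerSL_apply_apply, inner_ket] at h1
  refine h1.unique ?_
  have h2 : ∀ m, bandTerm n₁ n₂ c m ψ i
      = if m = i then (if n₁ ≤ n₂ + i then (c i : ℂ) * ψ (n₂ + i - n₁) else 0) else 0 := fun m => by
    unfold bandTerm
    split_ifs with h3 h4 h5 h4 h5
    · subst h4
      rw [smul_apply, lp.coeFn_smul, Pi.smul_apply, ketBra_apply, if_pos rfl, smul_eq_mul]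
    · subst h4
      exact absurd h3 h5
    · rw [smul_apply, lp.coeFn_smul, Pi.smul_apply, ketBra_apply, if_neg (Ne.symm h4), smul_zero]
    · subst h4
      exact absurd h5 h3
    · rfl
    · rfl
  simp_rw [h2]
  exact hasSum_ite_eq i _

/-! ### Sums over the Kraus family of band operators -/

/-- The band operators with the coefficients `g x₁^n₁ x₂^n₂ h[s, t]`. -/
def bandKraus (g x₁ x₂ s t : ℝ) (n₁ n₂ : ℕ) : Mode →L[ℂ] Mode :=
  bandOp n₁ n₂ fun m => g * x₁ ^ n₁ * x₂ ^ n₂ * hAB n₁ n₂ m s t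

theorem summable_bandTerm_hAB {s t : ℝ} (hs : |s| ≤ 1) (ht : |t| < 1) (c : ℝ) (n₁ n₂ : ℕ) :
    Summable (bandTerm n₁ n₂ fun m => c * hAB n₁ n₂ m s t) := by
  refine summable_bandTerm ?_
  simp_rw [abs_mul c]
  exact (summable_abs_hAB hs ht n₁ n₂).mul_left _

section BandKraus

variable {g x₁ x₂ s t : ℝ}

theorem bandKraus_apply (hs : |s| ≤ 1) (ht : |t| < 1) (n₁ n₂ : ℕ) (ψ : Mode) (i : ℕ) :
    bandKraus g x₁ x₂ s t n₁ n₂ ψ i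
      = ((g * x₁ ^ n₁ * x₂ ^ n₂ * hAB n₁ n₂ i s t : ℝ) : ℂ) * ψ (n₂ + i - n₁) := by
  rw [bandKraus, bandOp_apply (summable_bandTerm_hAB hs ht _ n₁ n₂)]
  split_ifs with h
  · rfl
  · rw [hAB_eq_zero (not_le.1 h)]
    simp

/-- The generating function `∑ aⁿ / √(n!) K_{n, n₂} expVec z`, with `n₂` as the second index. -/
def bandGen (g x₁ x₂ s t : ℝ) (z a : ℂ) : TwoMode :=
  ((g * s : ℝ) : ℂ) • expVec₂ (t * z + (s * x₁) * a) (x₂ * s * z + (-(x₂ * t * x₁)) * a)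

/-- For fixed n₁, the vectors K_{n₁,n₂} e_z over all n₂ are the slices of one two-mode vector, the
n₁-th Taylor coefficient of `bandGen`. Summation over n₂ thus becomes an inner product in `TwoMode`,
and summation over n₁ is left to `hasSum_inner_coeff`. -/
theorem exists_bandCoeff (hs : |s| ≤ 1) (ht : |t| < 1) (g x₁ x₂ : ℝ) (z : ℂ) :
    ∃ c : ℕ → TwoMode, (∀ a : ℂ, HasSum
      (fun n : ℕ => (a ^ n / (Real.sqrt (Nat.factorial n) : ℂ)) • c n)
        (bandGen g x₁ x₂ s t z a)) ∧
      ∀ n₁ n₂, row (swapModes (c n₁)) n₂ = bandKraus g x₁ x₂ s t n₁ n₂ (expVec z) := by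
  have hd : Differentiable ℂ (bandGen g x₁ x₂ s t z) := by
    refine Differentiable.fun_smul ?_ (differentiable_expVec₂ _ _ _ _)
    fun_prop
  obtain ⟨c, hc⟩ := exists_hasSum_of_differentiable hd
  refine ⟨c, hc, fun n₁ n₂ => ?_⟩
  ext i
  change c n₁ (i, n₂) = _
  refine congrFun (coeff_unique (x := fun n => c n (i, n₂))
    (y := fun n => bandKraus g x₁ x₂ s t n n₂ (expVec z) i)
    (f := fun a => bandGen g x₁ x₂ s t z a (i, n₂)) (fun a => ?_) fun a => ?_) n₁
  · have h1 := (hc a).mapL (innerSL ℂ (ket₂ i n₂))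
    simp only [innerSL_apply_apply, inner_smul_right, inner_ket₂] at h1
    exact h1
  · have h1 := (hasSum_hAB n₂ i s t (x₁ * a) z).mul_left ((g * x₂ ^ n₂ : ℝ) : ℂ)
    have e : bandGen g x₁ x₂ s t z a (i, n₂) = ((g * x₂ ^ n₂ : ℝ) : ℂ) *
        (s * ((t * z + s * (x₁ * a)) ^ i / (Real.sqrt (Nat.factorial i) : ℂ)
        * ((s * z - t * (x₁ * a)) ^ n₂ / (Real.sqrt (Nat.factorial n₂) : ℂ)))) := by
      rw [bandGen, lp.coeFn_smul, Pi.smul_apply, expVec₂_apply, smul_eq_mul,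
        show (x₂ : ℂ) * s * z + (-(x₂ * t * x₁)) * a = x₂ * (s * z - t * (x₁ * a)) by ring,
        mul_pow, mul_assoc (s : ℂ) (x₁ : ℂ) a]
      push_cast
      ring
    rw [e]
    refine h1.congr_fun fun n => ?_
    rw [bandKraus_apply hs ht, expVec_apply, mul_pow]
    push_cast
    ring

theorem hasSum_inner_onFirst (R S : Mode →L[ℂ] Mode) (d c : TwoMode) :
    HasSum (fun j => inner ℂ (R (row (swapModes d) j)) (S (row (swapModes c) j)))
      (inner ℂ (onFirst R d) (onFirst S c)) :=
  ((Equiv.prodComm ℕ ℕ).hasSum_iff.2 (lp.hasSum_inner (𝕜 := ℂ) (onFirst R d)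
    (onFirst S c))).prod_fiberwise fun j =>
      lp.hasSum_inner (𝕜 := ℂ) (R (row (swapModes d) j)) (S (row (swapModes c) j))

/-- The value of `∑ ⟨R K_n expVec w, S K_n expVec z⟩` over a family of band operators, when
`⟨R expVec q, S expVec p⟩ = C exp (A q̄ p + L p + M q̄)`. -/
def bandValue (g x₁ x₂ s t : ℝ) (C A L M w z : ℂ) : ℂ :=
  g ^ 2 * s ^ 2 * C * Complex.exp (A * t ^ 2 * starRingEnd ℂ w * z + L * t * z
      + M * t * starRingEnd ℂ w + x₂ ^ 2 * s ^ 2 * starRingEnd ℂ w * z) *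
    (1 / (1 - x₁ ^ 2 * (A * s ^ 2 + x₂ ^ 2 * t ^ 2)) *
      Complex.exp ((x₁ * (A * t * s * starRingEnd ℂ w + L * s - x₂ ^ 2 * s * t * starRingEnd ℂ w))
        * (x₁ * (A * t * s * z + M * s - x₂ ^ 2 * s * t * z))
        / (1 - x₁ ^ 2 * (A * s ^ 2 + x₂ ^ 2 * t ^ 2))))

variable {R S : Mode →L[ℂ] Mode} {C A L M : ℂ}

/-- The iterated sum, n₂ inside and n₁ outside. Leaving R and S general, with a Gaussian kernel,
covers the displacement sums and the Choi kernels at once. -/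
theorem hasSum_hasSum_bandKraus (hs : |s| ≤ 1) (ht : |t| < 1)
    (h : ∀ p q, inner ℂ (R (expVec q)) (S (expVec p))
      = C * Complex.exp (A * (starRingEnd ℂ q * p) + L * p + M * starRingEnd ℂ q))
    (hl : ‖(x₁ : ℂ) ^ 2 * (A * s ^ 2 + x₂ ^ 2 * t ^ 2)‖ < 1) (w z : ℂ) :
    ∃ f : ℕ → ℂ, (∀ n₁, HasSum (fun n₂ => inner ℂ (R (bandKraus g x₁ x₂ s t n₁ n₂ (expVec w)))
      (S (bandKraus g x₁ x₂ s t n₁ n₂ (expVec z)))) (f n₁)) ∧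
      HasSum f (bandValue g x₁ x₂ s t C A L M w z) := by
  obtain ⟨d, hd, hd'⟩ := exists_bandCoeff hs ht g x₁ x₂ w
  obtain ⟨c, hc, hc'⟩ := exists_bandCoeff hs ht g x₁ x₂ z
  refine ⟨fun n => inner ℂ (onFirst R (d n)) (onFirst S (c n)), fun n₁ => ?_, ?_⟩
  · simpa only [hd', hc'] using hasSum_inner_onFirst R S (d n₁) (c n₁)
  · refine hasSum_inner_coeff (Φ := fun a => onFirst S (bandGen g x₁ x₂ s t z a))
      (Ψ := fun a => onFirst R (bandGen g x₁ x₂ s t w a)) (fun a => ?_) (fun a => ?_)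
      (fun a b => ?_) hl
    · simpa only [map_smul] using (hc a).mapL (onFirst S)
    · simpa only [map_smul] using (hd a).mapL (onFirst R)
    · simp only [bandGen, expVec₂, map_smul, onFirst_prodVec, inner_smul_left, inner_smul_right,
        inner_prodVec, h, inner_expVec]
      rw [Complex.conj_ofReal, mul_assoc C, ← Complex.exp_add]
      have e : ∀ X Y c : ℂ, X = Y →
          ((g * s : ℝ) : ℂ) * (((g * s : ℝ) : ℂ) * (C * Complex.exp X))
            = (g : ℂ) ^ 2 * s ^ 2 * C * Complex.exp Y := by
        rintro X Y c rfl
        push_cast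
        ring
      rw [mul_assoc (_ * C), ← Complex.exp_add]
      refine e _ _ 0 ?_
      simp only [map_add, map_mul, map_neg, Complex.conj_ofReal]
      ring

/-- On the diagonal R = S, w = z all terms are nonnegative, so convergence of the iterated sum is
convergence over pairs. -/
theorem summable_bandKraus (hs : |s| ≤ 1) (ht : |t| < 1)
    (h : ∀ p q, inner ℂ (R (expVec q)) (R (expVec p))
      = C * Complex.exp (A * (starRingEnd ℂ q * p) + L * p + M * starRingEnd ℂ q))
    (hl : ‖(x₁ : ℂ) ^ 2 * (A * s ^ 2 + x₂ ^ 2 * t ^ 2)‖ < 1) (z : ℂ) :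
    Summable fun n : ℕ × ℕ => ‖R (bandKraus g x₁ x₂ s t n.1 n.2 (expVec z))‖ ^ 2 := by
  obtain ⟨f, h1, h2⟩ := hasSum_hasSum_bandKraus (g := g) hs ht h hl z z
  have h3 : ∀ n₁, HasSum (fun n₂ => ‖R (bandKraus g x₁ x₂ s t n₁ n₂ (expVec z))‖ ^ 2)
      (f n₁).re := fun n₁ => by
    have h4 := Complex.hasSum_re (h1 n₁)
    refine h4.congr_fun fun n₂ => ?_
    rw [inner_self_eq_norm_sq_to_K]
    norm_cast
  rw [summable_prod_of_nonneg fun _ => by positivity]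
  refine ⟨fun n₁ => (h3 n₁).summable, ?_⟩
  simp_rw [fun n₁ => (h3 n₁).tsum_eq]
  exact (Complex.hasSum_re h2).summable

/-- Cauchy–Schwarz and the diagonal summability give absolute convergence over pairs, and the value
is then that of the iterated sum. -/
theorem hasSum_bandKraus (hs : |s| ≤ 1) (ht : |t| < 1)
    (h : ∀ p q, inner ℂ (R (expVec q)) (S (expVec p))
      = C * Complex.exp (A * (starRingEnd ℂ q * p) + L * p + M * starRingEnd ℂ q))
    (hl : ‖(x₁ : ℂ) ^ 2 * (A * s ^ 2 + x₂ ^ 2 * t ^ 2)‖ < 1) {w z : ℂ}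
    (hR : Summable fun n : ℕ × ℕ => ‖R (bandKraus g x₁ x₂ s t n.1 n.2 (expVec w))‖ ^ 2)
    (hS : Summable fun n : ℕ × ℕ => ‖S (bandKraus g x₁ x₂ s t n.1 n.2 (expVec z))‖ ^ 2) :
    HasSum (fun n : ℕ × ℕ => inner ℂ (R (bandKraus g x₁ x₂ s t n.1 n.2 (expVec w)))
      (S (bandKraus g x₁ x₂ s t n.1 n.2 (expVec z)))) (bandValue g x₁ x₂ s t C A L M w z) := by
  obtain ⟨f, h1, h2⟩ := hasSum_hasSum_bandKraus (g := g) hs ht h hl w z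
  have h3 := (Summable.of_norm_bounded (summable_norm_mul_norm hR hS)
    (f := fun n : ℕ × ℕ => inner ℂ (R (bandKraus g x₁ x₂ s t n.1 n.2 (expVec w)))
      (S (bandKraus g x₁ x₂ s t n.1 n.2 (expVec z))))
    fun n => norm_inner_le_norm _ _).hasSum
  rwa [(h3.prod_fiberwise h1).unique h2] at h3

theorem hasSum_bandKraus_displacement (hs : |s| ≤ 1) (ht : |t| < 1)
    (hl : x₁ ^ 2 * (s ^ 2 + x₂ ^ 2 * t ^ 2) < 1) (β w z : ℂ) :
    HasSum (fun n : ℕ × ℕ => inner ℂ (bandKraus g x₁ x₂ s t n.1 n.2 (expVec w))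
      (displacement β (bandKraus g x₁ x₂ s t n.1 n.2 (expVec z))))
      (bandValue g x₁ x₂ s t (Complex.exp (-(‖β‖ ^ 2 / 2 : ℝ))) 1 (-starRingEnd ℂ β) β w z) := by
  have hl' : ‖(x₁ : ℂ) ^ 2 * (1 * s ^ 2 + x₂ ^ 2 * t ^ 2)‖ < 1 := by
    have e : (x₁ : ℂ) ^ 2 * (1 * s ^ 2 + x₂ ^ 2 * t ^ 2)
        = ((x₁ ^ 2 * (s ^ 2 + x₂ ^ 2 * t ^ 2) : ℝ) : ℂ) := by
      push_cast
      ring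
    rwa [e, Complex.norm_real, Real.norm_eq_abs, abs_of_nonneg (by positivity)]
  have h0 : ∀ z, Summable fun n : ℕ × ℕ => ‖bandKraus g x₁ x₂ s t n.1 n.2 (expVec z)‖ ^ 2 := by
    simpa using summable_bandKraus (g := g) (R := ContinuousLinearMap.id ℂ Mode) (C := 1) (A := 1)
      (L := 0) (M := 0) hs ht (fun p q => by simp [inner_expVec]) hl'
  refine hasSum_bandKraus (R := ContinuousLinearMap.id ℂ Mode) hs ht (fun p q => ?_) hl' (h0 w) ?_
  · rw [ContinuousLinearMap.id_apply, inner_expVec_displacement_expVec, ← Complex.exp_add]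
    congr 1
    ring
  · simpa only [norm_displacement_apply] using h0 z

/-- Matrix elements are turned into inner products by the rank-one operators |0⟩⟨e_v| and |0⟩⟨e_u|.
Their kernel has no mixed term, so A = 0 and the convergence condition loses the s² contribution. -/
theorem hasSum_bandKraus_kernel (hs : |s| ≤ 1) (ht : |t| < 1)
    (hl : x₁ ^ 2 * (x₂ ^ 2 * t ^ 2) < 1) (u v w z : ℂ) :
    HasSum (fun n : ℕ × ℕ => starRingEnd ℂ (inner ℂ (expVec v)
        (bandKraus g x₁ x₂ s t n.1 n.2 (expVec w)))
      * inner ℂ (expVec u) (bandKraus g x₁ x₂ s t n.1 n.2 (expVec z)))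
      (bandValue g x₁ x₂ s t 1 0 (starRingEnd ℂ u) v w z) := by
  have hl' : ‖(x₁ : ℂ) ^ 2 * (0 * s ^ 2 + x₂ ^ 2 * t ^ 2)‖ < 1 := by
    have e : (x₁ : ℂ) ^ 2 * (0 * s ^ 2 + x₂ ^ 2 * t ^ 2)
        = ((x₁ ^ 2 * (x₂ ^ 2 * t ^ 2) : ℝ) : ℂ) := by
      push_cast
      ring
    rwa [e, Complex.norm_real, Real.norm_eq_abs, abs_of_nonneg (by positivity)]
  set R : ℂ → Mode →L[ℂ] Mode := fun v => InnerProductSpace.rankOne ℂ (ket 0) (expVec v)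
  have hi : ∀ (u v : ℂ) (x y : Mode), inner ℂ (R v x) (R u y)
      = starRingEnd ℂ (inner ℂ (expVec v) x) * inner ℂ (expVec u) y := fun u v x y => by
    simp only [R, InnerProductSpace.rankOne_apply, inner_smul_left, inner_smul_right]
    rw [inner_self_eq_norm_sq_to_K, norm_ket]
    simp [mul_comm]
  have h : ∀ u v p q, inner ℂ (R v (expVec q)) (R u (expVec p)) = 1 * Complex.exp
      (0 * (starRingEnd ℂ q * p) + starRingEnd ℂ u * p + v * starRingEnd ℂ q) := fun u v p q => by
    rw [hi, inner_conj_symm, inner_expVec, inner_expVec, ← Complex.exp_add, one_mul]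
    congr 1
    ring
  have h1 := hasSum_bandKraus (g := g) hs ht (h u v) hl' (w := w) (z := z)
    (summable_bandKraus hs ht (h v v) hl' w) (summable_bandKraus hs ht (h u u) hl' z)
  simpa only [hi] using h1

end BandKraus

/-! ### Exchanging the order of summation in arrays of inner products -/

section Transpose

variable {ι κ : Type} {x y : ι → lp (fun _ : κ => ℂ) 2} {x' y' : κ → lp (fun _ : ι => ℂ) 2}

theorem summable_prod_norm_sq (hx : Summable fun i => ‖x i‖ ^ 2) :
    Summable fun p : ι × κ => ‖x p.1 p.2‖ ^ 2 := by
  rw [summable_prod_of_nonneg fun _ => by positivity]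
  exact ⟨fun i => (hasSum_norm_sq (x i)).summable,
    hx.congr fun i => (hasSum_norm_sq (x i)).tsum_eq.symm⟩

theorem summable_norm_sq_transpose (h : ∀ k i, x i k = x' k i)
    (hx : Summable fun k => ‖x' k‖ ^ 2) : Summable fun i => ‖x i‖ ^ 2 := by
  have h1 : Summable fun p : ι × κ => ‖x p.1 p.2‖ ^ 2 := by
    simp only [h]
    exact (Equiv.prodComm ι κ).summable_iff.2 (summable_prod_norm_sq hx)
  rw [summable_prod_of_nonneg fun _ => by positivity] at h1
  exact h1.2.congr fun i => (hasSum_norm_sq (x i)).tsum_eq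

/-- Square summability makes the double array absolutely summable, so the inner products may be
summed along columns instead of rows. -/
theorem hasSum_inner_transpose (h : ∀ k i, x i k = x' k i) (h' : ∀ k i, y i k = y' k i)
    (hx : Summable fun i => ‖x i‖ ^ 2) (hy : Summable fun i => ‖y i‖ ^ 2) {S : ℂ}
    (hs : HasSum (fun k => inner ℂ (x' k) (y' k)) S) :
    HasSum (fun i => inner ℂ (x i) (y i)) S := by
  have h1 := (Summable.of_norm_bounded
    (summable_norm_mul_norm (summable_prod_norm_sq hx) (summable_prod_norm_sq hy))
    (f := fun p : ι × κ => inner ℂ (x p.1 p.2) (y p.1 p.2))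
    fun p => norm_inner_le_norm _ _).hasSum
  have h2 := h1.prod_fiberwise fun i => lp.hasSum_inner (𝕜 := ℂ) (x i) (y i)
  have h3 := ((Equiv.prodComm κ ι).hasSum_iff.2 h1).prod_fiberwise
    (g := fun k => inner ℂ (x' k) (y' k)) fun k => by
      refine (lp.hasSum_inner (𝕜 := ℂ) (x' k) (y' k)).congr_fun fun i => ?_
      simp only [Function.comp_apply, Equiv.prodComm_apply, Prod.swap_prod_mk, h, h']
  rwa [h3.unique hs] at h2

end Transpose

/-! ### Sums over the Kraus family of antidiagonal band operators -/

/-- The antidiagonal band operators with the coefficients `g x₁^n₁ x₂^n₂ h_c[s, c]`. -/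
def antiKraus (g x₁ x₂ s c : ℝ) (n₁ n₂ : ℕ) : Mode →L[ℂ] Mode :=
  antiBandOp n₁ n₂ fun m => g * x₁ ^ n₁ * x₂ ^ n₂ * hC n₁ n₂ m s c

section AntiKraus

variable {g x₁ x₂ s c : ℝ}

/-- As a function of (n₁, n₂), the matrix element is a component of a product exponential vector
with rotated amplitudes. This is `hasSum_hC` read as a statement about operators. -/
theorem inner_expVec_antiKraus (u z : ℂ) (n₁ n₂ : ℕ) :
    inner ℂ (expVec u) (antiKraus g x₁ x₂ s c n₁ n₂ (expVec z))
      = g * expVec₂ (x₁ * (c * starRingEnd ℂ u - s * z)) (x₂ * (s * starRingEnd ℂ u + c * z))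
        (n₁, n₂) := by
  have h1 := (hasSum_hC n₁ n₂ s c (starRingEnd ℂ u) z).unique
    (hasSum_sum_of_ne_finset_zero (s := Finset.range (n₁ + n₂ + 1)) fun m hm => by
      rw [hC_eq_zero (by simpa using hm)]
      simp)
  rw [expVec₂_apply, mul_pow, mul_pow, mul_div_assoc, mul_div_assoc, mul_mul_mul_comm, h1,
    Finset.mul_sum, Finset.mul_sum, antiKraus, antiBandOp, sum_apply, inner_sum]
  refine Finset.sum_congr rfl fun m _ => ?_
  rw [smul_apply, inner_smul_right, ketBra, InnerProductSpace.rankOne_apply, inner_smul_right,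
    inner_ket, ← inner_conj_symm, inner_ket, expVec_apply, expVec_apply, map_div₀, map_pow,
    Complex.conj_ofReal]
  push_cast
  ring

/-- The generating function of the Fock components of the vectors `D(β) K_n expVec z`. -/
def antiGen (g x₁ x₂ s c : ℝ) (β z u : ℂ) : TwoMode :=
  (Complex.exp (-(‖β‖ ^ 2 / 2 : ℝ) + u * β) * g) •
    expVec₂ (x₁ * (-(c * starRingEnd ℂ β) - s * z) + x₁ * c * u)
      (x₂ * (-(s * starRingEnd ℂ β) + c * z) + x₂ * s * u)

theorem hasSum_expVec_conj (u : ℂ) (ψ : Mode) :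
    HasSum (fun i : ℕ => u ^ i / (Real.sqrt (Nat.factorial i) : ℂ) * ψ i)
      (inner ℂ (expVec (starRingEnd ℂ u)) ψ) := by
  refine (lp.hasSum_inner (𝕜 := ℂ) (expVec (starRingEnd ℂ u)) ψ).congr_fun fun i => ?_
  rw [RCLike.inner_apply, expVec_apply, map_div₀, map_pow, Complex.conj_conj, Complex.conj_ofReal,
    mul_comm]

/-- The roles of the indices are exchanged compared with the band case: the Taylor index is the Fock
number i of the output, and the Kraus index n labels the components of the coefficient vector. The
transposed sums then give the sum over n. -/
theorem exists_antiCoeff (g x₁ x₂ s c : ℝ) (β z : ℂ) :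
    ∃ d : ℕ → TwoMode, (∀ u : ℂ, HasSum
      (fun i : ℕ => (u ^ i / (Real.sqrt (Nat.factorial i) : ℂ)) • d i)
        (antiGen g x₁ x₂ s c β z u)) ∧
      ∀ i n, d i n = displacement β (antiKraus g x₁ x₂ s c n.1 n.2 (expVec z)) i := by
  have hd : Differentiable ℂ (antiGen g x₁ x₂ s c β z) := by
    refine Differentiable.fun_smul ?_ (differentiable_expVec₂ _ _ _ _)
    fun_prop
  obtain ⟨d, hd⟩ := exists_hasSum_of_differentiable hd
  refine ⟨d, hd, fun i n => ?_⟩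
  refine congrFun (coeff_unique (x := fun i => d i n)
    (y := fun i => displacement β (antiKraus g x₁ x₂ s c n.1 n.2 (expVec z)) i)
    (f := fun u => antiGen g x₁ x₂ s c β z u n) (fun u => ?_) fun u => ?_) i
  · have h1 := (hd u).mapL (innerSL ℂ (ket₂ n.1 n.2))
    simp only [innerSL_apply_apply, inner_smul_right, inner_ket₂] at h1
    exact h1
  · have h1 := hasSum_expVec_conj u (displacement β (antiKraus g x₁ x₂ s c n.1 n.2 (expVec z)))
    rw [inner_expVec_displacement, inner_expVec_antiKraus, map_sub, Complex.conj_conj] at h1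
    have e : antiGen g x₁ x₂ s c β z u n = Complex.exp (-(‖β‖ ^ 2 / 2 : ℝ) + u * β) *
        (g * expVec₂ (x₁ * (c * (u - starRingEnd ℂ β) - s * z))
          (x₂ * (s * (u - starRingEnd ℂ β) + c * z)) (n.1, n.2)) := by
      rw [antiGen, lp.coeFn_smul, Pi.smul_apply, smul_eq_mul, mul_assoc,
        show (x₁ : ℂ) * (-(c * starRingEnd ℂ β) - s * z) + x₁ * c * u
          = x₁ * (c * (u - starRingEnd ℂ β) - s * z) by ring,
        show (x₂ : ℂ) * (-(s * starRingEnd ℂ β) + c * z) + x₂ * s * u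
          = x₂ * (s * (u - starRingEnd ℂ β) + c * z) by ring]
    rw [e]
    exact h1

/-- The value of `∑ ⟨K_n expVec w, D(β) K_n expVec z⟩` over a family of antidiagonal band
operators. -/
def antiValue (g x₁ x₂ s c : ℝ) (β w z : ℂ) : ℂ :=
  g ^ 2 * Complex.exp (-(‖β‖ ^ 2 / 2 : ℝ)
      + (x₁ ^ 2 * s ^ 2 + x₂ ^ 2 * c ^ 2) * starRingEnd ℂ w * z
      - c * s * (x₂ ^ 2 - x₁ ^ 2) * starRingEnd ℂ w * starRingEnd ℂ β) *
    (1 / (1 - (x₁ ^ 2 * c ^ 2 + x₂ ^ 2 * s ^ 2)) *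
      Complex.exp ((β + c * s * (x₂ ^ 2 - x₁ ^ 2) * starRingEnd ℂ w)
        * (-((x₁ ^ 2 * c ^ 2 + x₂ ^ 2 * s ^ 2) * starRingEnd ℂ β) + c * s * (x₂ ^ 2 - x₁ ^ 2) * z)
        / (1 - (x₁ ^ 2 * c ^ 2 + x₂ ^ 2 * s ^ 2))))

theorem hasSum_inner_antiCoeff (hl : x₁ ^ 2 * c ^ 2 + x₂ ^ 2 * s ^ 2 < 1) {β w z : ℂ}
    {d e : ℕ → TwoMode} (hd : ∀ u : ℂ, HasSum
      (fun i : ℕ => (u ^ i / (Real.sqrt (Nat.factorial i) : ℂ)) • d i)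
        (antiGen g x₁ x₂ s c 0 w u))
    (he : ∀ u : ℂ, HasSum
      (fun i : ℕ => (u ^ i / (Real.sqrt (Nat.factorial i) : ℂ)) • e i)
        (antiGen g x₁ x₂ s c β z u)) :
    HasSum (fun i => inner ℂ (d i) (e i)) (antiValue g x₁ x₂ s c β w z) := by
  refine hasSum_inner_coeff he hd (fun a b => ?_) ?_
  · simp only [antiGen, inner_smul_left, inner_smul_right, inner_expVec₂]
    simp only [norm_zero, map_mul, map_zero, mul_zero, neg_zero, zero_sub, zero_add, ne_eq,
      OfNat.ofNat_ne_zero, not_false_eq_true, zero_pow, zero_div, Complex.ofReal_zero,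
      Complex.exp_zero, one_mul, Complex.conj_ofReal, map_add, map_neg]
    have key : ∀ E X Y Z : ℂ, E + X = Y + Z → Complex.exp E * (g : ℂ) * ((g : ℂ) * Complex.exp X)
        = (g : ℂ) ^ 2 * Complex.exp Y * Complex.exp Z := by
      intro E X Y Z h
      rw [mul_assoc _ (Complex.exp Y), ← Complex.exp_add, ← h, Complex.exp_add]
      ring
    refine key _ _ _ _ ?_
    ring
  · have e : (x₁ : ℂ) ^ 2 * c ^ 2 + x₂ ^ 2 * s ^ 2
        = ((x₁ ^ 2 * c ^ 2 + x₂ ^ 2 * s ^ 2 : ℝ) : ℂ) := by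
      push_cast
      ring
    rwa [e, Complex.norm_real, Real.norm_eq_abs, abs_of_nonneg (by positivity)]

theorem summable_antiKraus (hl : x₁ ^ 2 * c ^ 2 + x₂ ^ 2 * s ^ 2 < 1) (z : ℂ) :
    Summable fun n : ℕ × ℕ => ‖antiKraus g x₁ x₂ s c n.1 n.2 (expVec z)‖ ^ 2 := by
  obtain ⟨d, hd, hd'⟩ := exists_antiCoeff g x₁ x₂ s c 0 z
  have h1 := hasSum_inner_antiCoeff hl hd hd
  simp only [displacement_zero, ContinuousLinearMap.id_apply] at hd'
  refine summable_norm_sq_transpose (fun i n => (hd' i n).symm) ?_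
  refine (Complex.hasSum_re h1).summable.congr fun i => ?_
  rw [inner_self_eq_norm_sq_to_K]
  norm_cast

theorem hasSum_antiKraus_displacement (hl : x₁ ^ 2 * c ^ 2 + x₂ ^ 2 * s ^ 2 < 1) (β w z : ℂ) :
    HasSum (fun n : ℕ × ℕ => inner ℂ (antiKraus g x₁ x₂ s c n.1 n.2 (expVec w))
      (displacement β (antiKraus g x₁ x₂ s c n.1 n.2 (expVec z))))
      (antiValue g x₁ x₂ s c β w z) := by
  obtain ⟨d, hd, hd'⟩ := exists_antiCoeff g x₁ x₂ s c 0 w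
  obtain ⟨e, he, he'⟩ := exists_antiCoeff g x₁ x₂ s c β z
  have h1 := hasSum_inner_antiCoeff hl hd he
  simp only [displacement_zero, ContinuousLinearMap.id_apply] at hd'
  refine hasSum_inner_transpose (fun i n => (hd' i n).symm) (fun i n => (he' i n).symm)
    (summable_antiKraus hl w) ?_ h1
  simp only [norm_displacement_apply]
  exact summable_antiKraus hl z

/-- By `inner_expVec_antiKraus` the sum over n is the inner product of two product exponential
vectors, so no convergence condition appears. -/
theorem hasSum_antiKraus_kernel (u v w z : ℂ) :
    HasSum (fun n : ℕ × ℕ => starRingEnd ℂ (inner ℂ (expVec v)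
        (antiKraus g x₁ x₂ s c n.1 n.2 (expVec w)))
      * inner ℂ (expVec u) (antiKraus g x₁ x₂ s c n.1 n.2 (expVec z)))
      (g ^ 2 * Complex.exp (x₁ ^ 2 * (c * v - s * starRingEnd ℂ w) * (c * starRingEnd ℂ u - s * z)
        + x₂ ^ 2 * (s * v + c * starRingEnd ℂ w) * (s * starRingEnd ℂ u + c * z))) := by
  have h1 := (lp.hasSum_inner (𝕜 := ℂ)
    (expVec₂ (x₁ * (c * starRingEnd ℂ v - s * w)) (x₂ * (s * starRingEnd ℂ v + c * w)))
    (expVec₂ (x₁ * (c * starRingEnd ℂ u - s * z)) (x₂ * (s * starRingEnd ℂ u + c * z)))).mul_left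
    ((g : ℂ) ^ 2)
  rw [inner_expVec₂] at h1
  have e : starRingEnd ℂ (x₁ * (c * starRingEnd ℂ v - s * w)) *
      (x₁ * (c * starRingEnd ℂ u - s * z)) + starRingEnd ℂ (x₂ * (s * starRingEnd ℂ v + c * w)) *
      (x₂ * (s * starRingEnd ℂ u + c * z))
      = x₁ ^ 2 * (c * v - s * starRingEnd ℂ w) * (c * starRingEnd ℂ u - s * z)
        + x₂ ^ 2 * (s * v + c * starRingEnd ℂ w) * (s * starRingEnd ℂ u + c * z) := by
    simp only [map_add, map_mul, map_sub, Complex.conj_conj, Complex.conj_ofReal]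
    ring
  rw [e] at h1
  refine h1.congr_fun fun n => ?_
  rw [inner_expVec_antiKraus, inner_expVec_antiKraus, map_mul, Complex.conj_ofReal,
    RCLike.inner_apply]
  ring

end AntiKraus

/-! ### Unitaries from families of flipped operators -/

/-- Flipping a ket to a bra is antilinear in the second mode, hence the conjugate of w. -/
theorem inner_expVec₂_of_isFlip {η : TwoMode} {A : Mode →L[ℂ] Mode} (h : IsFlip η A) (v w : ℂ) :
    inner ℂ (expVec₂ v w) η = inner ℂ (expVec v) (A (expVec (starRingEnd ℂ w))) := by
  refine (inner_prodVec_left (expVec v) (expVec w) η).unique ?_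
  refine (lp.hasSum_inner (𝕜 := ℂ) (expVec v) (A (expVec (starRingEnd ℂ w)))).congr_fun fun i => ?_
  congr 1
  refine (lp.hasSum_inner (𝕜 := ℂ) (expVec w) (row η i)).unique ?_
  rw [← inner_ket i, ← adjoint_inner_left]
  refine (hasSum_inner_ket (adjoint A (ket i)) (expVec (starRingEnd ℂ w))).congr_fun fun j => ?_
  rw [adjoint_inner_left, h, inner_ket, RCLike.inner_apply, expVec_apply, expVec_apply, map_div₀,
    map_pow, Complex.conj_ofReal]
  rfl

/-- The hypothesis says that the Choi kernel is the reproducing kernel of the two-mode exponential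
vectors, i.e. ∑ |η_n⟩⟨η_n| = 1 weakly. The functionals ⟨η_n, ·⟩ are therefore the components of an
isometry, whose adjoint sends |n₁, n₂⟩ to η. -/
theorem exists_isometry_of_isFlip {K : ℕ → ℕ → Mode →L[ℂ] Mode} {η : ℕ → ℕ → TwoMode}
    (hη : ∀ n₁ n₂, IsFlip (η n₁ n₂) (K n₁ n₂))
    (h : ∀ u v w z, HasSum (fun n : ℕ × ℕ =>
      starRingEnd ℂ (inner ℂ (expVec v) (K n.1 n.2 (expVec w)))
        * inner ℂ (expVec u) (K n.1 n.2 (expVec z)))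
      (Complex.exp (starRingEnd ℂ u * v + starRingEnd ℂ w * z))) :
    ∃ U : TwoMode →L[ℂ] TwoMode, adjoint U ∘L U = 1 ∧
      (∀ n₁ n₂, adjoint U (ket₂ n₁ n₂) = η n₁ n₂) ∧
      ∀ v w n, U (expVec₂ v w) n
        = starRingEnd ℂ (inner ℂ (expVec v) (K n.1 n.2 (expVec (starRingEnd ℂ w)))) := by
  have hE : ∀ (v w : ℂ) (n : ℕ × ℕ), inner ℂ (η n.1 n.2) (expVec₂ v w)
      = starRingEnd ℂ (inner ℂ (expVec v) (K n.1 n.2 (expVec (starRingEnd ℂ w)))) := fun v w n => by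
    rw [← inner_conj_symm, inner_expVec₂_of_isFlip (hη _ _)]
  obtain ⟨U, hU, hi⟩ := exists_isometry_lp (fun n : ℕ × ℕ => innerSL ℂ (η n.1 n.2))
    dense_span_expVec₂ fun p q => by
      simp only [innerSL_apply_apply, RCLike.inner_apply, hE, inner_expVec₂, Complex.conj_conj]
      have h1 := h p.1 q.1 (starRingEnd ℂ q.2) (starRingEnd ℂ p.2)
      rwa [Complex.conj_conj, mul_comm q.2] at h1
  refine ⟨U, ?_, fun n₁ n₂ => ext_inner_right ℂ fun ψ => ?_, fun v w n => ?_⟩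
  · refine ContinuousLinearMap.ext fun ψ => ext_inner_left ℂ fun φ => ?_
    rw [comp_apply, adjoint_inner_right, hi]
    rfl
  · rw [adjoint_inner_left, inner_ket₂, hU]
    rfl
  · rw [hU]
    exact hE v w n

theorem tensorOp_displacement_expVec₂ (β β' p q : ℂ) :
    tensorOp (displacement β) (displacement β') (expVec₂ p q)
      = Complex.exp (-(‖β‖ ^ 2 / 2 : ℝ) - starRingEnd ℂ β * p
        + (-(‖β'‖ ^ 2 / 2 : ℝ) - starRingEnd ℂ β' * q)) • expVec₂ (p + β) (q + β') := by
  rw [expVec₂, tensorOp_prodVec, displacement_expVec, displacement_expVec, displacedExpVec,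
    displacedExpVec, prodVec_smul_left, prodVec_smul_right, smul_smul, ← Complex.exp_add, expVec₂]

theorem inner_expVec₂_tensorOp_displacement (β β' p q : ℂ) (ψ : TwoMode) :
    inner ℂ (expVec₂ p q) (tensorOp (displacement β) (displacement β') ψ)
      = Complex.exp (-(‖β‖ ^ 2 / 2 : ℝ) + starRingEnd ℂ p * β
        + (-(‖β'‖ ^ 2 / 2 : ℝ) + starRingEnd ℂ q * β')) *
        inner ℂ (expVec₂ (p - β) (q - β')) ψ := by
  have h : innerSL ℂ (expVec₂ p q) ∘L tensorOp (displacement β) (displacement β')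
      = Complex.exp (-(‖β‖ ^ 2 / 2 : ℝ) + starRingEnd ℂ p * β
        + (-(‖β'‖ ^ 2 / 2 : ℝ) + starRingEnd ℂ q * β')) •
        innerSL ℂ (expVec₂ (p - β) (q - β')) := by
    refine ContinuousLinearMap.ext_on dense_span_expVec₂ ?_
    rintro _ ⟨⟨z, z'⟩, rfl⟩
    simp only [comp_apply, innerSL_apply_apply, smul_apply, smul_eq_mul]
    rw [tensorOp_displacement_expVec₂, inner_smul_right, inner_expVec₂, inner_expVec₂,
      ← Complex.exp_add, ← Complex.exp_add]
    congr 1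
    simp only [map_sub]
    ring
  exact DFunLike.congr_fun h ψ

theorem ofReal_norm_sq_div_two (β : ℂ) : ((‖β‖ ^ 2 / 2 : ℝ) : ℂ) = starRingEnd ℂ β * β / 2 := by
  rw [← Complex.normSq_eq_norm_sq, Complex.ofReal_div, Complex.normSq_eq_conj_mul_self]
  simp

theorem twoModeWeyl_eq (ξ : Fin 2 ⊕ Fin 2 → ℝ) : twoModeWeyl ξ = tensorOp
    (displacement (Complex.I * (ξ (Sum.inl 0) + Complex.I * ξ (Sum.inl 1))))
    (displacement (Complex.I * (ξ (Sum.inr 0) + Complex.I * ξ (Sum.inr 1)))) := rfl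

/-- On the left the displacement is moved onto the bra, on the right onto the ket; for a Gaussian
kernel the intertwining relation is then an identity of exponents. -/
theorem comp_eq_comp_of_kernel {U : TwoMode →L[ℂ] TwoMode} {k : ℂ → ℂ → ℂ → ℂ → ℂ}
    (hk : ∀ u u' a a', inner ℂ (expVec₂ u u') (U (expVec₂ a a')) = Complex.exp (k u u' a a'))
    {β β' γ γ' : ℂ}
    (h : ∀ u u' a a', -(starRingEnd ℂ β * β / 2) + starRingEnd ℂ u * β
        + (-(starRingEnd ℂ β' * β' / 2) + starRingEnd ℂ u' * β') + k (u - β) (u' - β') a a'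
      = -(starRingEnd ℂ γ * γ / 2) - starRingEnd ℂ γ * a
        + (-(starRingEnd ℂ γ' * γ' / 2) - starRingEnd ℂ γ' * a') + k u u' (a + γ) (a' + γ')) :
    tensorOp (displacement β) (displacement β') ∘L U
      = U ∘L tensorOp (displacement γ) (displacement γ') := by
  refine eq_of_inner_expVec₂ fun u u' a a' => ?_
  rw [comp_apply, comp_apply, inner_expVec₂_tensorOp_displacement, tensorOp_displacement_expVec₂,
    map_smul, inner_smul_right, hk, hk, ← Complex.exp_add, ← Complex.exp_add]
  simp only [ofReal_norm_sq_div_two]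
  exact congrArg Complex.exp (h u u' a a')

/-- An isometry whose adjoint is an isometry, and whose kernel in the exponential vectors has the
right covariance, is a Gaussian unitary. -/
theorem isGaussianUnitary_of_kernel {S : Matrix (Fin 2 ⊕ Fin 2) (Fin 2 ⊕ Fin 2) ℝ}
    {U U' : TwoMode →L[ℂ] TwoMode} (h : adjoint U ∘L U = 1) (h' : adjoint U' ∘L U' = 1)
    {k k' : ℂ → ℂ → ℂ → ℂ → ℂ}
    (hk : ∀ u u' a a', inner ℂ (expVec₂ u u') (U (expVec₂ a a')) = Complex.exp (k u u' a a'))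
    (hk' : ∀ u u' a a', inner ℂ (expVec₂ u u') (U' (expVec₂ a a')) = Complex.exp (k' u u' a a'))
    (hc : ∀ u u' a a', starRingEnd ℂ (k' a a' u u') = k u u' a a')
    (hS : ∀ (ξ : Fin 2 ⊕ Fin 2 → ℝ) (β β' γ γ' u u' a a' : ℂ),
      β = Complex.I * (ξ (Sum.inl 0) + Complex.I * ξ (Sum.inl 1)) →
      β' = Complex.I * (ξ (Sum.inr 0) + Complex.I * ξ (Sum.inr 1)) →
      γ = Complex.I * (S.transpose.mulVec ξ (Sum.inl 0)
        + Complex.I * S.transpose.mulVec ξ (Sum.inl 1)) →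
      γ' = Complex.I * (S.transpose.mulVec ξ (Sum.inr 0)
        + Complex.I * S.transpose.mulVec ξ (Sum.inr 1)) →
      -(starRingEnd ℂ β * β / 2) + starRingEnd ℂ u * β
        + (-(starRingEnd ℂ β' * β' / 2) + starRingEnd ℂ u' * β') + k (u - β) (u' - β') a a'
      = -(starRingEnd ℂ γ * γ / 2) - starRingEnd ℂ γ * a
        + (-(starRingEnd ℂ γ' * γ' / 2) - starRingEnd ℂ γ' * a') + k u u' (a + γ) (a' + γ')) :
    IsGaussianUnitary S U := by
  -- Conjugate kernels identify the second isometry as the adjoint; its isometry relation is U U† =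
  -- 1.
  have h1 : adjoint U = U' := by
    refine eq_of_inner_expVec₂ fun w w' z z' => ?_
    rw [adjoint_inner_right, ← inner_conj_symm, hk, hk', ← hc, Complex.exp_conj, Complex.conj_conj]
  have h2 : U ∘L adjoint U = 1 := by
    rw [h1, ← h', ← h1, adjoint_adjoint]
  refine ⟨Unitary.mem_iff.2 ⟨h, h2⟩, fun ξ => ?_⟩
  have h3 : twoModeWeyl ξ ∘L U = U ∘L twoModeWeyl (S.transpose.mulVec ξ) := by
    rw [twoModeWeyl_eq, twoModeWeyl_eq]
    refine comp_eq_comp_of_kernel hk fun u u' a a' => ?_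
    exact hS ξ _ _ _ _ u u' a a' rfl rfl rfl rfl
  rw [h3, ← comp_assoc, h, one_def, id_comp]

/-! ### Beam splitters -/

theorem isFlip_antiBandOp_aux (n₁ n₂ : ℕ) (f : ℕ → ℝ) : ∃ η : TwoMode,
    IsFlip η (antiBandOp n₁ n₂ f) := by
  refine ⟨∑ m ∈ Finset.range (n₁ + n₂ + 1), (f m : ℂ) • ket₂ (n₁ + n₂ - m) m, fun i j => ?_⟩
  rw [← inner_ket₂, inner_sum, antiBandOp, sum_apply, inner_sum]
  refine Finset.sum_congr rfl fun m _ => ?_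
  rw [smul_apply, inner_smul_right, inner_smul_right, ketBra, InnerProductSpace.rankOne_apply,
    inner_smul_right, inner_ket, inner_ket, inner_ket₂]
  simp only [ket, ket₂, lp.single_apply, Pi.single_apply, Prod.mk.injEq]
  rcases eq_or_ne j m with h2 | h2 <;> by_cases h1 : i = n₁ + n₂ - m <;>
    simp [h1, h2]
  exact fun h => absurd h.symm h2

/-- The operator sends e_a ⊗ e_a' to the product exponential vector of the rotated amplitudes, and
the rotation by the opposite angle gives its adjoint. -/
theorem exists_beamSplitter (θ : ℝ) : ∃ U : TwoMode →L[ℂ] TwoMode,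
    IsGaussianUnitary (beamSplitterMatrix θ) U ∧ ∀ n₁ n₂, IsFlip (adjoint U (ket₂ n₁ n₂))
      (antiKraus 1 1 1 (Real.sin θ) (Real.cos θ) n₁ n₂) := by
  have key : ∀ s c : ℝ, s ^ 2 + c ^ 2 = 1 → ∃ U : TwoMode →L[ℂ] TwoMode, adjoint U ∘L U = 1 ∧
      (∀ n₁ n₂, IsFlip (adjoint U (ket₂ n₁ n₂)) (antiKraus 1 1 1 s c n₁ n₂)) ∧
      ∀ u u' a a', inner ℂ (expVec₂ u u') (U (expVec₂ a a'))
        = Complex.exp (starRingEnd ℂ u * (c * a - s * a') + starRingEnd ℂ u' * (s * a + c * a')) := by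
    intro s c hsc
    have hsc' : (s : ℂ) ^ 2 + (c : ℂ) ^ 2 = 1 := by exact_mod_cast hsc
    choose η hη using fun n₁ n₂ => isFlip_antiBandOp_aux n₁ n₂
      fun m => 1 * 1 ^ n₁ * 1 ^ n₂ * hC n₁ n₂ m s c
    obtain ⟨U, h1, h2, h3⟩ := exists_isometry_of_isFlip (K := antiKraus 1 1 1 s c) hη
      fun u v w z => by
        have h1 := hasSum_antiKraus_kernel (g := 1) (x₁ := 1) (x₂ := 1) (s := s) (c := c) u v w z
        convert h1 using 1
        simp only [Complex.ofReal_one, one_pow, one_mul]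
        congr 1
        linear_combination - (starRingEnd ℂ u * v + starRingEnd ℂ w * z) * hsc'
    refine ⟨U, h1, fun n₁ n₂ => by rw [h2]; exact hη n₁ n₂, fun u u' a a' => ?_⟩
    have h4 : U (expVec₂ a a') = expVec₂ (c * a - s * a') (s * a + c * a') := by
      ext n
      rw [h3, inner_expVec_antiKraus, expVec₂_apply, expVec₂_apply]
      simp
    rw [h4, inner_expVec₂]
  obtain ⟨U, h1, h2, h3⟩ := key (Real.sin θ) (Real.cos θ) (Real.sin_sq_add_cos_sq θ)
  obtain ⟨U', h1', -, h3'⟩ := key (-Real.sin θ) (Real.cos θ) (by simp)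
  refine ⟨U, isGaussianUnitary_of_kernel h1 h1' h3 h3' (fun u u' a a' => ?_) ?_, h2⟩
  · simp only [map_add, map_sub, map_mul, Complex.conj_conj, Complex.conj_ofReal, Complex.ofReal_neg,
      map_neg]
    ring
  · intro ξ β β' γ γ' u u' a a' hβ hβ' hγ hγ'
    have hsc : (Real.sin θ : ℂ) ^ 2 + (Real.cos θ : ℂ) ^ 2 = 1 := by
      exact_mod_cast Real.sin_sq_add_cos_sq θ
    -- In complex amplitudes the transposed rotation acts complex linearly; together with `e2` this
    -- is what the exponents must match.
    have e1 : γ = Real.cos θ * β + Real.sin θ * β' := by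
      rw [hγ, hβ, hβ']
      simp [beamSplitterMatrix, Matrix.mulVec, dotProduct, Matrix.transpose_apply]
      ring
    have e2 : γ' = -Real.sin θ * β + Real.cos θ * β' := by
      rw [hγ', hβ, hβ']
      simp [beamSplitterMatrix, Matrix.mulVec, dotProduct, Matrix.transpose_apply]
      ring
    rw [e1, e2]
    generalize Real.sin θ = s at *
    generalize Real.cos θ = c at *
    simp only [map_add, map_sub, map_mul, map_neg, Complex.conj_ofReal]
    generalize starRingEnd ℂ β = b at *
    generalize starRingEnd ℂ β' = b' at *
    linear_combination (b * β / 2 + b' * β' / 2 - starRingEnd ℂ u * β - starRingEnd ℂ u' * β') * hsc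

/-! ### Two-mode squeezing -/

/-- A flipped vector exists when the operator is Hilbert–Schmidt: each row of a band operator has at
most one nonzero entry, and the entries are absolutely, hence square, summable. -/
theorem isFlip_bandKraus_aux {g x₁ x₂ s t : ℝ} (hs : |s| ≤ 1) (ht : |t| < 1) (n₁ n₂ : ℕ) :
    ∃ η : TwoMode, IsFlip η (bandKraus g x₁ x₂ s t n₁ n₂) := by
  set f : ℕ → ℝ := fun i => g * x₁ ^ n₁ * x₂ ^ n₂ * hAB n₁ n₂ i s t
  have hf : Summable fun i => |f i| := by
    simp_rw [f, abs_mul (g * x₁ ^ n₁ * x₂ ^ n₂)]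
    exact (summable_abs_hAB hs ht n₁ n₂).mul_left _
  have hA : ∀ i j, inner ℂ (ket i) (bandKraus g x₁ x₂ s t n₁ n₂ (ket j))
      = if j = n₂ + i - n₁ then (f i : ℂ) else 0 := fun i j => by
    rw [inner_ket, bandKraus_apply hs ht, ket_apply]
    simp only [f]
    split_ifs <;> simp_all
  have h1 : ∀ i, HasSum (fun j => ‖inner ℂ (ket i) (bandKraus g x₁ x₂ s t n₁ n₂ (ket j))‖ ^ 2)
      (|f i| ^ 2) := fun i => by
    have h2 := hasSum_ite_eq (n₂ + i - n₁) (|f i| ^ 2)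
    refine h2.congr_fun fun j => ?_
    rw [hA]
    split_ifs <;> simp
  have h2 : Summable fun p : ℕ × ℕ =>
      ‖inner ℂ (ket p.1) (bandKraus g x₁ x₂ s t n₁ n₂ (ket p.2))‖ ^ 2 := by
    rw [summable_prod_of_nonneg fun _ => by positivity]
    refine ⟨fun i => (h1 i).summable, ?_⟩
    refine Summable.congr ?_ fun i => (h1 i).tsum_eq.symm
    refine ((hf.mul_of_nonneg hf (fun _ => abs_nonneg _) fun _ => abs_nonneg _).comp_injective
      (i := fun i => (i, i)) fun i j h => congrArg Prod.fst h).congr fun i => ?_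
    exact (sq _).symm
  exact ⟨⟨_, memℓp_of_summable_sq h2⟩, fun i j => rfl⟩

theorem inner_swapModes (x y : TwoMode) : inner ℂ (swapModes x) (swapModes y) = inner ℂ x y :=
  (lp.hasSum_inner (𝕜 := ℂ) (swapModes x) (swapModes y)).unique
    ((Equiv.prodComm ℕ ℕ).hasSum_iff.2 (lp.hasSum_inner (𝕜 := ℂ) x y))

theorem hasSum_inner_row_swapModes (p q : ℂ) (χ : TwoMode) :
    HasSum (fun j => inner ℂ (expVec q j) (inner ℂ (expVec p) (row (swapModes χ) j)))
      (inner ℂ (expVec₂ p q) χ) := by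
  rw [← inner_swapModes, expVec₂, swapModes_prodVec]
  exact inner_prodVec_left (expVec q) (expVec p) (swapModes χ)

/-- The flipped operators with unit weights have the identity as Choi kernel because s² + t² = 1,
giving an isometry. Its kernel is s · exp(t a a' + s a ū + s a' ū' - t ū ū'), and t ↦ -t gives the
kernel of the adjoint. -/
theorem exists_twoModeSqueezer (μ : ℝ) : ∃ U : TwoMode →L[ℂ] TwoMode,
    IsGaussianUnitary (squeezeMatrix μ) U ∧ ∀ n₁ n₂, IsFlip (adjoint U (ket₂ n₁ n₂))
      (bandKraus 1 1 1 (Real.cosh μ)⁻¹ (Real.tanh μ) n₁ n₂) := by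
  have key : ∀ s t : ℝ, 0 < s → s ^ 2 + t ^ 2 = 1 → ∃ U : TwoMode →L[ℂ] TwoMode,
      adjoint U ∘L U = 1 ∧ (∀ n₁ n₂, IsFlip (adjoint U (ket₂ n₁ n₂)) (bandKraus 1 1 1 s t n₁ n₂)) ∧
      ∀ u u' a a', inner ℂ (expVec₂ u u') (U (expVec₂ a a'))
        -- The prefactor s is absorbed as log s, since `isGaussianUnitary_of_kernel` takes pure
        -- exponentials.
        = Complex.exp (Real.log s + (t * a * a' + s * a * starRingEnd ℂ u
          + s * a' * starRingEnd ℂ u' - t * starRingEnd ℂ u * starRingEnd ℂ u')) := by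
    intro s t hs0 hst
    have hs : |s| ≤ 1 := abs_le_of_sq_le_sq (by nlinarith [sq_nonneg t]) one_pos.le
    have ht : |t| < 1 := abs_lt_of_sq_lt_sq (by nlinarith [sq_pos_of_pos hs0]) one_pos.le
    have hst' : (s : ℂ) ^ 2 + (t : ℂ) ^ 2 = 1 := by exact_mod_cast hst
    have hs' : (s : ℂ) ≠ 0 := by exact_mod_cast hs0.ne'
    choose η hη using fun n₁ n₂ => isFlip_bandKraus_aux (g := 1) (x₁ := 1) (x₂ := 1) hs ht n₁ n₂
    obtain ⟨U, h1, h2, h3⟩ := exists_isometry_of_isFlip hη fun u v w z => by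
      have h1 := hasSum_bandKraus_kernel (g := 1) (x₁ := 1) (x₂ := 1) hs ht
        (by nlinarith [sq_pos_of_pos hs0]) u v w z
      convert h1 using 1
      have e1 : (1 : ℂ) - 1 ^ 2 * (0 * s ^ 2 + 1 ^ 2 * t ^ 2) = s ^ 2 := by
        linear_combination -hst'
      simp only [bandValue, Complex.ofReal_one]
      rw [e1]
      have e2 : ∀ x y w : ℂ, w = x + y → Complex.exp w = 1 ^ 2 * (s : ℂ) ^ 2 * 1 * Complex.exp x *
          (1 / (s : ℂ) ^ 2 * Complex.exp y) := by
        rintro x y _ rfl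
        rw [Complex.exp_add]
        field_simp
      refine e2 _ _ _ ?_
      field_simp
      linear_combination -(starRingEnd ℂ w * z) * hst'
    refine ⟨U, h1, fun n₁ n₂ => by rw [h2]; exact hη n₁ n₂, fun u u' a a' => ?_⟩
    obtain ⟨c, hc, hc'⟩ := exists_bandCoeff hs ht 1 1 1 (starRingEnd ℂ a')
    -- The components of U(e_a ⊗ e_a') are summed against e_u ⊗ e_u' first over n₂, giving an inner
    -- product with the coefficient vector c n; the remaining sum over n₁ is the generating function
    -- at u.
    have h4 := (lp.hasSum_inner (𝕜 := ℂ) (U (expVec₂ a a')) (expVec₂ u u')).prod_fiberwise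
        (g := fun n => u ^ n / (Real.sqrt (Nat.factorial n) : ℂ) *
          inner ℂ (expVec₂ a (starRingEnd ℂ u')) (c n)) fun n => by
      refine ((hasSum_inner_row_swapModes a (starRingEnd ℂ u') (c n)).mul_left _).congr_fun
        fun m => ?_
      rw [hc', RCLike.inner_apply, RCLike.inner_apply, h3, expVec₂_apply, Complex.conj_conj,
        expVec_apply, map_div₀, map_pow, Complex.conj_conj, Complex.conj_ofReal]
      ring
    have h5 := (hc u).mapL (innerSL ℂ (expVec₂ a (starRingEnd ℂ u')))
    simp only [map_smul, innerSL_apply_apply, smul_eq_mul] at h5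
    rw [← inner_conj_symm, h4.unique h5, bandGen, inner_smul_right, inner_expVec₂, map_mul,
      ← Complex.exp_conj, Complex.exp_add, ← Complex.ofReal_exp, Real.exp_log hs0]
    simp only [map_add, map_mul, map_neg, Complex.conj_conj, Complex.conj_ofReal,
      Complex.ofReal_one, one_mul, mul_one]
    congr 2
    ring
  have hc := Real.cosh_pos μ
  have hst : ((Real.cosh μ)⁻¹) ^ 2 + (Real.tanh μ) ^ 2 = 1 := by
    rw [Real.tanh_eq_sinh_div_cosh]
    field_simp
    linarith [Real.cosh_sq μ]
  obtain ⟨U, h1, h2, h3⟩ := key _ _ (inv_pos.2 hc) hst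
  obtain ⟨U', h1', -, h3'⟩ := key (Real.cosh μ)⁻¹ (-Real.tanh μ) (inv_pos.2 hc) (by simpa using hst)
  refine ⟨U, isGaussianUnitary_of_kernel h1 h1' h3 h3' (fun u u' a a' => ?_) ?_, h2⟩
  · simp only [map_add, map_sub, map_mul, Complex.conj_conj, Complex.conj_ofReal, Complex.ofReal_neg,
      map_neg]
    ring
  · intro ξ β β' γ γ' u u' a a' hβ hβ' hγ hγ'
    -- The matrix σ₃ in the off-diagonal blocks becomes complex conjugation of the amplitude of the
    -- other mode.
    have e1 : γ = Real.cosh μ * β + Real.sinh μ * starRingEnd ℂ β' := by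
      rw [hγ, hβ, hβ']
      simp [squeezeMatrix, pauli₃, Matrix.mulVec, dotProduct, Matrix.transpose_apply]
      ring_nf
    have e2 : γ' = Real.sinh μ * starRingEnd ℂ β + Real.cosh μ * β' := by
      rw [hγ', hβ, hβ']
      simp [squeezeMatrix, pauli₃, Matrix.mulVec, dotProduct, Matrix.transpose_apply]
      ring_nf
    have hc1 : (Real.cosh μ : ℂ) ≠ 0 := by exact_mod_cast hc.ne'
    have hc2 : (Real.cosh μ : ℂ) ^ 2 = (Real.sinh μ : ℂ) ^ 2 + 1 := by
      exact_mod_cast Real.cosh_sq μ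
    rw [e1, e2, Real.tanh_eq_sinh_div_cosh]
    generalize (Real.log (Real.cosh μ)⁻¹) = l
    push_cast
    simp only [← Complex.ofReal_cosh, ← Complex.ofReal_sinh]
    generalize Real.sinh μ = s at *
    generalize Real.cosh μ = c at *
    simp only [map_add, map_sub, map_mul, Complex.conj_ofReal, Complex.conj_conj]
    generalize starRingEnd ℂ β = b at *
    generalize starRingEnd ℂ β' = b' at *
    generalize starRingEnd ℂ u = v at *
    generalize starRingEnd ℂ u' = v' at *
    field_simp
    linear_combination (c * β * b + c * β' * b' + 2 * s * b * b' + 2 * a * b + 2 * a' * b') * hc2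

/-! ### Thermal states -/

theorem xParam_nonneg (ν : ℝ) : 0 ≤ xParam ν := Real.sqrt_nonneg _

theorem xParam_sq {ν : ℝ} (h : 1 ≤ ν) : xParam ν ^ 2 = (ν - 1) / (ν + 1) :=
  Real.sq_sqrt (div_nonneg (by linarith) (by linarith))

theorem one_sub_xParam_sq {ν : ℝ} (h : 1 ≤ ν) : 1 - xParam ν ^ 2 = 2 / (ν + 1) := by
  have : ν + 1 ≠ 0 := by linarith
  rw [xParam_sq h]
  field_simp
  ring

theorem xParam_sq_lt_one {ν : ℝ} (h : 1 ≤ ν) : xParam ν ^ 2 < 1 := by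
  have := one_sub_xParam_sq h
  have h2 : 0 < 2 / (ν + 1) := div_pos two_pos (by linarith)
  linarith

/-- The eigenvalues of the thermal state. -/
def thermalWeight (ν : ℝ) (n : ℕ) : ℝ := (1 - xParam ν ^ 2) * xParam ν ^ (2 * n)

theorem thermalWeight_nonneg {ν : ℝ} (h : 1 ≤ ν) (n : ℕ) : 0 ≤ thermalWeight ν n :=
  mul_nonneg (by linarith [xParam_sq_lt_one h]) (pow_nonneg (xParam_nonneg ν) _)

theorem summable_thermalWeight {ν : ℝ} (h : 1 ≤ ν) : Summable (thermalWeight ν) := by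
  refine ((summable_geometric_of_lt_one (sq_nonneg _) (xParam_sq_lt_one h)).mul_left
    (1 - xParam ν ^ 2)).congr fun n => ?_
  rw [thermalWeight, pow_mul]

theorem thermal_apply {ν : ℝ} (h : 1 ≤ ν) (ψ : Mode) (i : ℕ) :
    thermal ν ψ i = (thermalWeight ν i : ℂ) * ψ i := by
  have hs : Summable fun n => (thermalWeight ν n : ℂ) • ketBra n n := by
    refine Summable.of_norm ((summable_thermalWeight h).congr fun n => ?_)
    rw [norm_smul, norm_ketBra, Complex.norm_real, Real.norm_eq_abs,
      abs_of_nonneg (thermalWeight_nonneg h n), mul_one]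
  have h1 := (hs.hasSum.mapL (ContinuousLinearMap.apply ℂ Mode ψ)).mapL (innerSL ℂ (ket i))
  rw [← inner_ket]
  refine h1.unique ?_
  refine (hasSum_ite_eq i ((thermalWeight ν i : ℂ) * ψ i)).congr_fun fun n => ?_
  rw [innerSL_apply_apply, apply_apply, smul_apply, inner_smul_right, ketBra,
    InnerProductSpace.rankOne_apply, inner_smul_right, inner_ket, inner_ket, ket_apply]
  rcases eq_or_ne n i with rfl | hn
  · simp
  · simp [hn, hn.symm]

theorem hasSum_rankOne_tensorOp_thermal {νp νm : ℝ} (hp : 1 ≤ νp) (hm : 1 ≤ νm)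
    {φ : ℕ × ℕ → TwoMode} (hφ : ∀ n, φ n
      = (Real.sqrt (thermalWeight νp n.1 * thermalWeight νm n.2) : ℂ) • ket₂ n.1 n.2) :
    (Summable fun n => ‖φ n‖ ^ 2) ∧
    HasSum (fun n => (InnerProductSpace.rankOne ℂ (φ n) (φ n) : TwoMode →L[ℂ] TwoMode))
      (tensorOp (thermal νp) (thermal νm)) := by
  have h0 : ∀ n : ℕ × ℕ, 0 ≤ thermalWeight νp n.1 * thermalWeight νm n.2 := fun n =>
    mul_nonneg (thermalWeight_nonneg hp _) (thermalWeight_nonneg hm _)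
  have h1 : Summable fun n => ‖φ n‖ ^ 2 := by
    refine ((summable_thermalWeight hp).mul_of_nonneg (summable_thermalWeight hm)
      (thermalWeight_nonneg hp) (thermalWeight_nonneg hm)).congr fun n => ?_
    rw [hφ, norm_smul, Complex.norm_real, Real.norm_eq_abs, mul_pow, sq_abs, Real.sq_sqrt (h0 n),
      ket₂, lp.norm_single (by norm_num)]
    simp
  refine ⟨h1, ?_⟩
  have h2 := (summable_rankOne h1 h1).hasSum
  convert h2 using 1
  refine ContinuousLinearMap.ext_on dense_span_expVec₂ ?_
  rintro _ ⟨⟨p, q⟩, rfl⟩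
  ext ⟨i, j⟩
  have h3 := hasSum_inner_of_hasSum_rankOne h2 (ket₂ i j) (expVec₂ p q)
  rw [← inner_ket₂, ← inner_ket₂]
  refine HasSum.unique ?_ h3
  change HasSum _ (inner ℂ (ket₂ i j) (tensorOp _ _ (prodVec (expVec p) (expVec q))))
  rw [inner_ket₂, expVec₂, tensorOp_prodVec, prodVec_apply, thermal_apply hp, thermal_apply hm]
  refine (hasSum_ite_eq (i, j) _).congr_fun fun n => ?_
  rw [hφ, inner_smul_right, inner_smul_left, inner_ket₂, inner_ket₂, Complex.conj_ofReal]
  have h4 : (Real.sqrt (thermalWeight νp n.1 * thermalWeight νm n.2) : ℂ)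
      * Real.sqrt (thermalWeight νp n.1 * thermalWeight νm n.2)
      = thermalWeight νp n.1 * thermalWeight νm n.2 := by
    rw [← Complex.ofReal_mul, Real.mul_self_sqrt (h0 n), Complex.ofReal_mul]
  rcases eq_or_ne n (i, j) with rfl | hn
  · rw [if_pos rfl, ket₂, lp.single_apply_self, mul_one, ← mul_assoc, h4, prodVec_apply]
    ring
  · rw [if_neg hn, ket₂, lp.single_apply_ne _ _ _ hn.symm]
    simp

/-! ### Choi states -/

theorem squeezedVacuum_apply (r : ℝ) (i j : ℕ) : squeezedVacuum r (i, j)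
    = if i = j then (((Real.cosh r)⁻¹ * Real.tanh r ^ j : ℝ) : ℂ) else 0 := by
  have ht : |Real.tanh r| < 1 := Real.abs_tanh_lt_one r
  have hs : Summable fun j : ℕ => ((Real.tanh r ^ j : ℝ) : ℂ) • ket₂ j j := by
    refine Summable.of_norm ((summable_geometric_of_abs_lt_one ht).abs.congr fun j => ?_)
    rw [norm_smul, ket₂, lp.norm_single (by norm_num), Complex.norm_real, Real.norm_eq_abs]
    simp
  have h1 := (hs.hasSum.mapL (innerSL ℂ (ket₂ i j)))
  rw [squeezedVacuum, lp.coeFn_smul, Pi.smul_apply, smul_eq_mul, ← inner_ket₂ i j]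
  have h2 := h1.unique (a₂ := if i = j then ((Real.tanh r ^ j : ℝ) : ℂ) else 0) (by
    refine (hasSum_ite_eq j (if i = j then ((Real.tanh r ^ j : ℝ) : ℂ) else 0)).congr_fun
      fun n => ?_
    rw [innerSL_apply_apply, inner_smul_right, inner_ket₂, ket₂]
    simp only [lp.single_apply, Pi.single_apply, Prod.mk.injEq]
    rcases eq_or_ne n j with rfl | hn
    · simp
    · simp [hn, hn.symm])
  rw [innerSL_apply_apply] at h2
  rw [h2]
  split_ifs <;> simp

theorem row_swapModes_squeezedVacuum (r : ℝ) (j : ℕ) : row (swapModes (squeezedVacuum r)) j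
    = (((Real.cosh r)⁻¹ * Real.tanh r ^ j : ℝ) : ℂ) • ket j := by
  ext i
  change squeezedVacuum r (i, j) = _
  rw [squeezedVacuum_apply, lp.coeFn_smul, Pi.smul_apply, ket_apply, smul_eq_mul]
  split_ifs <;> simp_all

theorem onFirst_squeezedVacuum_apply (A : Mode →L[ℂ] Mode) (r : ℝ) (i j : ℕ) :
    onFirst A (squeezedVacuum r) (i, j)
      = (((Real.cosh r)⁻¹ * Real.tanh r ^ j : ℝ) : ℂ) * A (ket j) i := by
  rw [onFirst_apply, row_swapModes_squeezedVacuum, map_smul]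
  rfl

/-- The squeezed vacuum acts as a damped flip: each |j, j⟩ carries (tanh r)ʲ, which rescales the
argument of the exponential vector. This is the source of the factors tanh r in the kernels. -/
theorem inner_expVec₂_onFirst_squeezedVacuum (A : Mode →L[ℂ] Mode) (r : ℝ) (u z : ℂ) :
    inner ℂ (expVec₂ u z) (onFirst A (squeezedVacuum r))
      = ((Real.cosh r)⁻¹ : ℝ) * inner ℂ (expVec u) (A (expVec (Real.tanh r * starRingEnd ℂ z))) := by
  refine (hasSum_inner_row_swapModes u z _).unique ?_
  rw [← adjoint_inner_left]
  refine ((hasSum_inner_ket (adjoint A (expVec u))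
    (expVec (Real.tanh r * starRingEnd ℂ z))).mul_left _).congr_fun fun j => ?_
  have h1 : row (swapModes (onFirst A (squeezedVacuum r))) j
      = A (row (swapModes (squeezedVacuum r)) j) := rfl
  rw [h1, row_swapModes_squeezedVacuum, map_smul, inner_smul_right, adjoint_inner_left,
    RCLike.inner_apply, inner_ket, expVec_apply, expVec_apply, map_div₀, map_pow,
    Complex.conj_ofReal, mul_pow]
  push_cast
  ring

theorem IsKrausRepresentation.hasSum_norm_sq {Φ : traceClass →ₗ[ℂ] traceClass}
    {K : ℕ → ℕ → Mode →L[ℂ] Mode} (h : IsKrausRepresentation Φ K) (ψ : Mode) :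
    HasSum (fun n : ℕ × ℕ => ‖K n.1 n.2 ψ‖ ^ 2) (‖ψ‖ ^ 2) := by
  have h1 := Complex.hasSum_re ((h.resolution ψ).mapL (innerSL ℂ ψ))
  have h2 : ∀ φ : Mode, ‖φ‖ ^ 2 = (inner ℂ φ φ).re := fun φ => by
    rw [inner_self_eq_norm_sq_to_K]
    norm_cast
  rw [h2]
  refine h1.congr_fun fun n => ?_
  rw [h2, innerSL_apply_apply, adjoint_inner_right]

theorem IsKrausRepresentation.summable_norm_onFirst {Φ : traceClass →ₗ[ℂ] traceClass}
    {K : ℕ → ℕ → Mode →L[ℂ] Mode} (h : IsKrausRepresentation Φ K) (ψ : TwoMode) :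
    Summable fun n : ℕ × ℕ => ‖onFirst (K n.1 n.2) ψ‖ ^ 2 := by
  have h1 : ∀ χ : TwoMode, HasSum (fun j => ‖row (swapModes χ) j‖ ^ 2) (‖χ‖ ^ 2) := fun χ => by
    have h2 : ‖swapModes χ‖ = ‖χ‖ := norm_swapVec χ
    rw [← h2]
    exact hasSum_norm_row _
  have h2 : Summable fun p : ℕ × (ℕ × ℕ) => ‖K p.2.1 p.2.2 (row (swapModes ψ) p.1)‖ ^ 2 := by
    rw [summable_prod_of_nonneg fun _ => by positivity]
    refine ⟨fun j => (h.hasSum_norm_sq (row (swapModes ψ) j)).summable,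
      (h1 ψ).summable.congr fun j => ?_⟩
    exact (h.hasSum_norm_sq (row (swapModes ψ) j)).tsum_eq.symm
  have h3 : Summable fun p : (ℕ × ℕ) × ℕ => ‖K p.1.1 p.1.2 (row (swapModes ψ) p.2)‖ ^ 2 :=
    (Equiv.prodComm (ℕ × ℕ) ℕ).summable_iff.2 h2
  rw [summable_prod_of_nonneg fun _ => by positivity] at h3
  refine h3.2.congr fun n => ?_
  rw [← (h1 (onFirst (K n.1 n.2) ψ)).tsum_eq]
  rfl

/-- Both σ and ∑ (K_n ⊗ 1)|Ψ_r⟩⟨Ψ_r|(K_n ⊗ 1)† are tested on product exponential vectors; the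
rescaled kernel makes them equal. The Fock blocks of the second operator are visibly those of Φ
applied to the squeezed vacuum. -/
theorem isOneSidedAction_of_kernel {Φ : traceClass →ₗ[ℂ] traceClass}
    {K T : ℕ → ℕ → Mode →L[ℂ] Mode} {r : ℝ} (hΦ : IsKrausRepresentation Φ K)
    (hΦ' : ∀ (ρ : traceClass) (x y : Mode), HasSum (fun n : ℕ × ℕ =>
      inner ℂ (adjoint (K n.1 n.2) x) ((ρ : Mode →L[ℂ] Mode) (adjoint (K n.1 n.2) y)))
        (inner ℂ x ((Φ ρ : Mode →L[ℂ] Mode) y)))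
    {F : ℂ → ℂ → ℂ → ℂ → ℂ}
    (hK : ∀ u v w z, HasSum (fun n : ℕ × ℕ =>
      starRingEnd ℂ (inner ℂ (expVec v) (K n.1 n.2 (expVec w)))
        * inner ℂ (expVec u) (K n.1 n.2 (expVec z))) (F u v w z))
    (hT : ∀ u v w z, HasSum (fun n : ℕ × ℕ =>
      starRingEnd ℂ (inner ℂ (expVec v) (T n.1 n.2 (expVec w)))
        * inner ℂ (expVec u) (T n.1 n.2 (expVec z))) (F u v (Real.tanh r * w) (Real.tanh r * z)))
    {τ : ℕ × ℕ → TwoMode} (hτ : ∀ n u z, inner ℂ (expVec₂ u z) (τ n)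
      = ((Real.cosh r)⁻¹ : ℝ) * inner ℂ (expVec u) (T n.1 n.2 (expVec (starRingEnd ℂ z))))
    {σ : TwoMode →L[ℂ] TwoMode}
    (hσ : HasSum (fun n => (InnerProductSpace.rankOne ℂ (τ n) (τ n) : TwoMode →L[ℂ] TwoMode)) σ) :
    IsOneSidedAction Φ
      (InnerProductSpace.rankOne ℂ (squeezedVacuum r) (squeezedVacuum r)) σ := by
  have h1 := hΦ.summable_norm_onFirst (squeezedVacuum r)
  have h2 := (summable_rankOne h1 h1).hasSum
  have hσ' : σ = ∑' n : ℕ × ℕ, (InnerProductSpace.rankOne ℂ (onFirst (K n.1 n.2) (squeezedVacuum r))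
      (onFirst (K n.1 n.2) (squeezedVacuum r)) : TwoMode →L[ℂ] TwoMode) := by
    refine eq_of_inner_expVec₂ fun u z v w => ?_
    have h3 := hasSum_inner_of_hasSum_rankOne h2 (expVec₂ u z) (expVec₂ v w)
    have h4 := hasSum_inner_of_hasSum_rankOne hσ (expVec₂ u z) (expVec₂ v w)
    have h5 := ((hT u v (starRingEnd ℂ w) (starRingEnd ℂ z)).mul_left
      (((Real.cosh r)⁻¹ : ℝ) : ℂ)).mul_left (((Real.cosh r)⁻¹ : ℝ) : ℂ)
    have h6 := ((hK u v (Real.tanh r * starRingEnd ℂ w) (Real.tanh r * starRingEnd ℂ z)).mul_left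
      (((Real.cosh r)⁻¹ : ℝ) : ℂ)).mul_left (((Real.cosh r)⁻¹ : ℝ) : ℂ)
    refine (h4.unique (h5.congr_fun fun n => ?_)).trans (h3.unique (h6.congr_fun fun n => ?_)).symm
    · rw [← inner_conj_symm (τ n), hτ, hτ, map_mul, Complex.conj_ofReal]
      ring
    · rw [← inner_conj_symm (onFirst _ _), inner_expVec₂_onFirst_squeezedVacuum,
        inner_expVec₂_onFirst_squeezedVacuum, map_mul, Complex.conj_ofReal]
      ring
  intro m n
  -- The (m, n) block of |Ψ_r⟩⟨Ψ_r| is a multiple of |m⟩⟨n|, because the squeezed vacuum is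
  -- supported on the diagonal.
  refine ⟨(((Real.cosh r)⁻¹ * Real.tanh r ^ m * ((Real.cosh r)⁻¹ * Real.tanh r ^ n) : ℝ) : ℂ) •
    ⟨ketBra m n, (nuclearSeries_rankOne (ket m) (ket n)).mem_traceClass⟩, fun i j => ?_,
    fun i j => ?_⟩
  · rw [InnerProductSpace.rankOne_apply, inner_smul_right, ← inner_conj_symm (squeezedVacuum r),
      inner_ket₂, inner_ket₂, squeezedVacuum_apply, squeezedVacuum_apply, Submodule.coe_smul,
      smul_apply, inner_smul_right]
    change _ * inner ℂ (ket i) (InnerProductSpace.rankOne ℂ (ket m) (ket n) (ket j)) = _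
    rw [InnerProductSpace.rankOne_apply, inner_smul_right, inner_ket, inner_ket, ket_apply, ket_apply]
    generalize (Real.cosh r)⁻¹ * Real.tanh r ^ m = a
    generalize (Real.cosh r)⁻¹ * Real.tanh r ^ n = b
    rcases eq_or_ne i m with rfl | hi <;> rcases eq_or_ne j n with rfl | hj
    · simp [mul_comm]
    · simp [hj, hj.symm]
    · simp [hi]
    · simp [hi]
  · rw [hσ']
    refine (hΦ' _ _ _).unique ?_
    refine (hasSum_inner_of_hasSum_rankOne h2 (ket₂ i m) (ket₂ j n)).congr_fun fun N => ?_
    rw [← inner_conj_symm (onFirst _ _), inner_ket₂, inner_ket₂, onFirst_squeezedVacuum_apply,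
      onFirst_squeezedVacuum_apply, Submodule.coe_smul, smul_apply, inner_smul_right]
    change _ * inner ℂ _ (InnerProductSpace.rankOne ℂ (ket m) (ket n) _) = _
    rw [InnerProductSpace.rankOne_apply, inner_smul_right, adjoint_inner_left, adjoint_inner_right,
      ← inner_conj_symm _ (ket j), inner_ket, inner_ket, map_mul, Complex.conj_ofReal]
    push_cast
    ring

theorem normFactor_nonneg (r : ℝ) {νp νm : ℝ} (hp : 1 ≤ νp) (hm : 1 ≤ νm) :
    0 ≤ normFactor r νp νm := by
  have := xParam_sq_lt_one hp
  have := xParam_sq_lt_one hm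
  exact mul_nonneg (mul_nonneg (sq_nonneg _) (by linarith)) (by linarith)

/-- Here σ is defined as U†(thermal ⊗ thermal)U, so the canonical form and the Fock series hold by
construction. The content is that σ is the Choi state, and this is the agreement of kernels. -/
theorem hasFockChoiDecomposition_of_kernel {Φ : traceClass →ₗ[ℂ] traceClass}
    {K T K₀ : ℕ → ℕ → Mode →L[ℂ] Mode} {r : ℝ} (hΦ : IsKrausRepresentation Φ K)
    (hΦ' : ∀ (ρ : traceClass) (x y : Mode), HasSum (fun n : ℕ × ℕ =>
      inner ℂ (adjoint (K n.1 n.2) x) ((ρ : Mode →L[ℂ] Mode) (adjoint (K n.1 n.2) y)))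
        (inner ℂ x ((Φ ρ : Mode →L[ℂ] Mode) y)))
    {F : ℂ → ℂ → ℂ → ℂ → ℂ}
    (hK : ∀ u v w z, HasSum (fun n : ℕ × ℕ =>
      starRingEnd ℂ (inner ℂ (expVec v) (K n.1 n.2 (expVec w)))
        * inner ℂ (expVec u) (K n.1 n.2 (expVec z))) (F u v w z))
    (hT : ∀ u v w z, HasSum (fun n : ℕ × ℕ =>
      starRingEnd ℂ (inner ℂ (expVec v) (T n.1 n.2 (expVec w)))
        * inner ℂ (expVec u) (T n.1 n.2 (expVec z))) (F u v (Real.tanh r * w) (Real.tanh r * z)))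
    {S : Matrix (Fin 2 ⊕ Fin 2) (Fin 2 ⊕ Fin 2) ℝ} {U : TwoMode →L[ℂ] TwoMode}
    (hU : IsGaussianUnitary S U) (hU' : ∀ n₁ n₂, IsFlip (adjoint U (ket₂ n₁ n₂)) (K₀ n₁ n₂))
    {νp νm : ℝ} (hp : 1 ≤ νp) (hm : 1 ≤ νm)
    (hT' : ∀ n₁ n₂, T n₁ n₂ = ((Real.sqrt (normFactor r νp νm) * xParam νp ^ n₁ * xParam νm ^ n₂ :
      ℝ) : ℂ) • K₀ n₁ n₂) :
    HasFockChoiDecomposition Φ r S νp νm T := by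
  set t : ℕ → ℕ → TwoMode := fun n₁ n₂ =>
    ((Real.sqrt (normFactor r νp νm) * xParam νp ^ n₁ * xParam νm ^ n₂ : ℝ) : ℂ) •
      adjoint U (ket₂ n₁ n₂) with ht
  have hflip : ∀ n₁ n₂, IsFlip (t n₁ n₂) (T n₁ n₂) := fun n₁ n₂ i j => by
    rw [hT', smul_apply, inner_smul_right, hU' n₁ n₂ i j]
    rfl
  have hc := Real.cosh_pos r
  set φ : ℕ × ℕ → TwoMode := fun n =>
    (Real.sqrt (thermalWeight νp n.1 * thermalWeight νm n.2) : ℂ) • ket₂ n.1 n.2 with hφ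
  obtain ⟨h1, h2⟩ := hasSum_rankOne_tensorOp_thermal hp hm (φ := φ) fun _ => rfl
  have hU1 : adjoint U ∘L U = 1 := hU.unitary.1
  have hU2 : U ∘L adjoint U = 1 := hU.unitary.2
  have hτ : ∀ n : ℕ × ℕ, (((Real.cosh r)⁻¹ : ℝ) : ℂ) • t n.1 n.2 = adjoint U (φ n) := fun n => by
    rw [ht, hφ, map_smul, smul_smul, ← Complex.ofReal_mul]
    congr 2
    have hx := xParam_nonneg νp
    have hx' := xParam_nonneg νm
    -- The factor cosh² r inside `normFactor` cancels sech² r, leaving exactly the thermal weights.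
    have e : thermalWeight νp n.1 * thermalWeight νm n.2 = ((Real.cosh r)⁻¹ *
        (Real.sqrt (normFactor r νp νm) * xParam νp ^ n.1 * xParam νm ^ n.2)) ^ 2 := by
      rw [mul_pow, mul_pow, mul_pow, Real.sq_sqrt (normFactor_nonneg r hp hm), thermalWeight,
        thermalWeight, normFactor]
      field_simp
      ring
    rw [e, Real.sqrt_sq (by positivity)]
  have h3 : HasSum (fun n : ℕ × ℕ => (InnerProductSpace.rankOne ℂ
      ((((Real.cosh r)⁻¹ : ℝ) : ℂ) • t n.1 n.2) ((((Real.cosh r)⁻¹ : ℝ) : ℂ) • t n.1 n.2) :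
      TwoMode →L[ℂ] TwoMode)) (adjoint U ∘L tensorOp (thermal νp) (thermal νm) ∘L U) := by
    have h4 := (h2.mapL ((ContinuousLinearMap.compL ℂ TwoMode TwoMode TwoMode).flip U)).mapL
      (ContinuousLinearMap.compL ℂ TwoMode TwoMode TwoMode (adjoint U))
    simp only [hτ]
    simpa [InnerProductSpace.rankOne_comp, InnerProductSpace.comp_rankOne] using h4
  have h4 : Summable fun n : ℕ × ℕ => ‖(((Real.cosh r)⁻¹ : ℝ) : ℂ) • t n.1 n.2‖ ^ 2 := by
    refine Summable.of_nonneg_of_le (fun _ => by positivity) (fun n => ?_)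
      (h1.mul_left (‖adjoint U‖ ^ 2))
    rw [hτ, ← mul_pow]
    exact pow_le_pow_left₀ (norm_nonneg _) (le_opNorm _ _) 2
  refine ⟨adjoint U ∘L tensorOp (thermal νp) (thermal νm) ∘L U, U, t, ?_, hU, ?_,
    fun _ _ => rfl, ?_, hflip⟩
  · refine isOneSidedAction_of_kernel hΦ hΦ' hK hT (fun n u z => ?_) h3
    rw [inner_smul_right, inner_expVec₂_of_isFlip (hflip _ _)]
  · calc U ∘L (adjoint U ∘L tensorOp (thermal νp) (thermal νm) ∘L U) ∘L adjoint U
        = (U ∘L adjoint U) ∘L tensorOp (thermal νp) (thermal νm) ∘L (U ∘L adjoint U) := rfl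
      _ = _ := by
        rw [hU2]
        rfl
  · refine hasTraceNormSum_of_hasSum_rankOne (κ := Unit)
      (φ := fun p => (((Real.cosh r)⁻¹ : ℝ) : ℂ) • t p.1.1 p.1.2)
      (ψ := fun p => (((Real.cosh r)⁻¹ : ℝ) : ℂ) • t p.1.1 p.1.2) ?_ ?_ fun n => ?_
    · refine (Equiv.prodPUnit (ℕ × ℕ)).summable_iff (f := fun n : ℕ × ℕ =>
        ‖(((Real.cosh r)⁻¹ : ℝ) : ℂ) • t n.1 n.2‖ * ‖(((Real.cosh r)⁻¹ : ℝ) : ℂ) • t n.1 n.2‖) |>.2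
        (summable_norm_mul_norm h4 h4)
    · exact (Equiv.prodPUnit (ℕ × ℕ)).hasSum_iff.2 h3
    · have e : ((Real.cosh r ^ 2)⁻¹ : ℂ) • (InnerProductSpace.rankOne ℂ (t n.1 n.2) (t n.1 n.2) :
          TwoMode →L[ℂ] TwoMode) = InnerProductSpace.rankOne ℂ ((((Real.cosh r)⁻¹ : ℝ) : ℂ) •
          t n.1 n.2) ((((Real.cosh r)⁻¹ : ℝ) : ℂ) • t n.1 n.2) := ?_
      · rw [e]
        exact hasSum_unique _
      ext1 ψ
      simp only [smul_apply, InnerProductSpace.rankOne_apply, inner_smul_left, smul_smul,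
        Complex.conj_ofReal]
      congr 1
      push_cast
      ring

/-! ### Parameters of the canonical form: attenuator and amplifier -/

theorem cosh_sq_eq_half (r : ℝ) : Real.cosh r ^ 2 = (Real.cosh (2 * r) + 1) / 2 := by
  rw [Real.cosh_two_mul, Real.sinh_sq]
  ring

theorem tanh_eq_sinh_div (r : ℝ) :
    Real.tanh r = Real.sinh (2 * r) / (Real.cosh (2 * r) + 1) := by
  have h := Real.cosh_pos r
  have h1 : Real.cosh (2 * r) + 1 = 2 * Real.cosh r ^ 2 := by
    rw [cosh_sq_eq_half]
    ring
  rw [h1, Real.sinh_two_mul, Real.tanh_eq_sinh_div_cosh]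
  field_simp

section AB

variable {κ α r : ℝ}

/-- The data shared by attenuator and amplifier: `κ > 0` and `α ≥ |1 - κ²|`. -/
structure ABParams (κ α : ℝ) : Prop where
  pos : 0 < κ
  att : 1 - κ ^ 2 ≤ α
  amp : κ ^ 2 - 1 ≤ α

namespace ABParams

theorem nonneg (h : ABParams κ α) : 0 ≤ α := by linarith [h.att, h.amp]

theorem denom_pos (h : ABParams κ α) : 0 < α + κ ^ 2 + 1 := by
  linarith [h.nonneg, sq_nonneg κ]

theorem mass_pos (h : ABParams κ α) (r : ℝ) :
    0 < α + (κ ^ 2 + 1) * Real.cosh (2 * r) := by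
  have := Real.cosh_pos (2 * r)
  have := h.nonneg
  positivity

theorem abs_lt_mass (h : ABParams κ α) (r : ℝ) :
    |2 * κ * Real.sinh (2 * r)| < α + (κ ^ 2 + 1) * Real.cosh (2 * r) := by
  have h1 := Real.cosh_pos (2 * r)
  have h2 : |Real.sinh (2 * r)| < Real.cosh (2 * r) :=
    abs_lt_of_sq_lt_sq (by linarith [Real.cosh_sq (2 * r)]) h1.le
  have h3 := h.pos
  have h4 := h.nonneg
  rw [abs_mul, abs_of_pos (by positivity)]
  nlinarith [sq_nonneg (κ - 1)]

theorem zAB_sq (h : ABParams κ α) (r : ℝ) : zAB κ α r ^ 2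
    = (α + (κ ^ 2 + 1) * Real.cosh (2 * r)) ^ 2 - 4 * κ ^ 2 * Real.sinh (2 * r) ^ 2 := by
  rw [zAB, Real.sq_sqrt]
  have := sq_lt_sq' (by linarith [neg_abs_le (2 * κ * Real.sinh (2 * r)), h.abs_lt_mass r])
    ((le_abs_self _).trans_lt (h.abs_lt_mass r))
  nlinarith

theorem zAB_pos (h : ABParams κ α) (r : ℝ) : 0 < zAB κ α r := by
  rw [zAB, Real.sqrt_pos]
  have := sq_lt_sq' (by linarith [neg_abs_le (2 * κ * Real.sinh (2 * r)), h.abs_lt_mass r])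
    ((le_abs_self _).trans_lt (h.abs_lt_mass r))
  nlinarith

/-- The square root z disappears from the product of the eigenvalues, and ν₊ - ν₋ = w contains no
root either. Hence (ν₊ ∓ 1)(ν₋ ± 1) below are polynomials in cosh 2r, whose signs follow from the
conditions on α. -/
theorem nu_mul (h : ABParams κ α) (r : ℝ) :
    nuPlusAB κ α r * nuMinusAB κ α r = α * Real.cosh (2 * r) + κ ^ 2 := by
  rw [nuPlusAB, nuMinusAB, wAB]
  linear_combination (1 / 4) * h.zAB_sq r + κ ^ 2 * Real.cosh_sq (2 * r)

theorem nu_pos (h : ABParams κ α) (r : ℝ) : 0 < nuPlusAB κ α r ∧ 0 < nuMinusAB κ α r := by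
  have h1 := h.nu_mul r
  have h2 : 0 < nuPlusAB κ α r + nuMinusAB κ α r := by
    rw [nuPlusAB, nuMinusAB]
    linarith [h.zAB_pos r]
  have h3 : 0 < nuPlusAB κ α r * nuMinusAB κ α r := by
    have := Real.cosh_pos (2 * r)
    have := h.nonneg
    have := h.pos
    rw [h1]
    positivity
  rcases pos_and_pos_or_neg_and_neg_of_mul_pos h3 with h4 | h4
  · exact h4
  · linarith

theorem add_mul_add (h : ABParams κ α) (r : ℝ) : (nuPlusAB κ α r + 1) * (nuMinusAB κ α r + 1)
    = α * Real.cosh (2 * r) + κ ^ 2 + 1 + zAB κ α r := by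
  have h1 := h.nu_mul r
  have h2 : nuPlusAB κ α r + nuMinusAB κ α r = zAB κ α r := by
    rw [nuPlusAB, nuMinusAB]
    ring
  linear_combination h1 + h2

theorem sub_mul_add (h : ABParams κ α) (r : ℝ) : (nuPlusAB κ α r - 1) * (nuMinusAB κ α r + 1)
    = (Real.cosh (2 * r) + 1) * (α + κ ^ 2 - 1) := by
  have h1 := h.nu_mul r
  have h2 : nuPlusAB κ α r - nuMinusAB κ α r = wAB κ α r := by
    rw [nuPlusAB, nuMinusAB]
    ring
  rw [wAB] at h2
  linear_combination h1 + h2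

theorem add_mul_sub (h : ABParams κ α) (r : ℝ) : (nuPlusAB κ α r + 1) * (nuMinusAB κ α r - 1)
    = (Real.cosh (2 * r) - 1) * (α + 1 - κ ^ 2) := by
  have h1 := h.nu_mul r
  have h2 : nuPlusAB κ α r - nuMinusAB κ α r = wAB κ α r := by
    rw [nuPlusAB, nuMinusAB]
    ring
  rw [wAB] at h2
  linear_combination h1 - h2

theorem one_le_nuPlus (h : ABParams κ α) (r : ℝ) : 1 ≤ nuPlusAB κ α r := by
  obtain ⟨-, h2⟩ := h.nu_pos r
  have h3 := h.sub_mul_add r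
  have h4 : 0 ≤ (Real.cosh (2 * r) + 1) * (α + κ ^ 2 - 1) :=
    mul_nonneg (by linarith [Real.cosh_pos (2 * r)]) (by linarith [h.att])
  have := nonneg_of_mul_nonneg_left (h3 ▸ h4) (by linarith : 0 < nuMinusAB κ α r + 1)
  linarith

theorem one_le_nuMinus (h : ABParams κ α) (r : ℝ) : 1 ≤ nuMinusAB κ α r := by
  obtain ⟨h2, -⟩ := h.nu_pos r
  have h3 := h.add_mul_sub r
  have h4 : 0 ≤ (Real.cosh (2 * r) - 1) * (α + 1 - κ ^ 2) :=
    mul_nonneg (by linarith [Real.one_le_cosh (2 * r)]) (by linarith [h.amp])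
  have := nonneg_of_mul_nonneg_right (h3 ▸ h4) (by linarith : 0 < nuPlusAB κ α r + 1)
  linarith

theorem denomSum_pos (h : ABParams κ α) (r : ℝ) :
    0 < α * Real.cosh (2 * r) + κ ^ 2 + 1 + zAB κ α r := by
  have := h.zAB_pos r
  have := h.nonneg
  have := Real.cosh_pos (2 * r)
  positivity

theorem xParam_nuPlus_sq (h : ABParams κ α) (r : ℝ) : xParam (nuPlusAB κ α r) ^ 2
    = (Real.cosh (2 * r) + 1) * (α + κ ^ 2 - 1)
      / (α * Real.cosh (2 * r) + κ ^ 2 + 1 + zAB κ α r) := by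
  obtain ⟨h1, h2⟩ := h.nu_pos r
  rw [xParam_sq (h.one_le_nuPlus r), ← h.sub_mul_add, ← h.add_mul_add,
    mul_div_mul_right _ _ (by linarith)]

theorem xParam_nuMinus_sq (h : ABParams κ α) (r : ℝ) : xParam (nuMinusAB κ α r) ^ 2
    = (Real.cosh (2 * r) - 1) * (α + 1 - κ ^ 2)
      / (α * Real.cosh (2 * r) + κ ^ 2 + 1 + zAB κ α r) := by
  obtain ⟨h1, h2⟩ := h.nu_pos r
  rw [xParam_sq (h.one_le_nuMinus r), ← h.add_mul_sub, ← h.add_mul_add,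
    mul_div_mul_left _ _ (by linarith)]

theorem normFactor_eq (h : ABParams κ α) (r : ℝ) : normFactor r (nuPlusAB κ α r) (nuMinusAB κ α r)
    = 2 * (Real.cosh (2 * r) + 1) / (α * Real.cosh (2 * r) + κ ^ 2 + 1 + zAB κ α r) := by
  obtain ⟨h1, h2⟩ := h.nu_pos r
  rw [normFactor, one_sub_xParam_sq (h.one_le_nuPlus r), one_sub_xParam_sq (h.one_le_nuMinus r),
    ← h.add_mul_add, cosh_sq_eq_half]
  field_simp

/-- With M = α + (κ² + 1) cosh 2r one has z² = M² - (2κ sinh 2r)², so tanh 2μ = 2κ sinh 2r / M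
forces these values. -/
theorem cosh_squeezeParam (h : ABParams κ α) (r : ℝ) : Real.cosh (2 * squeezeParam κ α r)
    = (α + (κ ^ 2 + 1) * Real.cosh (2 * r)) / zAB κ α r ∧ Real.sinh (2 * squeezeParam κ α r)
    = 2 * κ * Real.sinh (2 * r) / zAB κ α r := by
  have hM := h.mass_pos r
  have hz := h.zAB_pos r
  have e : Real.cosh (2 * r) + κ ^ 2 * Real.cosh (2 * r) + α
      = α + (κ ^ 2 + 1) * Real.cosh (2 * r) := by ring
  have hy : 2 * κ * Real.sinh (2 * r) / (α + (κ ^ 2 + 1) * Real.cosh (2 * r))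
      ∈ Set.Ioo (-1 : ℝ) 1 := by
    rw [Set.mem_Ioo, ← abs_lt, abs_div, abs_of_pos hM, div_lt_one hM]
    exact h.abs_lt_mass r
  have e2 : 2 * squeezeParam κ α r
      = Real.artanh (2 * κ * Real.sinh (2 * r) / (α + (κ ^ 2 + 1) * Real.cosh (2 * r))) := by
    rw [squeezeParam, e]
    ring
  have e3 : Real.sqrt (1 - (2 * κ * Real.sinh (2 * r)
      / (α + (κ ^ 2 + 1) * Real.cosh (2 * r))) ^ 2)
      = zAB κ α r / (α + (κ ^ 2 + 1) * Real.cosh (2 * r)) := by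
    rw [Real.sqrt_eq_iff_mul_self_eq_of_pos (by positivity), ← sq, div_pow, h.zAB_sq]
    field_simp
    ring
  rw [e2, Real.cosh_artanh hy, Real.sinh_artanh hy, e3]
  constructor <;> field_simp

theorem sech_sq (h : ABParams κ α) (r : ℝ) : (Real.cosh (squeezeParam κ α r))⁻¹ ^ 2
    = 2 * zAB κ α r / (α + (κ ^ 2 + 1) * Real.cosh (2 * r) + zAB κ α r) := by
  have hM := h.mass_pos r
  have hz := h.zAB_pos r
  rw [inv_pow, cosh_sq_eq_half, (h.cosh_squeezeParam r).1]
  field_simp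

theorem tanh_squeezeParam (h : ABParams κ α) (r : ℝ) : Real.tanh (squeezeParam κ α r)
    = 2 * κ * Real.sinh (2 * r) / (α + (κ ^ 2 + 1) * Real.cosh (2 * r) + zAB κ α r) := by
  have hM := h.mass_pos r
  have hz := h.zAB_pos r
  rw [tanh_eq_sinh_div, (h.cosh_squeezeParam r).1, (h.cosh_squeezeParam r).2]
  field_simp

end ABParams

end AB

theorem sech_sq_add_tanh_sq (μ : ℝ) : (Real.cosh μ)⁻¹ ^ 2 + Real.tanh μ ^ 2 = 1 := by
  have hc := Real.cosh_pos μ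
  rw [Real.tanh_eq_sinh_div_cosh]
  field_simp
  linarith [Real.cosh_sq μ]

theorem abs_sech_le (μ : ℝ) : |(Real.cosh μ)⁻¹| ≤ 1 := by
  rw [abs_of_pos (inv_pos.2 (Real.cosh_pos μ))]
  exact inv_le_one_of_one_le₀ (Real.one_le_cosh μ)

/-! ### Kernels -/

/-- The Gaussian kernel of a phase covariant family of Kraus operators. -/
def gaussKernel (C A B D : ℝ) (u v w z : ℂ) : ℂ :=
  C * Complex.exp (A * starRingEnd ℂ u * v + B * starRingEnd ℂ w * z
    + D * (starRingEnd ℂ u * z + v * starRingEnd ℂ w))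

/-- Matches the closed form of `hasSum_bandKraus_kernel` with prescribed coefficients; the
hypotheses are multiplied by the Laguerre denominator 1 - x₁² x₂² t², so that they are polynomial
identities. -/
theorem hasSum_bandKraus_gaussKernel {g x₁ x₂ s t C A B D : ℝ} (hs : |s| ≤ 1) (ht : |t| < 1)
    (hl : x₁ ^ 2 * (x₂ ^ 2 * t ^ 2) < 1)
    (hC : C * (1 - x₁ ^ 2 * (x₂ ^ 2 * t ^ 2)) = g ^ 2 * s ^ 2)
    (hA : A * (1 - x₁ ^ 2 * (x₂ ^ 2 * t ^ 2)) = x₁ ^ 2 * s ^ 2)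
    (hB : B * (1 - x₁ ^ 2 * (x₂ ^ 2 * t ^ 2)) = x₂ ^ 2 * s ^ 2)
    (hD : D * (1 - x₁ ^ 2 * (x₂ ^ 2 * t ^ 2))
      = t * (1 - x₁ ^ 2 * (x₂ ^ 2 * t ^ 2)) - x₁ ^ 2 * x₂ ^ 2 * s ^ 2 * t) (u v w z : ℂ) :
    HasSum (fun n : ℕ × ℕ => starRingEnd ℂ (inner ℂ (expVec v)
        (bandKraus g x₁ x₂ s t n.1 n.2 (expVec w)))
      * inner ℂ (expVec u) (bandKraus g x₁ x₂ s t n.1 n.2 (expVec z)))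
      (gaussKernel C A B D u v w z) := by
  have h1 := hasSum_bandKraus_kernel (g := g) hs ht hl u v w z
  convert h1 using 1
  set l : ℝ := 1 - x₁ ^ 2 * (x₂ ^ 2 * t ^ 2) with hl'
  have hl0 : (l : ℂ) ≠ 0 := by
    rw [Complex.ofReal_ne_zero]
    linarith
  have e1 : (1 : ℂ) - x₁ ^ 2 * (0 * s ^ 2 + x₂ ^ 2 * t ^ 2) = (l : ℂ) := by
    rw [hl']
    push_cast
    ring
  have hl2 : (l : ℂ) = 1 - x₁ ^ 2 * (x₂ ^ 2 * t ^ 2) := by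
    rw [hl']
    push_cast
    ring
  have hC' : (C : ℂ) * l = g ^ 2 * s ^ 2 := by exact_mod_cast hC
  have hA' : (A : ℂ) * l = x₁ ^ 2 * s ^ 2 := by exact_mod_cast hA
  have hB' : (B : ℂ) * l = x₂ ^ 2 * s ^ 2 := by exact_mod_cast hB
  have hD' : (D : ℂ) * l = t * l - x₁ ^ 2 * x₂ ^ 2 * s ^ 2 * t := by exact_mod_cast hD
  simp only [bandValue]
  rw [e1, gaussKernel]
  have e2 : ∀ x y w : ℂ, w = x + y → (C : ℂ) * Complex.exp w = (g : ℂ) ^ 2 * (s : ℂ) ^ 2 * 1 *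
      Complex.exp x * (1 / (l : ℂ) * Complex.exp y) := by
    rintro x y _ rfl
    rw [Complex.exp_add, ← hC']
    field_simp
  refine e2 _ _ _ ?_
  field_simp
  linear_combination (starRingEnd ℂ u * v) * hA' + (starRingEnd ℂ w * z) * hB'
    + (starRingEnd ℂ u * z + v * starRingEnd ℂ w) * hD' - x₂ ^ 2 * s ^ 2 * starRingEnd ℂ w * z * hl2

/-- The Gaussian kernel of a phase contravariant family of Kraus operators. -/
def conjKernel (C A B D : ℝ) (u v w z : ℂ) : ℂ :=
  C * Complex.exp (A * starRingEnd ℂ u * v + B * starRingEnd ℂ w * z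
    + D * (starRingEnd ℂ u * starRingEnd ℂ w + v * z))

theorem hasSum_antiKraus_conjKernel {g x₁ x₂ s c C A B D : ℝ} (hC : C = g ^ 2)
    (hA : A = x₁ ^ 2 * c ^ 2 + x₂ ^ 2 * s ^ 2) (hB : B = x₁ ^ 2 * s ^ 2 + x₂ ^ 2 * c ^ 2)
    (hD : D = s * c * (x₂ ^ 2 - x₁ ^ 2)) (u v w z : ℂ) :
    HasSum (fun n : ℕ × ℕ => starRingEnd ℂ (inner ℂ (expVec v)
        (antiKraus g x₁ x₂ s c n.1 n.2 (expVec w)))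
      * inner ℂ (expVec u) (antiKraus g x₁ x₂ s c n.1 n.2 (expVec z)))
      (conjKernel C A B D u v w z) := by
  convert hasSum_antiKraus_kernel u v w z using 1
  rw [conjKernel, hC, hA, hB, hD]
  push_cast
  congr 2
  ring

theorem gaussKernel_mul_mul (C A B D t : ℝ) (u v w z : ℂ) :
    gaussKernel C A (B * t ^ 2) (D * t) u v w z = gaussKernel C A B D u v (t * w) (t * z) := by
  simp only [gaussKernel, map_mul, Complex.conj_ofReal]
  push_cast
  congr 2
  ring

theorem conjKernel_mul_mul (C A B D t : ℝ) (u v w z : ℂ) :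
    conjKernel C A (B * t ^ 2) (D * t) u v w z = conjKernel C A B D u v (t * w) (t * z) := by
  simp only [conjKernel, map_mul, Complex.conj_ofReal]
  push_cast
  congr 2
  ring

/-- The kernel depends on r only through tanh r · w and tanh r · z. The root z enters sech² μ, 1 -
x₊² x₋² and the Laguerre denominator through the same factor 2z and cancels from all four
coefficients. -/
theorem ABParams.hasSum_kernel {κ α : ℝ} (h : ABParams κ α) (r : ℝ) (u v w z : ℂ) :
    HasSum (fun n : ℕ × ℕ => starRingEnd ℂ (inner ℂ (expVec v)
        (bandKraus (Real.sqrt (normFactor r (nuPlusAB κ α r) (nuMinusAB κ α r)))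
          (xParam (nuPlusAB κ α r)) (xParam (nuMinusAB κ α r)) (Real.cosh (squeezeParam κ α r))⁻¹
          (Real.tanh (squeezeParam κ α r)) n.1 n.2 (expVec w)))
      * inner ℂ (expVec u)
        (bandKraus (Real.sqrt (normFactor r (nuPlusAB κ α r) (nuMinusAB κ α r)))
          (xParam (nuPlusAB κ α r)) (xParam (nuMinusAB κ α r)) (Real.cosh (squeezeParam κ α r))⁻¹
          (Real.tanh (squeezeParam κ α r)) n.1 n.2 (expVec z)))
      (gaussKernel (2 / (α + κ ^ 2 + 1)) ((α + κ ^ 2 - 1) / (α + κ ^ 2 + 1))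
        ((α + 1 - κ ^ 2) / (α + κ ^ 2 + 1)) (2 * κ / (α + κ ^ 2 + 1)) u v
        (Real.tanh r * w) (Real.tanh r * z)) := by
  rw [← gaussKernel_mul_mul]
  have hM := h.mass_pos r
  have hz := h.zAB_pos r
  have hP := h.denomSum_pos r
  have hΔ := h.denom_pos
  have hα := h.nonneg
  have hc := Real.cosh_pos (2 * r)
  have hp := xParam_sq_lt_one (h.one_le_nuPlus r)
  have hm := xParam_sq_lt_one (h.one_le_nuMinus r)
  have hsq := h.zAB_sq r
  have hcS := Real.cosh_sq (2 * r)
  have ht2 : Real.tanh (squeezeParam κ α r) ^ 2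
      = (α + (κ ^ 2 + 1) * Real.cosh (2 * r) - zAB κ α r)
        / (α + (κ ^ 2 + 1) * Real.cosh (2 * r) + zAB κ α r) := by
    rw [eq_sub_of_add_eq' (sech_sq_add_tanh_sq (squeezeParam κ α r)), h.sech_sq]
    field_simp
    ring
  -- By the definition of z, (α cosh 2r + κ² + 1)² - z² factors as (cosh² 2r - 1)(α² - (κ² - 1)²).
  have hpm : xParam (nuPlusAB κ α r) ^ 2 * xParam (nuMinusAB κ α r) ^ 2
      = (α * Real.cosh (2 * r) + κ ^ 2 + 1 - zAB κ α r)
        / (α * Real.cosh (2 * r) + κ ^ 2 + 1 + zAB κ α r) := by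
    rw [h.xParam_nuPlus_sq, h.xParam_nuMinus_sq, div_mul_div_comm, div_eq_div_iff (by positivity)
      (by positivity)]
    have e : (Real.cosh (2 * r) + 1) * (α + κ ^ 2 - 1) * ((Real.cosh (2 * r) - 1) * (α + 1 - κ ^ 2))
        = (α * Real.cosh (2 * r) + κ ^ 2 + 1 - zAB κ α r)
          * (α * Real.cosh (2 * r) + κ ^ 2 + 1 + zAB κ α r) := by
      linear_combination hsq + 4 * κ ^ 2 * hcS
    rw [e]
    ring
  have hl : 1 - xParam (nuPlusAB κ α r) ^ 2 * (xParam (nuMinusAB κ α r) ^ 2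
        * Real.tanh (squeezeParam κ α r) ^ 2)
      = 2 * zAB κ α r * ((Real.cosh (2 * r) + 1) * (α + κ ^ 2 + 1))
        / ((α * Real.cosh (2 * r) + κ ^ 2 + 1 + zAB κ α r)
          * (α + (κ ^ 2 + 1) * Real.cosh (2 * r) + zAB κ α r)) := by
    rw [← mul_assoc, hpm, ht2]
    field_simp
    ring
  refine hasSum_bandKraus_gaussKernel (abs_sech_le _) (Real.abs_tanh_lt_one _) ?_ ?_ ?_ ?_ ?_ u v w z
  · rw [← sub_pos, hl]
    positivity
  · rw [hl, Real.sq_sqrt (normFactor_nonneg r (h.one_le_nuPlus r) (h.one_le_nuMinus r)),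
      h.normFactor_eq, h.sech_sq]
    field_simp
  · rw [hl, h.xParam_nuPlus_sq, h.sech_sq]
    field_simp
  · rw [hl, h.xParam_nuMinus_sq, h.sech_sq, tanh_eq_sinh_div, div_pow, ← sub_eq_iff_eq_add.2 hcS]
    field_simp
    ring
  · have e : Real.tanh (squeezeParam κ α r) * (1 - xParam (nuPlusAB κ α r) ^ 2
        * (xParam (nuMinusAB κ α r) ^ 2 * Real.tanh (squeezeParam κ α r) ^ 2))
        - xParam (nuPlusAB κ α r) ^ 2 * xParam (nuMinusAB κ α r) ^ 2
          * (Real.cosh (squeezeParam κ α r))⁻¹ ^ 2 * Real.tanh (squeezeParam κ α r)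
        = Real.tanh (squeezeParam κ α r)
          * (1 - xParam (nuPlusAB κ α r) ^ 2 * xParam (nuMinusAB κ α r) ^ 2) := by
      linear_combination -(Real.tanh (squeezeParam κ α r) * xParam (nuPlusAB κ α r) ^ 2 *
        xParam (nuMinusAB κ α r) ^ 2) * sech_sq_add_tanh_sq (squeezeParam κ α r)
    rw [e, hl, hpm, h.tanh_squeezeParam, tanh_eq_sinh_div r]
    field_simp
    ring

/-! ### Parameters of the canonical form: phase conjugation -/

/-- The conditions `κ > 0` and `α ≥ κ² + 1` of phase conjugation. -/
structure ConjParams (κ α : ℝ) : Prop where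
  pos : 0 < κ
  le : κ ^ 2 + 1 ≤ α

namespace ConjParams

variable {κ α r : ℝ}

theorem denom_pos (h : ConjParams κ α) : 0 < α + κ ^ 2 + 1 := by
  linarith [h.le, sq_nonneg κ]

theorem zC_sq (κ α r : ℝ) : zC κ α r ^ 2
    = (α + (κ ^ 2 - 1) * Real.cosh (2 * r)) ^ 2 + 4 * κ ^ 2 * Real.sinh (2 * r) ^ 2 := by
  rw [zC, Real.sq_sqrt (by positivity)]

/-- Only the case sinh 2r = 0 needs the condition on α: then cosh 2r = 1 and α + κ² - 1 ≥ 2κ² > 0.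
-/
theorem zC_pos (h : ConjParams κ α) (r : ℝ) : 0 < zC κ α r := by
  have hκ := h.pos
  rw [zC, Real.sqrt_pos]
  rcases eq_or_ne (Real.sinh (2 * r)) 0 with h0 | h0
  · have h1 : Real.cosh (2 * r) = 1 := by
      have := Real.cosh_sq (2 * r)
      rw [h0] at this
      exact (sq_eq_sq₀ (Real.cosh_pos _).le one_pos.le).1 (by linarith)
    have h2 : 0 < α + (κ ^ 2 - 1) * Real.cosh (2 * r) := by
      rw [h1]
      nlinarith [h.le, sq_pos_of_pos hκ]
    positivity
  · positivity

theorem nu_mul (κ α r : ℝ) : nuPlusC κ α r * nuMinusC κ α r = α * Real.cosh (2 * r) + κ ^ 2 := by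
  rw [nuPlusC, nuMinusC, wC]
  linear_combination -(1 / 4) * zC_sq κ α r + κ ^ 2 * Real.cosh_sq (2 * r)

theorem nu_add (κ α r : ℝ) : nuPlusC κ α r + nuMinusC κ α r
    = α + κ ^ 2 * Real.cosh (2 * r) + Real.cosh (2 * r) := by
  rw [nuPlusC, nuMinusC, wC]
  ring

/-- The numbers ν± - 1 have nonnegative product and positive sum, hence both are nonnegative. -/
theorem one_le_nu (h : ConjParams κ α) (r : ℝ) : 1 ≤ nuPlusC κ α r ∧ 1 ≤ nuMinusC κ α r := by
  have hc := Real.one_le_cosh (2 * r)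
  have h1 : 0 ≤ (nuPlusC κ α r - 1) * (nuMinusC κ α r - 1) := by
    have e : (nuPlusC κ α r - 1) * (nuMinusC κ α r - 1)
        = (Real.cosh (2 * r) - 1) * (α - κ ^ 2 - 1) := by
      linear_combination nu_mul κ α r - nu_add κ α r
    rw [e]
    exact mul_nonneg (by linarith) (by linarith [h.le])
  have h2 : 0 < (nuPlusC κ α r - 1) + (nuMinusC κ α r - 1) := by
    have := nu_add κ α r
    nlinarith [h.le, sq_pos_of_pos h.pos]
  constructor <;> nlinarith

theorem add_mul_add (κ α r : ℝ) : (nuPlusC κ α r + 1) * (nuMinusC κ α r + 1)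
    = (Real.cosh (2 * r) + 1) * (α + κ ^ 2 + 1) := by
  linear_combination nu_mul κ α r + nu_add κ α r

theorem normFactor_eq (h : ConjParams κ α) (r : ℝ) :
    normFactor r (nuPlusC κ α r) (nuMinusC κ α r) = 2 / (α + κ ^ 2 + 1) := by
  obtain ⟨h1, h2⟩ := h.one_le_nu r
  have h3 := Real.cosh_pos (2 * r)
  have h4 := h.denom_pos
  have e : ∀ a b : ℝ, 0 < a → 0 < b → (Real.cosh (2 * r) + 1) / 2 * (2 / a) * (2 / b)
      = 2 * (Real.cosh (2 * r) + 1) / (a * b) := fun a b ha hb => by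
    field_simp
  rw [normFactor, one_sub_xParam_sq h1, one_sub_xParam_sq h2, cosh_sq_eq_half,
    e _ _ (by linarith) (by linarith), add_mul_add]
  field_simp

/-- Here z is the modulus of the number whose argument is 2θ. Keeping z as a factor matches x₊² -
x₋², which is proportional to z. -/
theorem arg_mul (κ α r : ℝ) :
    zC κ α r * Real.cos (2 * splitAngle κ α r)
      = κ ^ 2 * Real.cosh (2 * r) + α - Real.cosh (2 * r) ∧
    zC κ α r * Real.sin (2 * splitAngle κ α r) = -(2 * κ * Real.sinh (2 * r)) := by
  set p : ℂ := ⟨κ ^ 2 * Real.cosh (2 * r) + α - Real.cosh (2 * r), -(2 * κ * Real.sinh (2 * r))⟩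
    with hp
  have hz : ‖p‖ = zC κ α r := by
    rw [Complex.norm_def, zC, Complex.normSq_apply]
    congr 1
    simp only [hp]
    ring
  have h2 : 2 * splitAngle κ α r = p.arg := by
    rw [splitAngle]
    ring
  rw [h2, ← hz, Complex.norm_mul_cos_arg, Complex.norm_mul_sin_arg]
  exact ⟨rfl, rfl⟩

theorem splitAngle_mem (κ α r : ℝ) : -(Real.pi / 2) < splitAngle κ α r
    ∧ splitAngle κ α r ≤ Real.pi / 2 := by
  rw [splitAngle]
  constructor <;> linarith [Complex.neg_pi_lt_arg ⟨κ ^ 2 * Real.cosh (2 * r) + α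
    - Real.cosh (2 * r), -(2 * κ * Real.sinh (2 * r))⟩, Complex.arg_le_pi ⟨κ ^ 2 * Real.cosh (2 * r)
    + α - Real.cosh (2 * r), -(2 * κ * Real.sinh (2 * r))⟩]

theorem xParam_sq_add (h : ConjParams κ α) (r : ℝ) :
    xParam (nuPlusC κ α r) ^ 2 + xParam (nuMinusC κ α r) ^ 2
      = 2 * (α * Real.cosh (2 * r) + κ ^ 2 - 1)
        / ((Real.cosh (2 * r) + 1) * (α + κ ^ 2 + 1)) ∧
    xParam (nuPlusC κ α r) ^ 2 - xParam (nuMinusC κ α r) ^ 2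
      = 2 * zC κ α r / ((Real.cosh (2 * r) + 1) * (α + κ ^ 2 + 1)) := by
  obtain ⟨h1, h2⟩ := h.one_le_nu r
  rw [xParam_sq h1, xParam_sq h2, ← add_mul_add]
  have h3 : nuPlusC κ α r - nuMinusC κ α r = zC κ α r := by
    rw [nuPlusC, nuMinusC]
    ring
  have h4 := nu_mul κ α r
  have h5 : nuPlusC κ α r + 1 ≠ 0 := by linarith
  have h6 : nuMinusC κ α r + 1 ≠ 0 := by linarith
  rw [← h3, ← h4]
  constructor
  · field_simp
    ring
  · field_simp
    ring

/-- By double-angle formulas the coefficients involve only x₊² + x₋² and (x₊² - x₋²) times cos 2θ or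
sin 2θ. In the latter products z combines with the angle into polynomials in cosh 2r and sinh 2r. -/
theorem hasSum_kernel (h : ConjParams κ α) (r : ℝ) (u v w z : ℂ) :
    HasSum (fun n : ℕ × ℕ => starRingEnd ℂ (inner ℂ (expVec v)
        (antiKraus (Real.sqrt (normFactor r (nuPlusC κ α r) (nuMinusC κ α r)))
          (xParam (nuPlusC κ α r)) (xParam (nuMinusC κ α r)) (Real.sin (splitAngle κ α r))
          (Real.cos (splitAngle κ α r)) n.1 n.2 (expVec w)))
      * inner ℂ (expVec u)
        (antiKraus (Real.sqrt (normFactor r (nuPlusC κ α r) (nuMinusC κ α r)))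
          (xParam (nuPlusC κ α r)) (xParam (nuMinusC κ α r)) (Real.sin (splitAngle κ α r))
          (Real.cos (splitAngle κ α r)) n.1 n.2 (expVec z)))
      (conjKernel (2 / (α + κ ^ 2 + 1)) ((α + κ ^ 2 - 1) / (α + κ ^ 2 + 1))
        ((α + 1 - κ ^ 2) / (α + κ ^ 2 + 1)) (2 * κ / (α + κ ^ 2 + 1)) u v
        (Real.tanh r * w) (Real.tanh r * z)) := by
  rw [← conjKernel_mul_mul]
  have hΔ := h.denom_pos
  have hc := Real.cosh_pos (2 * r)
  obtain ⟨h1, h2⟩ := h.one_le_nu r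
  obtain ⟨e1, e2⟩ := h.xParam_sq_add r
  obtain ⟨e3, e4⟩ := arg_mul κ α r
  have e5 := Real.cos_two_mul (splitAngle κ α r)
  have e6 := Real.sin_two_mul (splitAngle κ α r)
  have e7 := Real.sin_sq_add_cos_sq (splitAngle κ α r)
  set Q := (Real.cosh (2 * r) + 1) * (α + κ ^ 2 + 1) with hQ
  have hQ0 : Q ≠ 0 := (mul_pos (by linarith) hΔ).ne'
  have e8 : (xParam (nuPlusC κ α r) ^ 2 - xParam (nuMinusC κ α r) ^ 2)
      * Real.cos (2 * splitAngle κ α r)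
      = 2 * (κ ^ 2 * Real.cosh (2 * r) + α - Real.cosh (2 * r)) / Q := by
    rw [e2, ← e3]
    ring
  have e9 : (xParam (nuPlusC κ α r) ^ 2 - xParam (nuMinusC κ α r) ^ 2)
      * Real.sin (2 * splitAngle κ α r) = 2 * -(2 * κ * Real.sinh (2 * r)) / Q := by
    rw [e2, ← e4]
    ring
  refine hasSum_antiKraus_conjKernel ?_ ?_ ?_ ?_ u v w z
  · rw [Real.sq_sqrt (normFactor_nonneg r h1 h2), h.normFactor_eq]
  · have e10 : (α + κ ^ 2 - 1) / (α + κ ^ 2 + 1) = (2 * (α * Real.cosh (2 * r) + κ ^ 2 - 1) / Q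
        + 2 * (κ ^ 2 * Real.cosh (2 * r) + α - Real.cosh (2 * r)) / Q) / 2 := by
      rw [hQ]
      field_simp
      ring
    rw [e10, ← e1, ← e8, e5]
    linear_combination -(xParam (nuMinusC κ α r) ^ 2) * e7
  · have e10 : (α + 1 - κ ^ 2) / (α + κ ^ 2 + 1) * Real.tanh r ^ 2
        = (2 * (α * Real.cosh (2 * r) + κ ^ 2 - 1) / Q
        - 2 * (κ ^ 2 * Real.cosh (2 * r) + α - Real.cosh (2 * r)) / Q) / 2 := by
      rw [tanh_eq_sinh_div, div_pow, ← sub_eq_iff_eq_add.2 (Real.cosh_sq (2 * r)), hQ]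
      field_simp
      ring
    rw [e10, ← e1, ← e8, e5]
    linear_combination -(xParam (nuPlusC κ α r) ^ 2) * e7
  · have e10 : 2 * κ / (α + κ ^ 2 + 1) * Real.tanh r = -(2 * -(2 * κ * Real.sinh (2 * r)) / Q) / 2 := by
      rw [tanh_eq_sinh_div, hQ]
      field_simp
    rw [e10, ← e9, e6]
    ring

end ConjParams

/-! ### The channels -/

theorem dotProduct_smul_one_mulVec (α : ℝ) (ξ : Fin 2 → ℝ) :
    -(1 / 2) * (ξ ⬝ᵥ (α • (1 : Matrix (Fin 2) (Fin 2) ℝ)).mulVec ξ)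
      = -(α * (‖Complex.I * ((ξ 0 : ℂ) + Complex.I * (ξ 1 : ℂ))‖ ^ 2 / 2)) := by
  rw [norm_mul, Complex.norm_I, one_mul, ← Complex.normSq_eq_norm_sq, Complex.normSq_apply]
  simp [dotProduct, Matrix.mulVec, Matrix.smul_apply, Matrix.one_apply]
  ring

theorem weyl_smul_one (κ : ℝ) (ξ : Fin 2 → ℝ) :
    weyl ((κ • (1 : Matrix (Fin 2) (Fin 2) ℝ)).mulVec ξ)
      = displacement (κ * (Complex.I * ((ξ 0 : ℂ) + Complex.I * (ξ 1 : ℂ)))) := by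
  rw [weyl]
  congr 1
  simp [Matrix.mulVec, dotProduct, Matrix.smul_apply, Matrix.one_apply]
  ring

theorem weyl_smul_pauli₃ (κ : ℝ) (ξ : Fin 2 → ℝ) : weyl ((κ • pauli₃).mulVec ξ)
      = displacement (-(κ * starRingEnd ℂ (Complex.I * ((ξ 0 : ℂ) + Complex.I * (ξ 1 : ℂ))))) := by
  rw [weyl]
  congr 1
  simp [Matrix.mulVec, dotProduct, Matrix.smul_apply, pauli₃]
  ring

theorem exists_isGaussianChannel_smul_one {K : ℕ → ℕ → Mode →L[ℂ] Mode} {κ α : ℝ}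
    (h : ∀ β w z, HasSum
      (fun n : ℕ × ℕ => inner ℂ (K n.1 n.2 (expVec w)) (displacement β (K n.1 n.2 (expVec z))))
      (Complex.exp (-((α + κ ^ 2) * (starRingEnd ℂ β * β / 2)) + starRingEnd ℂ w * z
        - κ * starRingEnd ℂ β * z + κ * starRingEnd ℂ w * β))) :
    ∃ Φ : traceClass →ₗ[ℂ] traceClass, IsGaussianChannel (κ • 1) (α • 1) Φ ∧
      IsKrausRepresentation Φ K ∧
      ∀ (ρ : traceClass) (x y : Mode), HasSum (fun n : ℕ × ℕ => inner ℂ (adjoint (K n.1 n.2) x)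
        ((ρ : Mode →L[ℂ] Mode) (adjoint (K n.1 n.2) y)))
        (inner ℂ x ((Φ ρ : Mode →L[ℂ] Mode) y)) := by
  refine exists_isGaussianChannel K _ _ fun ξ w z => ?_
  rw [dotProduct_smul_one_mulVec, weyl_smul_one, inner_expVec_displacement_expVec,
    Complex.ofReal_exp, ← Complex.exp_add, weyl]
  convert h _ w z using 2
  simp only [ofReal_norm_sq_div_two, Complex.ofReal_neg, Complex.ofReal_mul, map_mul (starRingEnd ℂ),
    Complex.conj_ofReal]
  ring

theorem exists_isGaussianChannel_smul_pauli₃ {K : ℕ → ℕ → Mode →L[ℂ] Mode} {κ α : ℝ}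
    (h : ∀ β w z, HasSum
      (fun n : ℕ × ℕ => inner ℂ (K n.1 n.2 (expVec w)) (displacement β (K n.1 n.2 (expVec z))))
      (Complex.exp (-((α + κ ^ 2) * (starRingEnd ℂ β * β / 2)) + starRingEnd ℂ w * z
        + κ * β * z - κ * starRingEnd ℂ w * starRingEnd ℂ β))) :
    ∃ Φ : traceClass →ₗ[ℂ] traceClass, IsGaussianChannel (κ • pauli₃) (α • 1) Φ ∧
      IsKrausRepresentation Φ K ∧
      ∀ (ρ : traceClass) (x y : Mode), HasSum (fun n : ℕ × ℕ => inner ℂ (adjoint (K n.1 n.2) x)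
        ((ρ : Mode →L[ℂ] Mode) (adjoint (K n.1 n.2) y)))
        (inner ℂ x ((Φ ρ : Mode →L[ℂ] Mode) y)) := by
  refine exists_isGaussianChannel K _ _ fun ξ w z => ?_
  rw [dotProduct_smul_one_mulVec, weyl_smul_pauli₃, inner_expVec_displacement_expVec,
    Complex.ofReal_exp, ← Complex.exp_add, weyl]
  convert h _ w z using 2
  generalize Complex.I * ((ξ 0 : ℂ) + Complex.I * (ξ 1 : ℂ)) = β
  simp only [ofReal_norm_sq_div_two, Complex.ofReal_neg, Complex.ofReal_mul, map_mul (starRingEnd ℂ),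
    Complex.conj_ofReal, map_neg, Complex.conj_conj]
  ring

/-- With x₂ = 1 and s² + κ² = 1 the Laguerre denominator is 1 - x². It cancels the prefactor g² s²,
which leaves a pure Gaussian. -/
theorem hasSum_attenuator {κ α g x s : ℝ} (h1 : κ ^ 2 < 1) (h2 : 1 - κ ^ 2 ≤ α)
    (hg : g ^ 2 = 2 / (α + 1 - κ ^ 2)) (hx : x ^ 2 = (α + κ ^ 2 - 1) / (α + 1 - κ ^ 2))
    (hs : s ^ 2 = 1 - κ ^ 2) (β w z : ℂ) :
    HasSum (fun n : ℕ × ℕ => inner ℂ (bandKraus g x 1 s κ n.1 n.2 (expVec w))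
      (displacement β (bandKraus g x 1 s κ n.1 n.2 (expVec z))))
      (Complex.exp (-((α + κ ^ 2) * (starRingEnd ℂ β * β / 2)) + starRingEnd ℂ w * z
        - κ * starRingEnd ℂ β * z + κ * starRingEnd ℂ w * β)) := by
  have hd : 0 < α + 1 - κ ^ 2 := by linarith
  have hx1 : 1 - x ^ 2 = 2 * (1 - κ ^ 2) / (α + 1 - κ ^ 2) := by
    rw [hx]
    field_simp
    ring
  have hx0 : 0 < 1 - x ^ 2 := by
    rw [hx1]
    exact div_pos (by linarith) hd
  have hs1 : |s| ≤ 1 := abs_le_of_sq_le_sq (by nlinarith [sq_nonneg κ]) one_pos.le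
  have ht1 : |κ| < 1 := abs_lt_of_sq_lt_sq (by linarith) one_pos.le
  have h3 := hasSum_bandKraus_displacement (g := g) (x₁ := x) (x₂ := 1) hs1 ht1
    (by rw [hs]; linarith) β w z
  convert h3 using 1
  have hs' : (s : ℂ) ^ 2 = 1 - κ ^ 2 := by exact_mod_cast hs
  have hgs : (g : ℂ) ^ 2 * s ^ 2 = 1 - x ^ 2 := by
    have : g ^ 2 * s ^ 2 = 1 - x ^ 2 := by
      rw [hx1, hg, hs]
      ring
    exact_mod_cast this
  have hxx : (x : ℂ) ^ 2 * s ^ 2 * 2 = (1 - x ^ 2) * (α + κ ^ 2 - 1) := by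
    have : x ^ 2 * s ^ 2 * 2 = (1 - x ^ 2) * (α + κ ^ 2 - 1) := by
      rw [hx1, hx, hs]
      ring
    exact_mod_cast this
  have hx0' : (1 : ℂ) - x ^ 2 ≠ 0 := by exact_mod_cast hx0.ne'
  simp only [bandValue, ofReal_norm_sq_div_two, Complex.ofReal_one]
  have e1 : (1 : ℂ) - x ^ 2 * (1 * s ^ 2 + 1 ^ 2 * κ ^ 2) = 1 - x ^ 2 := by
    rw [hs']
    ring
  rw [e1]
  have e2 : ∀ X Y Z W : ℂ, W = X + Y + Z → Complex.exp W = (g : ℂ) ^ 2 * (s : ℂ) ^ 2 *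
      Complex.exp X * Complex.exp Y * (1 / (1 - (x : ℂ) ^ 2) * Complex.exp Z) := by
    rintro X Y Z _ rfl
    rw [Complex.exp_add, Complex.exp_add, hgs]
    field_simp
  refine e2 _ _ _ _ ?_
  field_simp
  linear_combination (starRingEnd ℂ β * β) * hxx
    - 2 * (1 - (x : ℂ) ^ 2) * starRingEnd ℂ w * z * hs'

/-- Here x₁ = 1 and the denominator is t²(1 - x²), again equal to g² s² because t = 1/κ. -/
theorem hasSum_amplifier {κ α g x s t : ℝ} (h0 : 0 < κ) (h1 : 1 < κ ^ 2) (h2 : κ ^ 2 - 1 ≤ α)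
    (hg : g ^ 2 = 2 / (α + κ ^ 2 - 1)) (hx : x ^ 2 = (α - κ ^ 2 + 1) / (α + κ ^ 2 - 1))
    (ht : t * κ = 1) (hs : s ^ 2 = 1 - t ^ 2) (β w z : ℂ) :
    HasSum (fun n : ℕ × ℕ => inner ℂ (bandKraus g 1 x s t n.1 n.2 (expVec w))
      (displacement β (bandKraus g 1 x s t n.1 n.2 (expVec z))))
      (Complex.exp (-((α + κ ^ 2) * (starRingEnd ℂ β * β / 2)) + starRingEnd ℂ w * z
        - κ * starRingEnd ℂ β * z + κ * starRingEnd ℂ w * β)) := by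
  have hd : 0 < α + κ ^ 2 - 1 := by linarith
  have hx1 : (1 - x ^ 2) * (α + κ ^ 2 - 1) = 2 * (κ ^ 2 - 1) := by
    rw [hx]
    field_simp
    ring
  have hx0 : 0 < 1 - x ^ 2 := pos_of_mul_pos_left (hx1 ▸ by linarith) hd.le
  have ht0 : 0 < t := pos_of_mul_pos_left (ht ▸ one_pos) h0.le
  have htk : t ^ 2 * κ ^ 2 = 1 := by rw [← mul_pow, ht, one_pow]
  have ht2 : t ^ 2 < 1 := by nlinarith [sq_pos_of_pos ht0]
  have hs1 : |s| ≤ 1 := abs_le_of_sq_le_sq (by nlinarith [sq_nonneg t]) one_pos.le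
  have ht1 : |t| < 1 := abs_lt_of_sq_lt_sq (by linarith) one_pos.le
  have hl : 0 < t ^ 2 * (1 - x ^ 2) := by positivity
  have h3 := hasSum_bandKraus_displacement (g := g) (x₁ := 1) (x₂ := x) hs1 ht1
    (by rw [hs]; linarith) β w z
  convert h3 using 1
  have hs' : (s : ℂ) ^ 2 = 1 - t ^ 2 := by exact_mod_cast hs
  have ht' : (t : ℂ) * κ = 1 := by exact_mod_cast ht
  have hgs : (g : ℂ) ^ 2 * s ^ 2 = t ^ 2 * (1 - x ^ 2) := by
    have : g ^ 2 * s ^ 2 = t ^ 2 * (1 - x ^ 2) := by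
      rw [hg, hs, div_mul_eq_mul_div, div_eq_iff hd.ne', mul_assoc, hx1]
      linear_combination -2 * htk
    exact_mod_cast this
  have hxx : (s : ℂ) ^ 2 * 2 = t ^ 2 * (1 - x ^ 2) * (α + κ ^ 2 - 1) := by
    have : s ^ 2 * 2 = t ^ 2 * (1 - x ^ 2) * (α + κ ^ 2 - 1) := by
      rw [mul_assoc, hx1, hs]
      linear_combination -2 * htk
    exact_mod_cast this
  have hx0' : (1 : ℂ) - x ^ 2 ≠ 0 := by exact_mod_cast hx0.ne'
  have ht0' : (t : ℂ) ≠ 0 := by exact_mod_cast ht0.ne'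
  simp only [bandValue, ofReal_norm_sq_div_two, Complex.ofReal_one]
  have e1 : (1 : ℂ) - 1 ^ 2 * (1 * s ^ 2 + x ^ 2 * t ^ 2) = t ^ 2 * (1 - x ^ 2) := by
    rw [hs']
    ring
  rw [e1]
  have e2 : ∀ X Y Z W : ℂ, W = X + Y + Z → Complex.exp W = (g : ℂ) ^ 2 * (s : ℂ) ^ 2 *
      Complex.exp X * Complex.exp Y * (1 / ((t : ℂ) ^ 2 * (1 - (x : ℂ) ^ 2)) * Complex.exp Z) := by
    rintro X Y Z _ rfl
    rw [Complex.exp_add, Complex.exp_add, hgs]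
    field_simp
  refine e2 _ _ _ _ ?_
  have hk : (κ : ℂ) = (t : ℂ)⁻¹ := eq_inv_of_mul_eq_one_right ht'
  -- Splits (α + κ²)/2 into the vacuum part 1/2 and the remainder (α + κ² - 1)/2 = s²/(t²(1 - x²))
  -- produced by the Laguerre sum.
  have e3 : (-((α + κ ^ 2) * (starRingEnd ℂ β * β / 2)) : ℂ)
      = -(starRingEnd ℂ β * β / 2) - starRingEnd ℂ β * β * s ^ 2 / (t ^ 2 * (1 - x ^ 2)) := by
    field_simp
    linear_combination (starRingEnd ℂ β * β) * hxx
  rw [e3, hk]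
  field_simp
  linear_combination (-2 * (1 - (x : ℂ) ^ 2) * t ^ 2 * starRingEnd ℂ w * z
    + 2 * (1 - (x : ℂ) ^ 2) * t * (starRingEnd ℂ β * z - β * starRingEnd ℂ w)) * hs'

/-- The Laguerre denominator is 1 - (c² + x² s²) = 2/(α + κ² + 1), which is g². -/
theorem hasSum_conj {κ α g x s c : ℝ} (hd : 0 < α + κ ^ 2 + 1)
    (hg : g ^ 2 = 2 / (α + κ ^ 2 + 1))
    (hA : c ^ 2 + x ^ 2 * s ^ 2 = (α + κ ^ 2 - 1) / (α + κ ^ 2 + 1))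
    (hB : s ^ 2 + x ^ 2 * c ^ 2 = (α + 1 - κ ^ 2) / (α + κ ^ 2 + 1))
    (hD : c * s * (x ^ 2 - 1) = 2 * κ / (α + κ ^ 2 + 1)) (β w z : ℂ) :
    HasSum (fun n : ℕ × ℕ => inner ℂ (antiKraus g 1 x s c n.1 n.2 (expVec w))
      (displacement β (antiKraus g 1 x s c n.1 n.2 (expVec z))))
      (Complex.exp (-((α + κ ^ 2) * (starRingEnd ℂ β * β / 2)) + starRingEnd ℂ w * z
        + κ * β * z - κ * starRingEnd ℂ w * starRingEnd ℂ β)) := by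
  have h3 := hasSum_antiKraus_displacement (g := g) (x₁ := 1) (x₂ := x) (s := s) (c := c)
    (by rw [one_pow, one_mul, hA, div_lt_one hd]; linarith) β w z
  convert h3 using 1
  have hd' : (α : ℂ) + κ ^ 2 + 1 ≠ 0 := by exact_mod_cast hd.ne'
  have hg' : (g : ℂ) ^ 2 = 2 / (α + κ ^ 2 + 1) := by exact_mod_cast hg
  have hA' : (1 : ℂ) ^ 2 * c ^ 2 + x ^ 2 * s ^ 2 = (α + κ ^ 2 - 1) / (α + κ ^ 2 + 1) := by
    rw [one_pow, one_mul]
    exact_mod_cast hA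
  have hB' : (1 : ℂ) ^ 2 * s ^ 2 + x ^ 2 * c ^ 2 = (α + 1 - κ ^ 2) / (α + κ ^ 2 + 1) := by
    rw [one_pow, one_mul]
    exact_mod_cast hB
  have hD' : (c : ℂ) * s * (x ^ 2 - 1 ^ 2) = 2 * κ / (α + κ ^ 2 + 1) := by
    rw [one_pow]
    exact_mod_cast hD
  simp only [antiValue, ofReal_norm_sq_div_two, Complex.ofReal_one]
  rw [hA', hB', hD', hg']
  have e1 : (1 : ℂ) - (α + κ ^ 2 - 1) / (α + κ ^ 2 + 1) = 2 / (α + κ ^ 2 + 1) := by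
    field_simp
    ring
  rw [e1]
  have e2 : ∀ X Y W : ℂ, W = X + Y → Complex.exp W = 2 / ((α : ℂ) + κ ^ 2 + 1) *
      Complex.exp X * (1 / (2 / ((α : ℂ) + κ ^ 2 + 1)) * Complex.exp Y) := by
    rintro X Y _ rfl
    rw [Complex.exp_add]
    field_simp
  refine e2 _ _ _ ?_
  field_simp
  ring

/-! ### The limit of infinite squeezing -/

section Limits

variable {β : Type*} {l : Filter β} {g x₁ x₂ s t : β → ℝ} {g' x₁' x₂' s' t' : ℝ}

theorem _root_.Filter.Tendsto.fun_div {f h : β → ℝ} {a b : ℝ} (hf : Tendsto f l (𝓝 a))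
    (hh : Tendsto h l (𝓝 b)) (hb : b ≠ 0) : Tendsto (fun r => f r / h r) l (𝓝 (a / b)) :=
  hf.div hh hb

theorem tendsto_ofReal_smul {f : β → ℝ} {a : ℝ} (h : Tendsto f l (𝓝 a)) (T : Mode →L[ℂ] Mode) :
    Tendsto (fun r => (f r : ℂ) • T) l (𝓝 ((a : ℂ) • T)) :=
  ((Complex.continuous_ofReal.tendsto a).comp h).smul_const T

theorem tendsto_antiBandOp {n₁ n₂ : ℕ} {c : β → ℕ → ℝ} {c' : ℕ → ℝ}
    (h : ∀ m, Tendsto (fun r => c r m) l (𝓝 (c' m))) :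
    Tendsto (fun r => antiBandOp n₁ n₂ (c r)) l (𝓝 (antiBandOp n₁ n₂ c')) := by
  simp only [antiBandOp]
  exact tendsto_finsetSum _ fun m _ => tendsto_ofReal_smul (h m) _

theorem tendsto_bandOp {n₁ n₂ : ℕ} {c : β → ℕ → ℝ} {c' b : ℕ → ℝ} (hb : Summable b)
    (h : ∀ m, Tendsto (fun r => c r m) l (𝓝 (c' m))) (hc : ∀ᶠ r in l, ∀ m, |c r m| ≤ b m) :
    Tendsto (fun r => bandOp n₁ n₂ (c r)) l (𝓝 (bandOp n₁ n₂ c')) := by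
  simp only [bandOp]
  refine tendsto_tsum_of_dominated_convergence hb (fun m => ?_) ?_
  · by_cases hm : n₁ ≤ n₂ + m
    · simp only [bandTerm, if_pos hm]
      exact tendsto_ofReal_smul (h m) _
    · simp only [bandTerm, if_neg hm]
      exact tendsto_const_nhds
  · filter_upwards [hc] with r hr m
    exact (norm_bandTerm_le n₁ n₂ _ m).trans (hr m)

theorem tendsto_hAB (hs : Tendsto s l (𝓝 s')) (ht : Tendsto t l (𝓝 t')) (n₁ n₂ m : ℕ) :
    Tendsto (fun r => hAB n₁ n₂ m (s r) (t r)) l (𝓝 (hAB n₁ n₂ m s' t')) := by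
  simp only [hAB]
  exact tendsto_finsetSum _ fun k _ => (tendsto_const_nhds.mul (hs.pow _)).mul (ht.pow _)

theorem tendsto_hC (hs : Tendsto s l (𝓝 s')) (ht : Tendsto t l (𝓝 t')) (n₁ n₂ m : ℕ) :
    Tendsto (fun r => hC n₁ n₂ m (s r) (t r)) l (𝓝 (hC n₁ n₂ m s' t')) := by
  simp only [hC]
  exact tendsto_finsetSum _ fun k _ => (tendsto_const_nhds.mul (hs.pow _)).mul (ht.pow _)

theorem tendsto_antiKraus (hg : Tendsto g l (𝓝 g')) (h₁ : Tendsto x₁ l (𝓝 x₁'))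
    (h₂ : Tendsto x₂ l (𝓝 x₂')) (hs : Tendsto s l (𝓝 s')) (ht : Tendsto t l (𝓝 t')) (n₁ n₂ : ℕ) :
    Tendsto (fun r => antiKraus (g r) (x₁ r) (x₂ r) (s r) (t r) n₁ n₂) l
      (𝓝 (antiKraus g' x₁' x₂' s' t' n₁ n₂)) := by
  have hc : Tendsto (fun r => g r * x₁ r ^ n₁ * x₂ r ^ n₂) l (𝓝 (g' * x₁' ^ n₁ * x₂' ^ n₂)) :=
    (hg.mul (h₁.pow n₁)).mul (h₂.pow n₂)
  exact tendsto_antiBandOp fun m => hc.mul (tendsto_hC hs ht n₁ n₂ m)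

/-- Dominated convergence over the band: since |t'| < 1, eventually |t r| ≤ (|t'| + 1)/2 < 1, so one
summable `bandBound` serves for all large r. -/
theorem tendsto_bandKraus (hg : Tendsto g l (𝓝 g'))
    (h₁ : Tendsto x₁ l (𝓝 x₁')) (h₂ : Tendsto x₂ l (𝓝 x₂')) (hs : Tendsto s l (𝓝 s'))
    (ht : Tendsto t l (𝓝 t')) (hs1 : ∀ r, |s r| ≤ 1) (ht1 : |t'| < 1) (n₁ n₂ : ℕ) :
    Tendsto (fun r => bandKraus (g r) (x₁ r) (x₂ r) (s r) (t r) n₁ n₂) l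
      (𝓝 (bandKraus g' x₁' x₂' s' t' n₁ n₂)) := by
  have hc : Tendsto (fun r => g r * x₁ r ^ n₁ * x₂ r ^ n₂) l (𝓝 (g' * x₁' ^ n₁ * x₂' ^ n₂)) :=
    (hg.mul (h₁.pow n₁)).mul (h₂.pow n₂)
  have h0 := abs_nonneg t'
  have hb := (summable_bandBound n₁ n₂ (τ := (|t'| + 1) / 2) (by linarith) (by linarith)).mul_left
    (|g' * x₁' ^ n₁ * x₂' ^ n₂| + 1)
  have e1 := hc.abs.eventually_le_const (lt_add_one |g' * x₁' ^ n₁ * x₂' ^ n₂|)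
  have e2 := ht.abs.eventually_le_const (show |t'| < (|t'| + 1) / 2 by linarith)
  refine tendsto_bandOp hb (fun m => hc.mul (tendsto_hAB hs ht n₁ n₂ m)) ?_
  filter_upwards [e1, e2] with r hr hr' m
  rw [abs_mul]
  exact mul_le_mul hr (abs_hAB_le (hs1 r) hr' (by linarith) n₁ n₂ m) (abs_nonneg _)
    (by positivity)

theorem tendsto_of_tendsto_sq {f : β → ℝ} {a : ℝ} (hf : ∀ᶠ r in l, 0 ≤ f r)
    (h : Tendsto (fun r => f r ^ 2) l (𝓝 a)) : Tendsto f l (𝓝 (Real.sqrt a)) := by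
  refine ((Real.continuous_sqrt.tendsto a).comp h).congr' ?_
  filter_upwards [hf] with r hr
  exact Real.sqrt_sq hr

end Limits

/-! ### Asymptotics of the parameters in the variable sech 2r -/

theorem mul_sqrt_eq {c : ℝ} (hc : 0 ≤ c) (x : ℝ) : c * Real.sqrt x = Real.sqrt (c ^ 2 * x) := by
  rw [Real.sqrt_mul (sq_nonneg c), Real.sqrt_sq hc]

/-- The inverse of `cosh 2r`. -/
def sechTwo (r : ℝ) : ℝ := (Real.cosh (2 * r))⁻¹

theorem tendsto_sechTwo : Tendsto sechTwo atTop (𝓝 0) := by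
  refine tendsto_inv_atTop_zero.comp ?_
  refine tendsto_atTop_mono' atTop ?_ (tendsto_id.const_mul_atTop (two_pos (α := ℝ)))
  filter_upwards [eventually_ge_atTop 0] with r hr
  exact (Real.self_le_sinh_iff.2 (by simpa using hr)).trans (Real.sinh_lt_cosh _).le

theorem cosh_mul_sechTwo (r : ℝ) : Real.cosh (2 * r) * sechTwo r = 1 :=
  mul_inv_cancel₀ (Real.cosh_pos _).ne'

theorem sinh_eq_cosh_mul {r : ℝ} (hr : 0 ≤ r) :
    Real.sinh (2 * r) = Real.cosh (2 * r) * Real.sqrt (1 - sechTwo r ^ 2) := by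
  have hc := Real.cosh_pos (2 * r)
  rw [← Real.sqrt_sq (Real.sinh_nonneg_iff.2 (by linarith : 0 ≤ 2 * r)), mul_sqrt_eq hc.le]
  congr 1
  linear_combination -Real.cosh_sq (2 * r) + (Real.cosh (2 * r) * sechTwo r + 1) *
    cosh_mul_sechTwo r

namespace ABParams

variable {κ α : ℝ}

/-- The function with `zAB κ α r = cosh 2r * zFun κ α (sech 2r)`. -/
def zFun (κ α y : ℝ) : ℝ := Real.sqrt ((α * y + κ ^ 2 + 1) ^ 2 - 4 * κ ^ 2 * (1 - y ^ 2))

theorem zAB_eq (κ α r : ℝ) : zAB κ α r = Real.cosh (2 * r) * zFun κ α (sechTwo r) := by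
  have hc := Real.cosh_pos (2 * r)
  rw [zFun, mul_sqrt_eq hc.le, zAB]
  congr 1
  have e := cosh_mul_sechTwo r
  generalize sechTwo r = y at *
  have e2 : α = α * (Real.cosh (2 * r) * y) := by rw [e, mul_one]
  have e3 : Real.sinh (2 * r) ^ 2 = Real.cosh (2 * r) ^ 2 - (Real.cosh (2 * r) * y) ^ 2 := by
    rw [e, Real.cosh_sq]
    ring
  nth_rw 1 [e2]
  rw [e3]
  ring

theorem zFun_zero (κ α : ℝ) : zFun κ α 0 = |κ ^ 2 - 1| := by
  rw [zFun, ← Real.sqrt_sq_eq_abs]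
  congr 1
  ring

/-- After dividing by cosh 2r every parameter is continuous in y = sech 2r near 0, where z becomes
|κ² - 1|. The absolute value lets one computation serve attenuator and amplifier; κ² ≠ 1 keeps the
limiting denominators nonzero. -/
theorem tendsto_params (h : ABParams κ α) (h1 : κ ^ 2 ≠ 1) :
    Tendsto (fun r => Real.sqrt (normFactor r (nuPlusAB κ α r) (nuMinusAB κ α r))) atTop
      (𝓝 (Real.sqrt (2 / (α + |κ ^ 2 - 1|)))) ∧
    Tendsto (fun r => xParam (nuPlusAB κ α r)) atTop
      (𝓝 (Real.sqrt ((α + κ ^ 2 - 1) / (α + |κ ^ 2 - 1|)))) ∧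
    Tendsto (fun r => xParam (nuMinusAB κ α r)) atTop
      (𝓝 (Real.sqrt ((α + 1 - κ ^ 2) / (α + |κ ^ 2 - 1|)))) ∧
    Tendsto (fun r => (Real.cosh (squeezeParam κ α r))⁻¹) atTop
      (𝓝 (Real.sqrt (2 * |κ ^ 2 - 1| / (κ ^ 2 + 1 + |κ ^ 2 - 1|)))) ∧
    Tendsto (fun r => Real.tanh (squeezeParam κ α r)) atTop
      (𝓝 (2 * κ / (κ ^ 2 + 1 + |κ ^ 2 - 1|))) := by
  have ha : 0 < |κ ^ 2 - 1| := abs_pos.2 (sub_ne_zero.2 h1)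
  have hα := h.nonneg
  have hz : Tendsto (fun r => zFun κ α (sechTwo r)) atTop (𝓝 |κ ^ 2 - 1|) := by
    rw [← zFun_zero κ α]
    refine (Continuous.tendsto ?_ 0).comp tendsto_sechTwo
    unfold zFun
    fun_prop
  have hy := tendsto_sechTwo
  have hd : Tendsto (fun r => α + (κ ^ 2 + 1) * sechTwo r + zFun κ α (sechTwo r)) atTop
      (𝓝 (α + |κ ^ 2 - 1|)) := by
    simpa using (tendsto_const_nhds.add (hy.const_mul (κ ^ 2 + 1))).add hz
  have hd' : Tendsto (fun r => α * sechTwo r + κ ^ 2 + 1 + zFun κ α (sechTwo r)) atTop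
      (𝓝 (κ ^ 2 + 1 + |κ ^ 2 - 1|)) := by
    simpa using (((hy.const_mul α).add_const (κ ^ 2)).add_const 1).add hz
  have hd0 : α + |κ ^ 2 - 1| ≠ 0 := by positivity
  have hd0' : κ ^ 2 + 1 + |κ ^ 2 - 1| ≠ 0 := by positivity
  have e1 : ∀ r, α * Real.cosh (2 * r) + κ ^ 2 + 1 + zAB κ α r
      = Real.cosh (2 * r) * (α + (κ ^ 2 + 1) * sechTwo r + zFun κ α (sechTwo r)) := fun r => by
    rw [zAB_eq]
    linear_combination -(κ ^ 2 + 1) * cosh_mul_sechTwo r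
  have e2 : ∀ r, α + (κ ^ 2 + 1) * Real.cosh (2 * r) + zAB κ α r
      = Real.cosh (2 * r) * (α * sechTwo r + κ ^ 2 + 1 + zFun κ α (sechTwo r)) := fun r => by
    rw [zAB_eq]
    linear_combination -α * cosh_mul_sechTwo r
  have e3 : ∀ r, Real.cosh (2 * r) + 1 = Real.cosh (2 * r) * (1 + sechTwo r) := fun r => by
    linear_combination -cosh_mul_sechTwo r
  have e4 : ∀ r, Real.cosh (2 * r) - 1 = Real.cosh (2 * r) * (1 - sechTwo r) := fun r => by
    linear_combination cosh_mul_sechTwo r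
  have hc : ∀ r, Real.cosh (2 * r) ≠ 0 := fun r => (Real.cosh_pos _).ne'
  have hy1 : Tendsto (fun r => 1 + sechTwo r) atTop (𝓝 1) := by simpa using hy.const_add 1
  have hy2 : Tendsto (fun r => 1 - sechTwo r) atTop (𝓝 1) := by simpa using hy.const_sub 1
  refine ⟨?_, ?_, ?_, ?_, ?_⟩
  · refine (Real.continuous_sqrt.tendsto _).comp ?_
    simp_rw [h.normFactor_eq, e1, e3, mul_left_comm (2 : ℝ), mul_div_mul_left _ _ (hc _)]
    simpa using (hy1.const_mul 2).fun_div hd hd0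
  · refine tendsto_of_tendsto_sq (Eventually.of_forall fun r => xParam_nonneg _) ?_
    simp_rw [h.xParam_nuPlus_sq, e1, e3, mul_assoc, mul_div_mul_left _ _ (hc _)]
    simpa using (hy1.mul_const (α + κ ^ 2 - 1)).fun_div hd hd0
  · refine tendsto_of_tendsto_sq (Eventually.of_forall fun r => xParam_nonneg _) ?_
    simp_rw [h.xParam_nuMinus_sq, e1, e4, mul_assoc, mul_div_mul_left _ _ (hc _)]
    simpa using (hy2.mul_const (α + 1 - κ ^ 2)).fun_div hd hd0
  · refine tendsto_of_tendsto_sq (Eventually.of_forall fun r =>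
      (inv_pos.2 (Real.cosh_pos _)).le) ?_
    simp_rw [h.sech_sq, e2, zAB_eq, mul_left_comm (2 : ℝ), mul_div_mul_left _ _ (hc _)]
    exact (hz.const_mul 2).fun_div hd' hd0'
  · have h3 : Tendsto (fun r => 2 * κ * Real.sqrt (1 - sechTwo r ^ 2)
        / (α * sechTwo r + κ ^ 2 + 1 + zFun κ α (sechTwo r))) atTop
        (𝓝 (2 * κ / (κ ^ 2 + 1 + |κ ^ 2 - 1|))) := by
      have h4 := ((((Real.continuous_sqrt.tendsto _).comp ((hy.pow 2).const_sub 1)).const_mul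
        (2 * κ)).fun_div hd' hd0')
      simpa using h4
    refine h3.congr' ?_
    filter_upwards [eventually_ge_atTop 0] with r hr
    rw [h.tanh_squeezeParam, e2, sinh_eq_cosh_mul hr, mul_left_comm, mul_div_mul_left _ _ (hc _)]

end ABParams

namespace ConjParams

variable {κ α : ℝ}

/-- The function with `zC κ α r = cosh 2r * zFun κ α (sech 2r)`. -/
def zFun (κ α y : ℝ) : ℝ := Real.sqrt ((α * y + κ ^ 2 - 1) ^ 2 + 4 * κ ^ 2 * (1 - y ^ 2))

theorem zC_eq (κ α r : ℝ) : zC κ α r = Real.cosh (2 * r) * zFun κ α (sechTwo r) := by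
  have hc := Real.cosh_pos (2 * r)
  rw [zFun, mul_sqrt_eq hc.le, zC]
  congr 1
  have e := cosh_mul_sechTwo r
  generalize sechTwo r = y at *
  have e2 : α = α * (Real.cosh (2 * r) * y) := by rw [e, mul_one]
  have e3 : Real.sinh (2 * r) ^ 2 = Real.cosh (2 * r) ^ 2 - (Real.cosh (2 * r) * y) ^ 2 := by
    rw [e, Real.cosh_sq]
    ring
  nth_rw 1 [e2]
  rw [e3]
  ring

theorem zFun_zero (κ α : ℝ) : zFun κ α 0 = κ ^ 2 + 1 := by
  rw [zFun, ← Real.sqrt_sq (show 0 ≤ κ ^ 2 + 1 by positivity)]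
  congr 1
  ring

/-- The weights are recovered from the sum and difference of their squares, and sin θ, cos θ from
cos 2θ, which tends to (κ² - 1)/(κ² + 1). The signs come from θ lying between -π/2 and 0. -/
theorem tendsto_params (h : ConjParams κ α) :
    Tendsto (fun r => Real.sqrt (normFactor r (nuPlusC κ α r) (nuMinusC κ α r))) atTop
      (𝓝 (Real.sqrt (2 / (α + κ ^ 2 + 1)))) ∧
    Tendsto (fun r => xParam (nuPlusC κ α r)) atTop (𝓝 1) ∧
    Tendsto (fun r => xParam (nuMinusC κ α r)) atTop
      (𝓝 (Real.sqrt ((α - κ ^ 2 - 1) / (α + κ ^ 2 + 1)))) ∧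
    Tendsto (fun r => Real.sin (splitAngle κ α r)) atTop (𝓝 (-1 / Real.sqrt (1 + κ ^ 2))) ∧
    Tendsto (fun r => Real.cos (splitAngle κ α r)) atTop (𝓝 (κ / Real.sqrt (1 + κ ^ 2))) := by
  have hκ := h.pos
  have hΔ := h.denom_pos
  have hy := tendsto_sechTwo
  have hc : ∀ r, Real.cosh (2 * r) ≠ 0 := fun r => (Real.cosh_pos _).ne'
  have hz : Tendsto (fun r => zFun κ α (sechTwo r)) atTop (𝓝 (κ ^ 2 + 1)) := by
    rw [← zFun_zero κ α]
    refine (Continuous.tendsto ?_ 0).comp tendsto_sechTwo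
    unfold zFun
    fun_prop
  have hd : Tendsto (fun r => (1 + sechTwo r) * (α + κ ^ 2 + 1)) atTop (𝓝 (α + κ ^ 2 + 1)) := by
    simpa using (hy.const_add 1).mul_const (α + κ ^ 2 + 1)
  have e1 : ∀ r, (Real.cosh (2 * r) + 1) * (α + κ ^ 2 + 1)
      = Real.cosh (2 * r) * ((1 + sechTwo r) * (α + κ ^ 2 + 1)) := fun r => by
    linear_combination -(α + κ ^ 2 + 1) * cosh_mul_sechTwo r
  have e2 : ∀ r, α * Real.cosh (2 * r) + κ ^ 2 - 1
      = Real.cosh (2 * r) * (α + (κ ^ 2 - 1) * sechTwo r) := fun r => by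
    linear_combination -(κ ^ 2 - 1) * cosh_mul_sechTwo r
  have e3 : ∀ r, κ ^ 2 * Real.cosh (2 * r) + α - Real.cosh (2 * r)
      = Real.cosh (2 * r) * (κ ^ 2 - 1 + α * sechTwo r) := fun r => by
    linear_combination -α * cosh_mul_sechTwo r
  have h1 : Tendsto (fun r => xParam (nuPlusC κ α r) ^ 2 + xParam (nuMinusC κ α r) ^ 2) atTop
      (𝓝 (2 * α / (α + κ ^ 2 + 1))) := by
    simp_rw [fun r => (h.xParam_sq_add r).1, e1, e2, mul_left_comm (2 : ℝ),
      mul_div_mul_left _ _ (hc _)]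
    simpa using (((hy.const_mul (κ ^ 2 - 1)).const_add α).const_mul 2).fun_div hd hΔ.ne'
  have h2 : Tendsto (fun r => xParam (nuPlusC κ α r) ^ 2 - xParam (nuMinusC κ α r) ^ 2) atTop
      (𝓝 (2 * (κ ^ 2 + 1) / (α + κ ^ 2 + 1))) := by
    simp_rw [fun r => (h.xParam_sq_add r).2, e1, zC_eq, mul_left_comm (2 : ℝ),
      mul_div_mul_left _ _ (hc _)]
    exact (hz.const_mul 2).fun_div hd hΔ.ne'
  have h3 : Tendsto (fun r => Real.cos (2 * splitAngle κ α r)) atTop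
      (𝓝 ((κ ^ 2 - 1) / (κ ^ 2 + 1))) := by
    have e4 : ∀ r, Real.cos (2 * splitAngle κ α r)
        = (κ ^ 2 - 1 + α * sechTwo r) / zFun κ α (sechTwo r) := fun r => by
      have e5 := (arg_mul κ α r).1
      have e6 := (h.zC_pos r).ne'
      rw [e3, zC_eq, mul_assoc] at e5
      rw [zC_eq] at e6
      rw [eq_div_iff (right_ne_zero_of_mul e6), mul_comm]
      exact mul_left_cancel₀ (hc r) e5
    simp_rw [e4]
    simpa using ((hy.const_mul α).const_add (κ ^ 2 - 1)).fun_div hz (by positivity)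
  have hs : Real.sqrt (1 + κ ^ 2) ^ 2 = 1 + κ ^ 2 := Real.sq_sqrt (by positivity)
  refine ⟨?_, ?_, ?_, ?_, ?_⟩
  · simp_rw [h.normFactor_eq]
    exact tendsto_const_nhds
  · have h4 := tendsto_of_tendsto_sq (Eventually.of_forall fun r => xParam_nonneg (nuPlusC κ α r))
      (((h1.add h2).div_const 2).congr fun r => by ring)
    convert h4 using 2
    rw [eq_comm, Real.sqrt_eq_one]
    field_simp
    ring
  · have h4 := tendsto_of_tendsto_sq (Eventually.of_forall fun r => xParam_nonneg (nuMinusC κ α r))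
      (((h1.sub h2).div_const 2).congr fun r => by ring)
    convert h4 using 3
    field_simp
    ring
  · have h4 := (tendsto_of_tendsto_sq (f := fun r => -Real.sin (splitAngle κ α r))
      (l := atTop) (a := 1 / (1 + κ ^ 2)) ?_ ?_).neg
    · simp only [neg_neg] at h4
      convert h4 using 2
      rw [Real.sqrt_div zero_le_one, Real.sqrt_one, neg_div]
    · filter_upwards [eventually_gt_atTop 0] with r hr
      -- For r > 0 the defining complex number has negative imaginary part, so its argument is
      -- negative; this selects the negative root for sin θ.
      have h5 : splitAngle κ α r < 0 := by
        rw [splitAngle]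
        refine div_neg_of_neg_of_pos (Complex.arg_neg_iff.2 ?_) two_pos
        have := Real.sinh_pos_iff.2 (by linarith : 0 < 2 * r)
        simp only [neg_lt_zero]
        positivity
      have h6 := (splitAngle_mem κ α r).1
      exact neg_nonneg.2 (Real.sin_nonpos_of_nonpos_of_neg_pi_le h5.le
        (by linarith [Real.pi_pos]))
    · have h5 := (h3.const_sub 1).div_const 2
      have e5 : (1 - (κ ^ 2 - 1) / (κ ^ 2 + 1)) / 2 = 1 / (1 + κ ^ 2) := by
        field_simp
        ring
      rw [e5] at h5
      refine h5.congr fun r => ?_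
      rw [Real.cos_two_mul, neg_sq, Real.sin_sq]
      ring
  · have h4 := tendsto_of_tendsto_sq (Eventually.of_forall fun r =>
      Real.cos_nonneg_of_mem_Icc ⟨(splitAngle_mem κ α r).1.le, (splitAngle_mem κ α r).2⟩)
      (((h3.const_add 1).div_const 2).congr fun r => by
        rw [Real.cos_two_mul]
        ring)
    convert h4 using 2
    rw [eq_comm, Real.sqrt_eq_iff_mul_self_eq_of_pos (by positivity), ← sq, div_pow, hs]
    field_simp
    ring

end ConjParams

/-! ### The Kraus operators of the three channels -/

theorem bandKraus_eq_smul {g x₁ x₂ s t : ℝ} (hs : |s| ≤ 1) (ht : |t| < 1) (n₁ n₂ : ℕ) :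
    bandKraus g x₁ x₂ s t n₁ n₂
      = ((g * x₁ ^ n₁ * x₂ ^ n₂ : ℝ) : ℂ) • bandKraus 1 1 1 s t n₁ n₂ := by
  ext ψ i
  rw [_root_.smul_apply, lp.coeFn_smul, Pi.smul_apply, bandKraus_apply hs ht,
    bandKraus_apply hs ht, smul_eq_mul, ← mul_assoc, ← Complex.ofReal_mul]
  simp only [one_pow, one_mul]

theorem antiKraus_eq_smul (g x₁ x₂ s c : ℝ) (n₁ n₂ : ℕ) :
    antiKraus g x₁ x₂ s c n₁ n₂
      = ((g * x₁ ^ n₁ * x₂ ^ n₂ : ℝ) : ℂ) • antiKraus 1 1 1 s c n₁ n₂ := by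
  simp only [antiKraus, antiBandOp, Finset.smul_sum, smul_smul, one_pow, one_mul,
    Complex.ofReal_mul]

theorem bandOp_gammaAB (κ α r : ℝ) (n₁ n₂ : ℕ) :
    bandOp n₁ n₂ (gammaAB κ α r n₁ n₂)
      = bandKraus (Real.sqrt (normFactor r (nuPlusAB κ α r) (nuMinusAB κ α r)))
          (xParam (nuPlusAB κ α r)) (xParam (nuMinusAB κ α r))
          (Real.cosh (squeezeParam κ α r))⁻¹ (Real.tanh (squeezeParam κ α r)) n₁ n₂ := rfl

theorem antiBandOp_gammaC (κ α r : ℝ) (n₁ n₂ : ℕ) :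
    antiBandOp n₁ n₂ (gammaC κ α r n₁ n₂)
      = antiKraus (Real.sqrt (normFactor r (nuPlusC κ α r) (nuMinusC κ α r)))
          (xParam (nuPlusC κ α r)) (xParam (nuMinusC κ α r))
          (Real.sin (splitAngle κ α r)) (Real.cos (splitAngle κ α r)) n₁ n₂ := rfl

theorem bandOp_gammaAtt (κ α : ℝ) (n₁ n₂ : ℕ) :
    bandOp n₁ n₂ (gammaAtt κ α n₁ n₂)
      = bandKraus (Real.sqrt (2 / (α + 1 - κ ^ 2)))
          (Real.sqrt ((α + κ ^ 2 - 1) / (α + 1 - κ ^ 2))) 1 (Real.sqrt (1 - κ ^ 2)) κ n₁ n₂ := by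
  rw [bandKraus]
  congr 1
  funext m
  rw [gammaAtt, one_pow, mul_one]

theorem bandOp_gammaAmp (κ α : ℝ) (n₁ n₂ : ℕ) :
    bandOp n₁ n₂ (gammaAmp κ α n₁ n₂)
      = bandKraus (Real.sqrt (2 / (α + κ ^ 2 - 1))) 1
          (Real.sqrt ((α - κ ^ 2 + 1) / (α + κ ^ 2 - 1))) (Real.sqrt (κ ^ 2 - 1) / κ) (1 / κ)
          n₁ n₂ := by
  rw [bandKraus]
  congr 1
  funext m
  rw [gammaAmp, one_pow, mul_one]

theorem antiBandOp_gammaConj (κ α : ℝ) (n₁ n₂ : ℕ) :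
    antiBandOp n₁ n₂ (gammaConj κ α n₁ n₂)
      = antiKraus (Real.sqrt (2 / (α + κ ^ 2 + 1))) 1
          (Real.sqrt ((α - κ ^ 2 - 1) / (α + κ ^ 2 + 1))) (-1 / Real.sqrt (1 + κ ^ 2))
          (κ / Real.sqrt (1 + κ ^ 2)) n₁ n₂ := by
  rw [antiKraus]
  congr 1
  funext m
  rw [gammaConj, one_pow, mul_one]

theorem summable_gammaAB (κ α r : ℝ) (n₁ n₂ : ℕ) :
    Summable (bandTerm n₁ n₂ (gammaAB κ α r n₁ n₂)) :=
  summable_bandTerm_hAB (abs_sech_le _) (Real.abs_tanh_lt_one _) _ n₁ n₂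

theorem ABParams.hasFockChoiDecomposition {κ α : ℝ} (h : ABParams κ α)
    {Φ : traceClass →ₗ[ℂ] traceClass} {K : ℕ → ℕ → Mode →L[ℂ] Mode}
    (hΦ : IsKrausRepresentation Φ K)
    (hΦ' : ∀ (ρ : traceClass) (x y : Mode),
      HasSum (fun n : ℕ × ℕ => inner ℂ (adjoint (K n.1 n.2) x)
        ((ρ : Mode →L[ℂ] Mode) (adjoint (K n.1 n.2) y)))
        (inner ℂ x ((Φ ρ : Mode →L[ℂ] Mode) y)))
    (hK : ∀ u v w z : ℂ, HasSum (fun n : ℕ × ℕ =>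
        starRingEnd ℂ (inner ℂ (expVec v) (K n.1 n.2 (expVec w)))
          * inner ℂ (expVec u) (K n.1 n.2 (expVec z)))
        (gaussKernel (2 / (α + κ ^ 2 + 1)) ((α + κ ^ 2 - 1) / (α + κ ^ 2 + 1))
          ((α + 1 - κ ^ 2) / (α + κ ^ 2 + 1)) (2 * κ / (α + κ ^ 2 + 1)) u v w z)) (r : ℝ) :
    HasFockChoiDecomposition Φ r (squeezeMatrix (squeezeParam κ α r))
      (nuPlusAB κ α r) (nuMinusAB κ α r)
      (fun n₁ n₂ => bandOp n₁ n₂ (gammaAB κ α r n₁ n₂)) := by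
  simp only [bandOp_gammaAB]
  obtain ⟨U, hU, hU'⟩ := exists_twoModeSqueezer (squeezeParam κ α r)
  exact hasFockChoiDecomposition_of_kernel hΦ hΦ' hK (h.hasSum_kernel r) hU hU'
    (h.one_le_nuPlus r) (h.one_le_nuMinus r)
    fun n₁ n₂ => bandKraus_eq_smul (abs_sech_le _) (Real.abs_tanh_lt_one _) n₁ n₂

theorem ConjParams.hasFockChoiDecomposition {κ α : ℝ} (h : ConjParams κ α)
    {Φ : traceClass →ₗ[ℂ] traceClass} {K : ℕ → ℕ → Mode →L[ℂ] Mode}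
    (hΦ : IsKrausRepresentation Φ K)
    (hΦ' : ∀ (ρ : traceClass) (x y : Mode),
      HasSum (fun n : ℕ × ℕ => inner ℂ (adjoint (K n.1 n.2) x)
        ((ρ : Mode →L[ℂ] Mode) (adjoint (K n.1 n.2) y)))
        (inner ℂ x ((Φ ρ : Mode →L[ℂ] Mode) y)))
    (hK : ∀ u v w z : ℂ, HasSum (fun n : ℕ × ℕ =>
        starRingEnd ℂ (inner ℂ (expVec v) (K n.1 n.2 (expVec w)))
          * inner ℂ (expVec u) (K n.1 n.2 (expVec z)))
        (conjKernel (2 / (α + κ ^ 2 + 1)) ((α + κ ^ 2 - 1) / (α + κ ^ 2 + 1))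
          ((α + 1 - κ ^ 2) / (α + κ ^ 2 + 1)) (2 * κ / (α + κ ^ 2 + 1)) u v w z)) (r : ℝ) :
    HasFockChoiDecomposition Φ r (beamSplitterMatrix (splitAngle κ α r))
      (nuPlusC κ α r) (nuMinusC κ α r)
      (fun n₁ n₂ => antiBandOp n₁ n₂ (gammaC κ α r n₁ n₂)) := by
  simp only [antiBandOp_gammaC]
  obtain ⟨U, hU, hU'⟩ := exists_beamSplitter (splitAngle κ α r)
  exact hasFockChoiDecomposition_of_kernel hΦ hΦ' hK (h.hasSum_kernel r) hU hU'
    (h.one_le_nu r).1 (h.one_le_nu r).2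
    fun n₁ n₂ => antiKraus_eq_smul _ _ _ _ _ n₁ n₂

/-! ### The three families of channels -/

theorem attenuator {κ α : ℝ} (h0 : 0 < κ) (h1 : κ < 1) (h2 : 1 - κ ^ 2 ≤ α) :
    ∃ Φ : traceClass →ₗ[ℂ] traceClass,
      (∀ Ψ, IsGaussianChannel (κ • 1) (α • 1) Ψ ↔ Ψ = Φ) ∧
      (∀ n₁ n₂, Summable (bandTerm n₁ n₂ (gammaAtt κ α n₁ n₂))) ∧
      IsKrausRepresentation Φ (fun n₁ n₂ => bandOp n₁ n₂ (gammaAtt κ α n₁ n₂)) ∧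
      (∀ r : ℝ, 0 ≤ r →
        (∀ n₁ n₂, Summable (bandTerm n₁ n₂ (gammaAB κ α r n₁ n₂))) ∧
        HasFockChoiDecomposition Φ r (squeezeMatrix (squeezeParam κ α r))
          (nuPlusAB κ α r) (nuMinusAB κ α r)
          (fun n₁ n₂ => bandOp n₁ n₂ (gammaAB κ α r n₁ n₂))) ∧
      (∀ n₁ n₂, Tendsto (fun r => bandOp n₁ n₂ (gammaAB κ α r n₁ n₂)) atTop
        (𝓝 (bandOp n₁ n₂ (gammaAtt κ α n₁ n₂)))) := by
  have hk : κ ^ 2 < 1 := by nlinarith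
  have hk0 : 0 < κ ^ 2 := by positivity
  have h : ABParams κ α := ⟨h0, h2, by linarith⟩
  have hd : 0 < α + 1 - κ ^ 2 := by linarith
  have hD : 0 < α + κ ^ 2 + 1 := by linarith
  have hg := Real.sq_sqrt (show 0 ≤ 2 / (α + 1 - κ ^ 2) by positivity)
  have hx := Real.sq_sqrt (show 0 ≤ (α + κ ^ 2 - 1) / (α + 1 - κ ^ 2) from
    div_nonneg (by linarith) hd.le)
  have hs := Real.sq_sqrt (show 0 ≤ 1 - κ ^ 2 by linarith)
  have hs1 : |Real.sqrt (1 - κ ^ 2)| ≤ 1 := by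
    rw [abs_of_nonneg (Real.sqrt_nonneg _), Real.sqrt_le_one]
    linarith
  have ht1 : |κ| < 1 := by rwa [abs_of_pos h0]
  obtain ⟨Φ, hΦ, hΦK, hΦ'⟩ := exists_isGaussianChannel_smul_one
    (hasSum_attenuator (κ := κ) hk h2 hg hx hs)
  have hL : 1 - (α + κ ^ 2 - 1) / (α + 1 - κ ^ 2) * κ ^ 2
      = (1 - κ ^ 2) * (α + κ ^ 2 + 1) / (α + 1 - κ ^ 2) := by
    field_simp
    ring
  have hL0 : 0 < (1 - κ ^ 2) * (α + κ ^ 2 + 1) / (α + 1 - κ ^ 2) :=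
    div_pos (mul_pos (by linarith) hD) hd
  have hK := hasSum_bandKraus_gaussKernel (g := Real.sqrt (2 / (α + 1 - κ ^ 2)))
    (x₁ := Real.sqrt ((α + κ ^ 2 - 1) / (α + 1 - κ ^ 2))) (x₂ := 1)
    (s := Real.sqrt (1 - κ ^ 2)) (t := κ)
    (C := 2 / (α + κ ^ 2 + 1)) (A := (α + κ ^ 2 - 1) / (α + κ ^ 2 + 1))
    (B := (α + 1 - κ ^ 2) / (α + κ ^ 2 + 1)) (D := 2 * κ / (α + κ ^ 2 + 1)) hs1 ht1
    (by rw [hx, one_pow, one_mul]; linarith)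
    (by rw [hx, hg, hs, one_pow, one_mul, hL]; field_simp)
    (by rw [hx, hs, one_pow, one_mul, hL]; field_simp)
    (by rw [hx, hs, one_pow, one_mul, hL]; field_simp)
    (by rw [hx, hs, one_pow, one_mul, hL]; field_simp; ring)
  refine ⟨Φ, hΦ.iff_eq, fun n₁ n₂ => summable_bandTerm_hAB hs1 ht1 _ n₁ n₂, ?_,
    fun r _ => ⟨summable_gammaAB κ α r, h.hasFockChoiDecomposition hΦK hΦ' hK r⟩, ?_⟩
  · simp only [bandOp_gammaAtt]
    exact hΦK
  · intro n₁ n₂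
    simp only [bandOp_gammaAtt, bandOp_gammaAB]
    obtain ⟨l1, l2, l3, l4, l5⟩ := h.tendsto_params hk.ne
    rw [abs_of_neg (by linarith : κ ^ 2 - 1 < 0)] at l1 l2 l3 l4 l5
    refine tendsto_bandKraus ?_ ?_ ?_ ?_ ?_ (fun r => abs_sech_le _) ht1 n₁ n₂
    · convert l1 using 4
      ring
    · convert l2 using 4
      ring
    -- For κ < 1 the limit of x₋ is 1, so no power with exponent n₂ survives in the limiting
    -- coefficients.
    · convert l3 using 2
      rw [eq_comm, Real.sqrt_eq_one, div_eq_one_iff_eq (by linarith)]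
      ring
    · convert l4 using 3
      ring
    · convert l5 using 2
      ring

theorem amplifier {κ α : ℝ} (h1 : 1 < κ) (h2 : κ ^ 2 - 1 ≤ α) :
    ∃ Φ : traceClass →ₗ[ℂ] traceClass,
      (∀ Ψ, IsGaussianChannel (κ • 1) (α • 1) Ψ ↔ Ψ = Φ) ∧
      (∀ n₁ n₂, Summable (bandTerm n₁ n₂ (gammaAmp κ α n₁ n₂))) ∧
      IsKrausRepresentation Φ (fun n₁ n₂ => bandOp n₁ n₂ (gammaAmp κ α n₁ n₂)) ∧
      (∀ r : ℝ, 0 ≤ r →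
        (∀ n₁ n₂, Summable (bandTerm n₁ n₂ (gammaAB κ α r n₁ n₂))) ∧
        HasFockChoiDecomposition Φ r (squeezeMatrix (squeezeParam κ α r))
          (nuPlusAB κ α r) (nuMinusAB κ α r)
          (fun n₁ n₂ => bandOp n₁ n₂ (gammaAB κ α r n₁ n₂))) ∧
      (∀ n₁ n₂, Tendsto (fun r => bandOp n₁ n₂ (gammaAB κ α r n₁ n₂)) atTop
        (𝓝 (bandOp n₁ n₂ (gammaAmp κ α n₁ n₂)))) := by
  have h0 : 0 < κ := by linarith
  have hk : 1 < κ ^ 2 := by nlinarith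
  have h : ABParams κ α := ⟨h0, by linarith, h2⟩
  have hd : 0 < α + κ ^ 2 - 1 := by linarith
  have hD : 0 < α + κ ^ 2 + 1 := by linarith
  have hg := Real.sq_sqrt (show 0 ≤ 2 / (α + κ ^ 2 - 1) by positivity)
  have hx := Real.sq_sqrt (show 0 ≤ (α - κ ^ 2 + 1) / (α + κ ^ 2 - 1) from
    div_nonneg (by linarith) hd.le)
  have ht : 1 / κ * κ = 1 := one_div_mul_cancel h0.ne'
  have hs : (Real.sqrt (κ ^ 2 - 1) / κ) ^ 2 = 1 - (1 / κ) ^ 2 := by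
    rw [div_pow, Real.sq_sqrt (by linarith)]
    field_simp
  have hs1 : |Real.sqrt (κ ^ 2 - 1) / κ| ≤ 1 := by
    rw [abs_le_one_iff_mul_self_le_one, ← sq, hs]
    linarith [sq_nonneg (1 / κ)]
  have ht1 : |1 / κ| < 1 := by rwa [abs_of_pos (by positivity), div_lt_one h0]
  obtain ⟨Φ, hΦ, hΦK, hΦ'⟩ := exists_isGaussianChannel_smul_one
    (hasSum_amplifier h0 hk h2 hg hx ht hs)
  have hL : 1 - (α - κ ^ 2 + 1) / (α + κ ^ 2 - 1) * (1 / κ) ^ 2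
      = (κ ^ 2 - 1) * (α + κ ^ 2 + 1) / ((α + κ ^ 2 - 1) * κ ^ 2) := by
    field_simp
    ring
  have hL0 : 0 < (κ ^ 2 - 1) * (α + κ ^ 2 + 1) / ((α + κ ^ 2 - 1) * κ ^ 2) :=
    div_pos (mul_pos (by linarith) hD) (by positivity)
  have hK := hasSum_bandKraus_gaussKernel (g := Real.sqrt (2 / (α + κ ^ 2 - 1))) (x₁ := 1)
    (x₂ := Real.sqrt ((α - κ ^ 2 + 1) / (α + κ ^ 2 - 1)))
    (s := Real.sqrt (κ ^ 2 - 1) / κ) (t := 1 / κ)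
    (C := 2 / (α + κ ^ 2 + 1)) (A := (α + κ ^ 2 - 1) / (α + κ ^ 2 + 1))
    (B := (α + 1 - κ ^ 2) / (α + κ ^ 2 + 1)) (D := 2 * κ / (α + κ ^ 2 + 1)) hs1 ht1
    (by rw [hx, one_pow, one_mul]; linarith)
    (by rw [hx, hg, hs, one_pow, one_mul, hL]; field_simp)
    (by rw [hx, hs, one_pow, one_mul, hL]; field_simp)
    (by rw [hx, hs, one_pow, one_mul, hL]; field_simp; ring)
    (by rw [hx, hs, one_pow, one_mul, hL]; field_simp; ring)
  refine ⟨Φ, hΦ.iff_eq, fun n₁ n₂ => summable_bandTerm_hAB hs1 ht1 _ n₁ n₂, ?_,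
    fun r _ => ⟨summable_gammaAB κ α r, h.hasFockChoiDecomposition hΦK hΦ' hK r⟩, ?_⟩
  · simp only [bandOp_gammaAmp]
    exact hΦK
  · intro n₁ n₂
    simp only [bandOp_gammaAmp, bandOp_gammaAB]
    obtain ⟨l1, l2, l3, l4, l5⟩ := h.tendsto_params hk.ne'
    rw [abs_of_pos (by linarith : 0 < κ ^ 2 - 1)] at l1 l2 l3 l4 l5
    refine tendsto_bandKraus ?_ ?_ ?_ ?_ ?_ (fun r => abs_sech_le _) ht1 n₁ n₂
    · convert l1 using 4
      ring
    -- For κ > 1 it is x₊ that tends to 1, and the power with exponent n₁ drops out.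
    · convert l2 using 2
      rw [eq_comm, Real.sqrt_eq_one, div_eq_one_iff_eq (by linarith)]
      ring
    · convert l3 using 3
      congr 1 <;> ring
    · convert l4 using 2
      rw [eq_comm, ← Real.sqrt_sq (div_nonneg (Real.sqrt_nonneg (κ ^ 2 - 1)) h0.le), hs]
      congr 1
      field_simp
      ring
    · convert l5 using 2
      field_simp
      ring

theorem phaseConjugation {κ α : ℝ} (h0 : 0 < κ) (h2 : κ ^ 2 + 1 ≤ α) :
    ∃ Φ : traceClass →ₗ[ℂ] traceClass,
      (∀ Ψ, IsGaussianChannel (κ • pauli₃) (α • 1) Ψ ↔ Ψ = Φ) ∧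
      IsKrausRepresentation Φ (fun n₁ n₂ => antiBandOp n₁ n₂ (gammaConj κ α n₁ n₂)) ∧
      (∀ r : ℝ, 0 ≤ r →
        HasFockChoiDecomposition Φ r (beamSplitterMatrix (splitAngle κ α r))
          (nuPlusC κ α r) (nuMinusC κ α r)
          (fun n₁ n₂ => antiBandOp n₁ n₂ (gammaC κ α r n₁ n₂))) ∧
      (∀ n₁ n₂, Tendsto (fun r => antiBandOp n₁ n₂ (gammaC κ α r n₁ n₂)) atTop
        (𝓝 (antiBandOp n₁ n₂ (gammaConj κ α n₁ n₂)))) := by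
  have h : ConjParams κ α := ⟨h0, h2⟩
  have hd : 0 < α + κ ^ 2 + 1 := h.denom_pos
  have hg := Real.sq_sqrt (show 0 ≤ 2 / (α + κ ^ 2 + 1) by positivity)
  have hx := Real.sq_sqrt (show 0 ≤ (α - κ ^ 2 - 1) / (α + κ ^ 2 + 1) from
    div_nonneg (by linarith) hd.le)
  have hr : Real.sqrt (1 + κ ^ 2) ^ 2 = 1 + κ ^ 2 := Real.sq_sqrt (by positivity)
  have hs : (-1 / Real.sqrt (1 + κ ^ 2)) ^ 2 = 1 / (1 + κ ^ 2) := by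
    rw [div_pow, hr, neg_one_sq]
  have hc : (κ / Real.sqrt (1 + κ ^ 2)) ^ 2 = κ ^ 2 / (1 + κ ^ 2) := by rw [div_pow, hr]
  have hsc : -1 / Real.sqrt (1 + κ ^ 2) * (κ / Real.sqrt (1 + κ ^ 2)) = -κ / (1 + κ ^ 2) := by
    rw [div_mul_div_comm, ← sq, hr, neg_one_mul]
  have hA : (α + κ ^ 2 - 1) / (α + κ ^ 2 + 1)
      = κ ^ 2 / (1 + κ ^ 2) + (α - κ ^ 2 - 1) / (α + κ ^ 2 + 1) * (1 / (1 + κ ^ 2)) := by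
    field_simp
    ring
  have hB : (α + 1 - κ ^ 2) / (α + κ ^ 2 + 1)
      = 1 / (1 + κ ^ 2) + (α - κ ^ 2 - 1) / (α + κ ^ 2 + 1) * (κ ^ 2 / (1 + κ ^ 2)) := by
    field_simp
    ring
  have hD : 2 * κ / (α + κ ^ 2 + 1)
      = -κ / (1 + κ ^ 2) * ((α - κ ^ 2 - 1) / (α + κ ^ 2 + 1) - 1) := by
    field_simp
    ring
  obtain ⟨Φ, hΦ, hΦK, hΦ'⟩ := exists_isGaussianChannel_smul_pauli₃
    (hasSum_conj (x := Real.sqrt ((α - κ ^ 2 - 1) / (α + κ ^ 2 + 1)))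
      (s := -1 / Real.sqrt (1 + κ ^ 2)) (c := κ / Real.sqrt (1 + κ ^ 2)) hd hg
      (by rw [hx, hs, hc, hA]) (by rw [hx, hs, hc, hB])
      (by rw [hx, mul_comm (κ / _), hsc, hD]))
  have hK := hasSum_antiKraus_conjKernel (g := Real.sqrt (2 / (α + κ ^ 2 + 1))) (x₁ := 1)
    (x₂ := Real.sqrt ((α - κ ^ 2 - 1) / (α + κ ^ 2 + 1))) (s := -1 / Real.sqrt (1 + κ ^ 2))
    (c := κ / Real.sqrt (1 + κ ^ 2)) (C := 2 / (α + κ ^ 2 + 1))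
    (A := (α + κ ^ 2 - 1) / (α + κ ^ 2 + 1)) (B := (α + 1 - κ ^ 2) / (α + κ ^ 2 + 1))
    (D := 2 * κ / (α + κ ^ 2 + 1)) hg.symm (by rw [hx, hs, hc, hA]; ring)
    (by rw [hx, hs, hc, hB]; ring) (by rw [hx, hsc, hD]; ring)
  refine ⟨Φ, hΦ.iff_eq, ?_, fun r _ => h.hasFockChoiDecomposition hΦK hΦ' hK r, ?_⟩
  · simp only [antiBandOp_gammaConj]
    exact hΦK
  · intro n₁ n₂
    simp only [antiBandOp_gammaConj, antiBandOp_gammaC]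
    obtain ⟨l1, l2, l3, l4, l5⟩ := h.tendsto_params
    exact tendsto_antiKraus l1 l2 l3 l4 l5 n₁ n₂

end Bosonic

end

theorem mainTheorem3 :
    -- noisy (and quantum-limited) attenuator
    (∀ κ α : ℝ, 0 < κ → κ < 1 → 1 - κ ^ 2 ≤ α →
      ∃ Φ : Bosonic.traceClass →ₗ[ℂ] Bosonic.traceClass,
        (∀ Ψ, Bosonic.IsGaussianChannel (κ • 1) (α • 1) Ψ ↔ Ψ = Φ) ∧
        (∀ n₁ n₂, Summable (Bosonic.bandTerm n₁ n₂ (Bosonic.gammaAtt κ α n₁ n₂))) ∧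
        Bosonic.IsKrausRepresentation Φ
          (fun n₁ n₂ => Bosonic.bandOp n₁ n₂ (Bosonic.gammaAtt κ α n₁ n₂)) ∧
        (∀ r : ℝ, 0 ≤ r →
          (∀ n₁ n₂, Summable (Bosonic.bandTerm n₁ n₂ (Bosonic.gammaAB κ α r n₁ n₂))) ∧
          Bosonic.HasFockChoiDecomposition Φ r
            (Bosonic.squeezeMatrix (Bosonic.squeezeParam κ α r))
            (Bosonic.nuPlusAB κ α r) (Bosonic.nuMinusAB κ α r)
            (fun n₁ n₂ => Bosonic.bandOp n₁ n₂ (Bosonic.gammaAB κ α r n₁ n₂))) ∧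
        (∀ n₁ n₂, Tendsto (fun r => Bosonic.bandOp n₁ n₂ (Bosonic.gammaAB κ α r n₁ n₂)) atTop
          (𝓝 (Bosonic.bandOp n₁ n₂ (Bosonic.gammaAtt κ α n₁ n₂))))) ∧
    -- noisy (and quantum-limited) amplifier
    (∀ κ α : ℝ, 1 < κ → κ ^ 2 - 1 ≤ α →
      ∃ Φ : Bosonic.traceClass →ₗ[ℂ] Bosonic.traceClass,
        (∀ Ψ, Bosonic.IsGaussianChannel (κ • 1) (α • 1) Ψ ↔ Ψ = Φ) ∧
        (∀ n₁ n₂, Summable (Bosonic.bandTerm n₁ n₂ (Bosonic.gammaAmp κ α n₁ n₂))) ∧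
        Bosonic.IsKrausRepresentation Φ
          (fun n₁ n₂ => Bosonic.bandOp n₁ n₂ (Bosonic.gammaAmp κ α n₁ n₂)) ∧
        (∀ r : ℝ, 0 ≤ r →
          (∀ n₁ n₂, Summable (Bosonic.bandTerm n₁ n₂ (Bosonic.gammaAB κ α r n₁ n₂))) ∧
          Bosonic.HasFockChoiDecomposition Φ r
            (Bosonic.squeezeMatrix (Bosonic.squeezeParam κ α r))
            (Bosonic.nuPlusAB κ α r) (Bosonic.nuMinusAB κ α r)
            (fun n₁ n₂ => Bosonic.bandOp n₁ n₂ (Bosonic.gammaAB κ α r n₁ n₂))) ∧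
        (∀ n₁ n₂, Tendsto (fun r => Bosonic.bandOp n₁ n₂ (Bosonic.gammaAB κ α r n₁ n₂)) atTop
          (𝓝 (Bosonic.bandOp n₁ n₂ (Bosonic.gammaAmp κ α n₁ n₂))))) ∧
    -- noisy (and quantum-limited) phase conjugation
    (∀ κ α : ℝ, 0 < κ → κ ^ 2 + 1 ≤ α →
      ∃ Φ : Bosonic.traceClass →ₗ[ℂ] Bosonic.traceClass,
        (∀ Ψ, Bosonic.IsGaussianChannel (κ • Bosonic.pauli₃) (α • 1) Ψ ↔ Ψ = Φ) ∧
        Bosonic.IsKrausRepresentation Φ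
          (fun n₁ n₂ => Bosonic.antiBandOp n₁ n₂ (Bosonic.gammaConj κ α n₁ n₂)) ∧
        (∀ r : ℝ, 0 ≤ r →
          Bosonic.HasFockChoiDecomposition Φ r
            (Bosonic.beamSplitterMatrix (Bosonic.splitAngle κ α r))
            (Bosonic.nuPlusC κ α r) (Bosonic.nuMinusC κ α r)
            (fun n₁ n₂ => Bosonic.antiBandOp n₁ n₂ (Bosonic.gammaC κ α r n₁ n₂))) ∧
        (∀ n₁ n₂, Tendsto (fun r => Bosonic.antiBandOp n₁ n₂ (Bosonic.gammaC κ α r n₁ n₂)) atTop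
          (𝓝 (Bosonic.antiBandOp n₁ n₂ (Bosonic.gammaConj κ α n₁ n₂))))) := by
  exact ⟨fun _ _ h0 h1 h2 => Bosonic.attenuator h0 h1 h2,
    fun _ _ h1 h2 => Bosonic.amplifier h1 h2,
    fun _ _ h0 h2 => Bosonic.phaseConjugation h0 h2⟩
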